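/- Let $k$ be a field of characteristic zero. A *curve with modulus* over $k$ is a triple $(X,Y,Z)$, where $X$ is a smooth proper $k$-curve (not necessarily connected) and $Y,Z$ are effective divisors on $X$ with disjoint supports. For an effective divisor $D=\sum_P n_P P$ write $I_D\subset\mathcal O_X$ for its ideal sheaf and $D_{\mathrm{red}}=\sum_{n_P>0}P$. A *morphism* $(X,Y,Z)\to(X',Y',Z')$ is a $k$-morphism $f:X\to X'$ such that $Y\le f^*Y'$, $Z-Z_{\mathrm{red}}\ge f^*(Z'-Z'_{\mathrm{red}})$ and $Z_{\mathrm{red}}\ge (f^*Z')_{\mathrm{red}}$, where $f^*D'$ is the closed subscheme defined by the ideal $I_{D'}\mathcal O_X$ and the inequalities mean the corresponding inclusions of ideal sheaves (for the last one: $f^{-1}|Z'|\subset|Z|$). Put $$\mathbf H^1_{\mathrm{dR}}(X,Y,Z)=\mathbf H^1\bigl(X,[I_Y\xrightarrow{\,d\,} I_Z^{-1}\Omega^1_{X/k}]\bigr),$$ the hypercohomology of the complex of sheaves of $k$-vector spaces with $I_Y$ in degree $0$, and $$U(X,Y)=H^0(X,I_{Y_{\mathrm{red}}}/I_Y),\qquad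 V(X,Z)=H^0(X,I_{Z_{\mathrm{red}}}I_Z^{-1}/\mathcal O_X).$$ For every morphism $f:(X,Y,Z)\to(X',Y',Z')$ of curves with modulus, pullback of differential forms maps $I_{Z'}^{-1}\Omega^1_{X'/k}$ to $f_*(I_Z^{-1}\Omega^1_{X/k})$; hence $f$ induces pullback maps $f^*$ on $\mathbf H^1_{\mathrm{dR}}(X,Y,Z)$, on $\mathbf H^1_{\mathrm{dR}}(X,Y_{\mathrm{red}},Z_{\mathrm{red}})$, on $U(X,Y)$ and on $V(X,Z)$. There are $k$-linear isomorphisms $$\mathbf H^1_{\mathrm{dR}}(X,Y,Z)\;\cong\;\mathbf H^1_{\mathrm{dR}}(X,Y_{\mathrm{red}},Z_{\mathrm{red}})\oplus U(X,Y)\oplus V(X,Z),$$ one for each curve with modulus $(X,Y,Z)$, which commute with $f^*$ for every morphism $f$ of curves with modulus. Moreover they can be chosen so that the inclusion $a$ of the first summand and the projection $b$ onto it satisfy the following, all unlabelled maps being induced by the identity of $X$: the composite $\mathbf H^1_{\mathrm{dR}}(X,Y_{\mathrm{red}},Z_{\mathrm{red}})\xrightarrow{a}\mathbf H^1_{\mathrm{dR}}(X,Y,Z)\to\mathbf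 H^1_{\mathrm{dR}}(X,Y_{\mathrm{red}},Z)$ is the map $\mathbf H^1_{\mathrm{dR}}(X,Y_{\mathrm{red}},Z_{\mathrm{red}})\to\mathbf H^1_{\mathrm{dR}}(X,Y_{\mathrm{red}},Z)$, and the composite $\mathbf H^1_{\mathrm{dR}}(X,Y,Z_{\mathrm{red}})\to\mathbf H^1_{\mathrm{dR}}(X,Y,Z)\xrightarrow{b}\mathbf H^1_{\mathrm{dR}}(X,Y_{\mathrm{red}},Z_{\mathrm{red}})$ is the map $\mathbf H^1_{\mathrm{dR}}(X,Y,Z_{\mathrm{red}})\to\mathbf H^1_{\mathrm{dR}}(X,Y_{\mathrm{red}},Z_{\mathrm{red}})$. -/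

import Mathlib

open CategoryTheory CategoryTheory.Limits TopologicalSpace Opposite AlgebraicGeometry

universe u

noncomputable section

namespace CurveModulus

/-! ### Sheaves of `k`-vector spaces and hypercohomology -/

section Hypercohomology

variable (k : Type u) [Field k]

/-- The category of sheaves of `k`-vector spaces on a topological space. -/
abbrev Sh (T : TopCat.{u}) := TopCat.Sheaf (ModuleCat.{u} k) T

variable {k}

instance shLinear (T : TopCat.{u}) : Linear k (Sh k T) where
  homModule F G :=
    { smul := fun r φ => ⟨r • φ.hom⟩
      one_smul := fun φ => Sheaf.hom_ext (one_smul k φ.hom)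
      mul_smul := fun r s φ => Sheaf.hom_ext (mul_smul r s φ.hom)
      smul_zero := fun r => Sheaf.hom_ext (smul_zero (A := F.obj ⟶ G.obj) r)
      smul_add := fun r φ ψ => Sheaf.hom_ext (smul_add r φ.hom ψ.hom)
      add_smul := fun r s φ => Sheaf.hom_ext (add_smul r s φ.hom)
      zero_smul := fun φ => Sheaf.hom_ext (zero_smul k φ.hom) }
  smul_comp _ _ _ r φ ψ := Sheaf.hom_ext (Linear.smul_comp _ _ _ r φ.hom ψ.hom)
  comp_smul _ _ _ φ r ψ := Sheaf.hom_ext (Linear.comp_smul _ _ _ φ.hom r ψ.hom)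

variable {T T' : TopCat.{u}} (f : T ⟶ T')

variable (k) in
/-- Direct image `f_*` of sheaves of `k`-vector spaces. -/
abbrev pushf : Sh k T ⥤ Sh k T' := TopCat.Sheaf.pushforward (ModuleCat.{u} k) f

variable (k) in
/-- Inverse image `f⁻¹` of sheaves of `k`-vector spaces. -/
abbrev pullf : Sh k T' ⥤ Sh k T := TopCat.Sheaf.pullback (ModuleCat.{u} k) f

variable (k) in
/-- The adjunction between `f⁻¹` and `f_*`. -/
abbrev pullPush : pullf k f ⊣ pushf k f :=
  TopCat.Sheaf.pullbackPushforwardAdjunction (ModuleCat.{u} k) f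

instance : (pushf k f).Additive where
  map_add := rfl

instance : (pushf k f).Linear k where
  map_smul _ _ := rfl

instance : (pullf k f).Additive := (pullPush k f).left_adjoint_additive

instance : (pullf k f).Linear k where
  map_smul {F G} φ r := by
    apply ((pullPush k f).homEquiv _ _).injective
    rw [Adjunction.homEquiv_unit, Adjunction.homEquiv_unit, Functor.map_smul (pushf k f),
      Linear.comp_smul, Adjunction.unit_naturality, Adjunction.unit_naturality,
      Linear.smul_comp]

instance : PreservesFiniteLimits (pullf k f) := by
  have : ReflectsLimits (forget (ModuleCat.{u} k)) := reflectsLimits_of_reflectsIsomorphisms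
  have : PreservesFiniteLimits ((Opens.map f).op.lan : (_ ⥤ _ ⥤ ModuleCat.{u} k)) :=
    lan_preservesFiniteLimits_of_flat _ _
  exact Functor.sheafPullbackConstruction.preservesFiniteLimits (Opens.map f)
    (ModuleCat.{u} k) _ _

instance (T : TopCat.{u}) : HasDerivedCategory (Sh k T) := HasDerivedCategory.standard _

variable (k) in
/-- The constant sheaf with value `k`. -/
def constSheaf (T : TopCat.{u}) : Sh k T :=
  (constantSheaf (Opens.grothendieckTopology T) (ModuleCat.{u} k)).obj (ModuleCat.of k k)

variable (k) in
/-- The canonical isomorphism `f⁻¹ k ≅ k`: both sides corepresent the functor of global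
sections. -/
def constPullbackIso : (pullf k f).obj (constSheaf k T') ≅ constSheaf k T :=
  (Adjunction.leftAdjointUniq
    ((constantSheafAdj (Opens.grothendieckTopology T') (ModuleCat.{u} k) isTerminalTop).comp
      (pullPush k f))
    (constantSheafAdj (Opens.grothendieckTopology T) (ModuleCat.{u} k) isTerminalTop)).app
      (ModuleCat.of k k)

/-- The `n`-th hypercohomology `𝐇ⁿ(T, C) = Hom_{D(T)}(k, C[n])` of a complex of sheaves of
`k`-vector spaces. -/
abbrev Hyper (n : ℤ) (C : CochainComplex (Sh k T) ℤ) : Type (u + 1) :=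
  (DerivedCategory.singleFunctor (Sh k T) 0).obj (constSheaf k T) ⟶ (DerivedCategory.Q.obj C)⟦n⟧

theorem adjoint_comm {A A' : Sh k T'} {B B' : Sh k T} (p : A ⟶ (pushf k f).obj B)
    (p' : A' ⟶ (pushf k f).obj B') (a : A ⟶ A') (b : B ⟶ B')
    (h : p ≫ (pushf k f).map b = a ≫ p') :
    ((pullPush k f).homEquiv _ _).symm p ≫ b =
      (pullf k f).map a ≫ ((pullPush k f).homEquiv _ _).symm p' := by
  rw [← Adjunction.homEquiv_naturality_left_symm, ← Adjunction.homEquiv_naturality_right_symm, h]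

/-- The morphism of complexes `f⁻¹ K ⟶ L` adjoint to a morphism of complexes `K ⟶ f_* L`. -/
def adjointHom {K : CochainComplex (Sh k T') ℤ} {L : CochainComplex (Sh k T) ℤ}
    (ψ : K ⟶ ((pushf k f).mapHomologicalComplex (.up ℤ)).obj L) :
    ((pullf k f).mapHomologicalComplex (.up ℤ)).obj K ⟶ L where
  f i := ((pullPush k f).homEquiv (K.X i) (L.X i)).symm (ψ.f i)
  comm' i j _ := adjoint_comm f (ψ.f i) (ψ.f j) (K.d i j) (L.d i j) (ψ.comm i j)

/-- The map `𝐇ⁿ(T', K) → 𝐇ⁿ(T, L)` induced by a continuous map `f : T ⟶ T'` and a morphism of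
complexes `K ⟶ f_* L`: apply the exact functor `f⁻¹`, then compose with `f⁻¹ K ⟶ L`. -/
def Hyper.pull (n : ℤ) {K : CochainComplex (Sh k T') ℤ} {L : CochainComplex (Sh k T) ℤ}
    (ψ : K ⟶ ((pushf k f).mapHomologicalComplex (.up ℤ)).obj L) :
    Hyper n K →ₗ[k] Hyper n L where
  toFun c :=
    (DerivedCategory.singleFunctor (Sh k T) 0).map (constPullbackIso k f).inv ≫
      ((pullf k f).mapDerivedCategorySingleFunctor 0).inv.app (constSheaf k T') ≫
      (pullf k f).mapDerivedCategory.map c ≫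
      ((pullf k f).mapDerivedCategory.commShiftIso n).hom.app (DerivedCategory.Q.obj K) ≫
      ((pullf k f).mapDerivedCategoryFactors.hom.app K ≫
        DerivedCategory.Q.map (adjointHom f ψ))⟦n⟧'
  map_add' c c' := by
    simp only [Functor.map_add, Preadditive.add_comp, Preadditive.comp_add]
  map_smul' r c := by
    simp only [Functor.map_smul, Linear.smul_comp, Linear.comp_smul, RingHom.id_apply]

/-- The complex `[A ⟶ B]` with `A` placed in degree `0`. -/
def twoTerm {A B : Sh k T} (d : A ⟶ B) : CochainComplex (Sh k T) ℤ :=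
  HomologicalComplex.double d (c := .up ℤ) (i₀ := 0) (i₁ := 1) (by simp)

/-- The morphism `[A' ⟶ B'] ⟶ f_* [A ⟶ B]` given by a commutative square. -/
def twoTermHom {A' B' : Sh k T'} {d' : A' ⟶ B'} {A B : Sh k T} {d : A ⟶ B}
    (α : A' ⟶ (pushf k f).obj A) (β : B' ⟶ (pushf k f).obj B)
    (comm : α ≫ (pushf k f).map d = d' ≫ β) :
    twoTerm d' ⟶ ((pushf k f).mapHomologicalComplex (.up ℤ)).obj (twoTerm d) :=
  HomologicalComplex.mkHomFromDouble (by simp) (by simp)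
    (α ≫ (pushf k f).map (HomologicalComplex.doubleXIso₀ d (by simp)).inv)
    (β ≫ (pushf k f).map (HomologicalComplex.doubleXIso₁ d (by simp) (by simp)).inv)
    (by
      have h : (α ≫ (pushf k f).map (HomologicalComplex.doubleXIso₀ d (by simp)).inv) ≫
          (pushf k f).map ((twoTerm d).d 0 1) = d' ≫ β ≫
          (pushf k f).map (HomologicalComplex.doubleXIso₁ d (by simp) (by simp)).inv := by
        dsimp only [twoTerm]
        rw [HomologicalComplex.double_d d (c := .up ℤ) (i₀ := 0) (i₁ := 1) (by simp) (by simp),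
          Category.assoc, ← Functor.map_comp, Iso.inv_hom_id_assoc, Functor.map_comp,
          reassoc_of% comm]
      exact h)
    (by
      intro j hj
      have h : (β ≫ (pushf k f).map
          (HomologicalComplex.doubleXIso₁ d (by simp) (by simp)).inv) ≫
          (pushf k f).map ((twoTerm d).d 1 j) = 0 := by
        dsimp only [twoTerm]
        rw [HomologicalComplex.double_d_eq_zero₀ _ _ _ _ (by simp), Functor.map_zero, comp_zero]
        rfl
      exact h)

end Hypercohomology

/-! ### Sheaves of families of germs -/

section Germs

variable (k : Type u) [Field k]

/-- A sheaf of `k`-vector spaces on `T` whose sections over `U` are certain families of germs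
`s x ∈ germs x` indexed by the points `x` of `U ∩ dom`. -/
structure GermSheaf (T : TopCat.{u}) where
  dom : Opens T
  germs : T → ModuleCat.{u} k
  sections : ∀ U : Opens T, Submodule k (∀ x : ↥(U ⊓ dom), germs x)
  res : ∀ {U V : Opens T} (h : V ≤ U) (s : ∀ x : ↥(U ⊓ dom), germs x), s ∈ sections U →
    (fun x : ↥(V ⊓ dom) => s ⟨x, h x.2.1, x.2.2⟩) ∈ sections V
  loc : ∀ (U : Opens T) (s : ∀ x : ↥(U ⊓ dom), germs x),
    (∀ x ∈ U, ∃ (V : Opens T) (h : V ≤ U), x ∈ V ∧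
      (fun x : ↥(V ⊓ dom) => s ⟨x, h x.2.1, x.2.2⟩) ∈ sections V) → s ∈ sections U

variable {k} {T T' : TopCat.{u}}

/-- The underlying presheaf. -/
def GermSheaf.presheaf (F : GermSheaf k T) : TopCat.Presheaf (ModuleCat.{u} k) T where
  obj U := ModuleCat.of k (F.sections U.unop)
  map {U V} i := ModuleCat.ofHom
    { toFun := fun s => ⟨_, F.res i.unop.le s.1 s.2⟩
      map_add' := fun _ _ => rfl
      map_smul' := fun _ _ => rfl }

theorem GermSheaf.isSheaf (F : GermSheaf k T) : F.presheaf.IsSheaf := by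
  rw [TopCat.Presheaf.isSheaf_iff_isSheafUniqueGluing]
  intro ι U sf hsf
  have hc : ∀ (i j : ι) (x : T) (hi : x ∈ U i) (hj : x ∈ U j) (hx : x ∈ F.dom),
      (sf i).1 ⟨x, hi, hx⟩ = (sf j).1 ⟨x, hj, hx⟩ := fun i j x hi hj hx =>
    congrFun (congrArg Subtype.val (hsf i j)) ⟨x, ⟨hi, hj⟩, hx⟩
  have hm : ∀ x : ↥(iSup U ⊓ F.dom), ∃ i, (x : T) ∈ U i := fun x => Opens.mem_iSup.1 x.2.1
  choose ix hix using hm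
  have hg : ∀ (i : ι) (x : ↥(U i ⊓ F.dom)),
      (sf (ix ⟨x, Opens.mem_iSup.2 ⟨i, x.2.1⟩, x.2.2⟩)).1 ⟨x, hix _, x.2.2⟩ = (sf i).1 x :=
    fun i x => hc _ i x.1 (hix _) x.2.1 x.2.2
  refine ⟨⟨fun x => (sf (ix x)).1 ⟨x, hix x, x.2.2⟩, F.loc _ _ fun x hx => ?_⟩, ?_, ?_⟩
  · obtain ⟨i, hi⟩ := Opens.mem_iSup.1 hx
    refine ⟨U i, le_iSup U i, hi, ?_⟩
    convert (sf i).2 using 1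
    funext y
    exact hg i y
  · intro i
    apply Subtype.ext
    funext y
    exact hg i y
  · intro s hs
    apply Subtype.ext
    funext x
    exact congrFun (congrArg Subtype.val (hs (ix x))) ⟨x, hix x, x.2.2⟩

/-- The underlying sheaf. -/
def GermSheaf.sheaf (F : GermSheaf k T) : Sh k T := ⟨F.presheaf, F.isSheaf⟩

/-- The morphism of sheaves given by linear maps on germs which preserve sections. -/
def GermSheaf.hom (F G : GermSheaf k T) (hdom : G.dom ≤ F.dom)
    (φ : ∀ x : T, F.germs x →ₗ[k] G.germs x)
    (hφ : ∀ (U : Opens T), ∀ s ∈ F.sections U,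
      (fun x : ↥(U ⊓ G.dom) => φ x (s ⟨x, x.2.1, hdom x.2.2⟩)) ∈ G.sections U) :
    F.sheaf ⟶ G.sheaf :=
  ⟨{ app := fun U => ModuleCat.ofHom
      { toFun := fun s => ⟨_, hφ U.unop s.1 s.2⟩
        map_add' := fun _ _ => Subtype.ext (funext fun x => map_add (φ x) _ _)
        map_smul' := fun _ _ => Subtype.ext (funext fun x => map_smul (φ x) _ _) }
     naturality := fun _ _ _ => rfl }⟩

/-- The morphism of sheaves `F ⟶ f_* G` given by linear maps `F_{f x} → G_x` on germs which
preserve sections. -/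
def GermSheaf.pull (f : T ⟶ T') (F : GermSheaf k T') (G : GermSheaf k T)
    (hdom : ∀ x ∈ G.dom, f x ∈ F.dom)
    (φ : ∀ x : T, F.germs (f x) →ₗ[k] G.germs x)
    (hφ : ∀ (U : Opens T'), ∀ s ∈ F.sections U,
      (fun x : ↥((Opens.map f).obj U ⊓ G.dom) => φ x (s ⟨f x, x.2.1, hdom x x.2.2⟩)) ∈
        G.sections ((Opens.map f).obj U)) :
    F.sheaf ⟶ (pushf k f).obj G.sheaf :=
  ⟨{ app := fun U => ModuleCat.ofHom
      { toFun := fun s => ⟨_, hφ U.unop s.1 s.2⟩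
        map_add' := fun _ _ => Subtype.ext (funext fun x => map_add (φ x) _ _)
        map_smul' := fun _ _ => Subtype.ext (funext fun x => map_smul (φ x) _ _) }
     naturality := fun _ _ _ => rfl }⟩

end Germs

/-! ### Regular functions and Kähler differentials -/

section Kaehler

variable {k : Type u} [Field k]

/-- The map `Ω_{A/k} → Ω_{B/k}`, `a db ↦ φ(a) d(φ(b))`, induced by `φ : A → B`. -/
def kaehlerMap {A B : Type u} [CommRing A] [CommRing B] [Algebra k A] [Algebra k B]
    (φ : A →ₐ[k] B) : Ω[A⁄k] →ₗ[k] Ω[B⁄k] :=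
  letI : Algebra A B := φ.toRingHom.toAlgebra
  haveI : IsScalarTower k A B := IsScalarTower.of_algebraMap_eq fun r => (φ.commutes r).symm
  (KaehlerDifferential.map k k A B).restrictScalars k

variable {A B C : Type u} [CommRing A] [CommRing B] [CommRing C] [Algebra k A] [Algebra k B]
  [Algebra k C]

theorem kaehlerMap_D (φ : A →ₐ[k] B) (a : A) :
    kaehlerMap φ (KaehlerDifferential.D k A a) = KaehlerDifferential.D k B (φ a) :=
  let : Algebra A B := φ.toRingHom.toAlgebra
  have : IsScalarTower k A B := IsScalarTower.of_algebraMap_eq fun r => (φ.commutes r).symm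
  KaehlerDifferential.map_D k k A B a

theorem kaehlerMap_smul (φ : A →ₐ[k] B) (a : A) (θ : Ω[A⁄k]) :
    kaehlerMap φ (a • θ) = φ a • kaehlerMap φ θ := by
  let : Algebra A B := φ.toRingHom.toAlgebra
  have : IsScalarTower k A B := IsScalarTower.of_algebraMap_eq fun r => (φ.commutes r).symm
  exact ((KaehlerDifferential.map k k A B).map_smul a θ).trans (algebraMap_smul B a _).symm

theorem kaehlerMap_comp (φ : A →ₐ[k] B) (ψ : B →ₐ[k] C) (θ : Ω[A⁄k]) :
    kaehlerMap ψ (kaehlerMap φ θ) = kaehlerMap (ψ.comp φ) θ := by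
  have h : θ ∈ Submodule.span A (Set.range (KaehlerDifferential.D k A)) := by
    rw [KaehlerDifferential.span_range_derivation]; trivial
  induction h using Submodule.span_induction with
  | mem x hx => obtain ⟨a, rfl⟩ := hx; simp [kaehlerMap_D]
  | zero => simp
  | add x y _ _ hx hy => simp [hx, hy]
  | smul a x _ hx => simp [kaehlerMap_smul, hx]

end Kaehler

section Scheme

variable (k : Type u) [Field k] (X : Scheme.{u}) [X.Over (Spec (CommRingCat.of k))]

/-- The structure map `k → Γ(X, 𝒪_X)` of a `k`-scheme. -/
def scalars : k →+* Γ(X, ⊤) :=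
  (X ↘ Spec (CommRingCat.of k)).appTop.hom.comp
    (Scheme.ΓSpecIso (CommRingCat.of k)).inv.hom

variable {X}

instance sectionAlgebra (U : X.Opens) : Algebra k Γ(X, U) :=
  ((X.presheaf.map (homOfLE le_top : U ⟶ ⊤).op).hom.comp (scalars k X)).toAlgebra

instance stalkAlgebra (x : X) : Algebra k (X.presheaf.stalk x) :=
  ((X.presheaf.germ ⊤ x trivial).hom.comp (scalars k X)).toAlgebra

/-- Restriction of regular functions, as a map of `k`-algebras. -/
def resHom {U V : X.Opens} (h : V ≤ U) : Γ(X, U) →ₐ[k] Γ(X, V) :=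
  { (X.presheaf.map (homOfLE h).op).hom with
    commutes' := fun r => by
      change (X.presheaf.map (homOfLE h).op).hom
        ((X.presheaf.map (homOfLE le_top : U ⟶ ⊤).op).hom (scalars k X r)) =
        (X.presheaf.map (homOfLE le_top : V ⟶ ⊤).op).hom (scalars k X r)
      rw [← ConcreteCategory.comp_apply, ← Functor.map_comp]
      rfl }

/-- The germ of a regular function at a point, as a map of `k`-algebras. -/
def germHom {U : X.Opens} (x : X) (hx : x ∈ U) : Γ(X, U) →ₐ[k] X.presheaf.stalk x :=
  { (X.presheaf.germ U x hx).hom with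
    commutes' := fun r => X.presheaf.germ_res_apply (homOfLE le_top) x hx (scalars k X r) }

theorem germHom_comp_resHom {U V : X.Opens} (h : V ≤ U) (x : X) (hx : x ∈ V) :
    (germHom k x hx).comp (resHom k h) = germHom k x (h hx) :=
  AlgHom.ext fun a => X.presheaf.germ_res_apply (homOfLE h) x hx a

theorem germHom_resHom {U V : X.Opens} (h : V ≤ U) (x : X) (hx : x ∈ V) (a : Γ(X, U)) :
    germHom k x hx (resHom k h a) = germHom k x (h hx) a :=
  X.presheaf.germ_res_apply (homOfLE h) x hx a

variable {X' : Scheme.{u}} [X'.Over (Spec (CommRingCat.of k))] (f : X ⟶ X')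
  [f.IsOver (Spec (CommRingCat.of k))]

theorem app_scalars (r : k) : f.appTop.hom (scalars k X' r) = scalars k X r := by
  have h : f ≫ (X' ↘ Spec (CommRingCat.of k)) = X ↘ Spec (CommRingCat.of k) :=
    comp_over f (Spec (CommRingCat.of k))
  simp only [scalars, ← h, Scheme.Hom.comp_appTop]
  rfl

/-- Pullback of regular functions, as a map of `k`-algebras. -/
def appHom (U : X'.Opens) : Γ(X', U) →ₐ[k] Γ(X, f ⁻¹ᵁ U) :=
  { (f.app U).hom with
    commutes' := fun r => by
      change (f.app U).hom ((X'.presheaf.map (homOfLE le_top : U ⟶ ⊤).op).hom (scalars k X' r)) =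
        (X.presheaf.map (homOfLE le_top : f ⁻¹ᵁ U ⟶ ⊤).op).hom (scalars k X r)
      rw [← app_scalars k f r, ← ConcreteCategory.comp_apply, Scheme.Hom.naturality]
      rfl }

/-- Pullback of germs of regular functions, as a map of `k`-algebras. -/
def stalkHom (x : X) : X'.presheaf.stalk (f x) →ₐ[k] X.presheaf.stalk x :=
  { (f.stalkMap x).hom with
    commutes' := fun r => by
      change (f.stalkMap x).hom ((X'.presheaf.germ ⊤ (f x) trivial).hom (scalars k X' r)) =
        (X.presheaf.germ ⊤ x trivial).hom (scalars k X r)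
      rw [← app_scalars k f r]
      exact Scheme.Hom.germ_stalkMap_apply f ⊤ x trivial _ }

theorem stalkHom_germHom (U : X'.Opens) (x : X) (hx : f x ∈ U) (a : Γ(X', U)) :
    stalkHom k f x (germHom k (f x) hx a) =
      germHom k (U := f ⁻¹ᵁ U) x hx (appHom k f U a) :=
  Scheme.Hom.germ_stalkMap_apply f U x hx a

/-- A family of germs of functions on `V` is a regular function on `V` if it is locally given by
the germs of one section of `𝒪_X`. -/
def IsFun (V : X.Opens) (s : ∀ x : V, X.presheaf.stalk (x : X)) : Prop :=
  ∀ x ∈ V, ∃ (W : X.Opens) (_ : x ∈ W) (h : W ≤ V) (a : Γ(X, W)),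
    ∀ (y : X) (hy : y ∈ W), s ⟨y, h hy⟩ = germHom k y hy a

/-- A family of germs `ω_x ∈ Ω_{𝒪_{X,x}/k}`, `x ∈ V`, is a differential form on `V`, that is a
section of `Ω¹_X` over `V`, if it is locally given by an element of `Ω_{𝒪_X(W)/k}`. -/
def IsForm (V : X.Opens) (ω : ∀ x : V, Ω[X.presheaf.stalk (x : X)⁄k]) : Prop :=
  ∀ x ∈ V, ∃ (W : X.Opens) (_ : x ∈ W) (h : W ≤ V) (θ : Ω[Γ(X, W)⁄k]),
    ∀ (y : X) (hy : y ∈ W), ω ⟨y, h hy⟩ = kaehlerMap (germHom k y hy) θ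

variable {k}

theorem IsFun.res {V V' : X.Opens} (h : V' ≤ V) {s : ∀ x : V, X.presheaf.stalk (x : X)}
    (hs : IsFun k V s) : IsFun k V' fun x => s ⟨x, h x.2⟩ := by
  intro x hx
  obtain ⟨W, hxW, hW, a, ha⟩ := hs x (h hx)
  refine ⟨W ⊓ V', ⟨hxW, hx⟩, inf_le_right, resHom k inf_le_left a, fun y hy => ?_⟩
  rw [germHom_resHom]
  exact ha y hy.1

theorem IsFun.add {V : X.Opens} {s t : ∀ x : V, X.presheaf.stalk (x : X)}
    (hs : IsFun k V s) (ht : IsFun k V t) : IsFun k V (s + t) := by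
  intro x hx
  obtain ⟨W, hxW, hW, a, ha⟩ := hs x hx
  obtain ⟨W', hxW', hW', a', ha'⟩ := ht x hx
  refine ⟨W ⊓ W', ⟨hxW, hxW'⟩, inf_le_left.trans hW,
    resHom k inf_le_left a + resHom k inf_le_right a', fun y hy => ?_⟩
  rw [map_add, germHom_resHom, germHom_resHom, ← ha y hy.1, ← ha' y hy.2]
  rfl

theorem IsFun.smul {V : X.Opens} {s : ∀ x : V, X.presheaf.stalk (x : X)} (r : k)
    (hs : IsFun k V s) : IsFun k V (r • s) := by
  intro x hx
  obtain ⟨W, hxW, hW, a, ha⟩ := hs x hx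
  refine ⟨W, hxW, hW, r • a, fun y hy => ?_⟩
  rw [map_smul, ← ha y hy]
  rfl

theorem IsFun.zero (V : X.Opens) : IsFun k V 0 :=
  fun x hx => ⟨V, hx, le_rfl, 0, fun y hy => (map_zero (germHom k y hy)).symm⟩

theorem IsFun.loc {V : X.Opens} {s : ∀ x : V, X.presheaf.stalk (x : X)}
    (hs : ∀ x ∈ V, ∃ (V' : X.Opens) (h : V' ≤ V), x ∈ V' ∧ IsFun k V' fun x => s ⟨x, h x.2⟩) :
    IsFun k V s := by
  intro _ hx
  obtain ⟨V', h, hx', hs'⟩ := hs _ hx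
  obtain ⟨W, hxW, hW, a, ha⟩ := hs' _ hx'
  exact ⟨W, hxW, hW.trans h, a, ha⟩

theorem IsForm.res {V V' : X.Opens} (h : V' ≤ V) {s : ∀ x : V, Ω[X.presheaf.stalk (x : X)⁄k]}
    (hs : IsForm k V s) : IsForm k V' fun x => s ⟨x, h x.2⟩ := by
  intro x hx
  obtain ⟨W, hxW, hW, a, ha⟩ := hs x (h hx)
  refine ⟨W ⊓ V', ⟨hxW, hx⟩, inf_le_right, kaehlerMap (resHom k inf_le_left) a, fun y hy => ?_⟩
  rw [kaehlerMap_comp, germHom_comp_resHom]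
  exact ha y hy.1

theorem IsForm.add {V : X.Opens} {s t : ∀ x : V, Ω[X.presheaf.stalk (x : X)⁄k]}
    (hs : IsForm k V s) (ht : IsForm k V t) : IsForm k V (s + t) := by
  intro x hx
  obtain ⟨W, hxW, hW, a, ha⟩ := hs x hx
  obtain ⟨W', hxW', hW', a', ha'⟩ := ht x hx
  refine ⟨W ⊓ W', ⟨hxW, hxW'⟩, inf_le_left.trans hW,
    kaehlerMap (resHom k inf_le_left) a + kaehlerMap (resHom k inf_le_right) a', fun y hy => ?_⟩
  rw [map_add, kaehlerMap_comp, germHom_comp_resHom, kaehlerMap_comp, germHom_comp_resHom,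
    ← ha y hy.1, ← ha' y hy.2]
  rfl

theorem IsForm.smul {V : X.Opens} {s : ∀ x : V, Ω[X.presheaf.stalk (x : X)⁄k]} (r : k)
    (hs : IsForm k V s) : IsForm k V (r • s) := by
  intro x hx
  obtain ⟨W, hxW, hW, a, ha⟩ := hs x hx
  refine ⟨W, hxW, hW, r • a, fun y hy => ?_⟩
  rw [map_smul, ← ha y hy]
  rfl

theorem IsForm.zero (V : X.Opens) : IsForm k V 0 :=
  fun x hx => ⟨V, hx, le_rfl, 0, fun y hy => (map_zero (kaehlerMap (germHom k y hy))).symm⟩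

theorem IsForm.loc {V : X.Opens} {s : ∀ x : V, Ω[X.presheaf.stalk (x : X)⁄k]}
    (hs : ∀ x ∈ V, ∃ (V' : X.Opens) (h : V' ≤ V), x ∈ V' ∧ IsForm k V' fun x => s ⟨x, h x.2⟩) :
    IsForm k V s := by
  intro _ hx
  obtain ⟨V', h, hx', hs'⟩ := hs _ hx
  obtain ⟨W, hxW, hW, a, ha⟩ := hs' _ hx'
  exact ⟨W, hxW, hW.trans h, a, ha⟩

theorem IsFun.d {V : X.Opens} {s : ∀ x : V, X.presheaf.stalk (x : X)} (hs : IsFun k V s) :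
    IsForm k V fun x => KaehlerDifferential.D k _ (s x) := by
  intro x hx
  obtain ⟨W, hxW, hW, a, ha⟩ := hs x hx
  refine ⟨W, hxW, hW, KaehlerDifferential.D k _ a, fun y hy => ?_⟩
  rw [kaehlerMap_D, ← ha y hy]

theorem IsFun.pull {V : X'.Opens} {s : ∀ x : V, X'.presheaf.stalk (x : X')} (hs : IsFun k V s) :
    IsFun k (f ⁻¹ᵁ V) fun x => stalkHom k f x (s ⟨f x, x.2⟩) := by
  intro x hx
  obtain ⟨W, hxW, hW, a, ha⟩ := hs (f x) hx
  refine ⟨f ⁻¹ᵁ W, hxW, fun y hy => hW hy, appHom k f W a, fun y hy => ?_⟩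
  exact (congrArg (stalkHom k f y) (ha (f y) hy)).trans (stalkHom_germHom k f W y hy a)

end Scheme

/-! ### Effective divisors and the sheaves attached to them -/

section Divisors

/-- An effective divisor `D = ∑ n_P P` on a curve: a finite linear combination of closed points
with coefficients in `ℕ`. -/
structure EffectiveDivisor (X : Scheme.{u}) where
  mult : X →₀ ℕ
  isClosed_singleton : ∀ x, mult x ≠ 0 → IsClosed ({x} : Set X)

namespace EffectiveDivisor

variable {X : Scheme.{u}} (D : EffectiveDivisor X)

/-- The zero divisor. -/
def zero (X : Scheme.{u}) : EffectiveDivisor X := ⟨0, fun _ h => absurd rfl h⟩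

/-- `D_red = ∑_{P ∈ |D|} P`. -/
def red : EffectiveDivisor X where
  mult := D.mult.mapRange (min 1) rfl
  isClosed_singleton x hx := D.isClosed_singleton x fun h => hx (by simp [h])

/-- `D - D_red = ∑_{P ∈ |D|} (n_P - 1) P`. -/
def subRed : EffectiveDivisor X where
  mult := D.mult.mapRange (· - 1) rfl
  isClosed_singleton x hx := D.isClosed_singleton x fun h => hx (by simp [h])

/-- The open complement `X ∖ |D|` of the support of `D`. -/
def compl : X.Opens :=
  ⟨{x | D.mult x = 0}, by
    have h : {x | D.mult x = 0} = (⋃ x ∈ D.mult.support, {x})ᶜ := by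
      ext y
      simp only [Set.mem_ofPred_eq, Set.mem_compl_iff, Set.mem_iUnion, Finsupp.mem_support_iff,
        Set.mem_singleton_iff, exists_prop, not_exists, not_and]
      exact ⟨fun h x hx hy => hx (hy ▸ h), fun h => by_contra fun hy => h y hy rfl⟩
    rw [h, isOpen_compl_iff]
    exact Set.Finite.isClosed_biUnion D.mult.support.finite_toSet fun x hx =>
      D.isClosed_singleton x (by simpa using hx)⟩

/-- The stalk `𝔪_x ^ n_x` at `x` of the ideal sheaf `I_D` of `D`. -/
def idealAt (x : X) : Ideal (X.presheaf.stalk x) :=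
  IsLocalRing.maximalIdeal (X.presheaf.stalk x) ^ D.mult x

/-- The stalk at `x` of the ideal sheaf of the pullback `f^* D'`, the ideal generated by the
pullbacks of the germs at `f x` of functions in `I_{D'}`. -/
def pullIdealAt {X' : Scheme.{u}} (f : X ⟶ X') (D' : EffectiveDivisor X') (x : X) :
    Ideal (X.presheaf.stalk x) :=
  (D'.idealAt (f x)).map (f.stalkMap x).hom

variable (k : Type u) [Field k] [X.Over (Spec (CommRingCat.of k))]

/-- The ideal sheaf `I_D` of `D`. -/
def ideal : GermSheaf k X.toPresheafedSpace.carrier where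
  dom := ⊤
  germs x := ModuleCat.of k (X.presheaf.stalk x)
  sections U :=
    { carrier := {s : ∀ x : ↥(U ⊓ (⊤ : X.Opens)), X.presheaf.stalk (x : X) |
        IsFun k (U ⊓ ⊤) s ∧ ∀ x : ↥(U ⊓ (⊤ : X.Opens)), s x ∈ D.idealAt x}
      add_mem' := fun hs ht => ⟨hs.1.add ht.1, fun x => add_mem (hs.2 x) (ht.2 x)⟩
      zero_mem' := ⟨IsFun.zero _, fun x => zero_mem _⟩
      smul_mem' := fun r s hs => ⟨hs.1.smul r, fun x => by
        have h := Ideal.mul_mem_left (D.idealAt x) (algebraMap k _ r) (hs.2 x)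
        rwa [← Algebra.smul_def] at h⟩ }
  res h s hs := ⟨hs.1.res (inf_le_inf_right _ h), fun x => hs.2 ⟨x, h x.2.1, x.2.2⟩⟩
  loc U s hs := by
    refine ⟨IsFun.loc fun x hx => ?_, fun x => ?_⟩
    · obtain ⟨V, h, hxV, hs'⟩ := hs x hx.1
      exact ⟨V ⊓ ⊤, inf_le_inf_right _ h, ⟨hxV, trivial⟩, hs'.1⟩
    · obtain ⟨V, h, hxV, hs'⟩ := hs x x.2.1
      exact hs'.2 ⟨x, hxV, trivial⟩

/-- The sheaf `I_D⁻¹` of functions `g` with poles bounded by `D`, where `|D| ⊆ |Z|`: functions `g`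
on `U ∖ |Z|` such that `a g` extends to a regular function near `x`, for every `x` and
every function `a` near `x` with germ in `I_{D,x}`. -/
def invIdeal (Z D : EffectiveDivisor X) : GermSheaf k X.toPresheafedSpace.carrier where
  dom := Z.compl
  germs x := ModuleCat.of k (X.presheaf.stalk x)
  sections U :=
    { carrier := {g : ∀ x : ↥(U ⊓ Z.compl), X.presheaf.stalk (x : X) |
        IsFun k (U ⊓ Z.compl) g ∧
        ∀ (W : X.Opens) (hW : W ≤ U) (a : Γ(X, W)) (x : X) (hx : x ∈ W),
          germHom k x hx a ∈ D.idealAt x →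
          ∃ (W' : X.Opens) (hW' : W' ≤ W) (_ : x ∈ W') (b : Γ(X, W')),
            ∀ (y : X) (hy : y ∈ W') (hyZ : y ∈ Z.compl),
              germHom k y (hW' hy) a * g ⟨y, hW (hW' hy), hyZ⟩ = germHom k y hy b}
      add_mem' := by
        rintro g g' ⟨hg, hg2⟩ ⟨hg', hg2'⟩
        refine ⟨hg.add hg', fun W hW a x hx ha => ?_⟩
        obtain ⟨V, hV, hxV, b, hb⟩ := hg2 W hW a x hx ha
        obtain ⟨V', hV', hxV', b', hb'⟩ := hg2' W hW a x hx ha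
        refine ⟨V ⊓ V', inf_le_left.trans hV, ⟨hxV, hxV'⟩,
          resHom k inf_le_left b + resHom k inf_le_right b', fun y hy hyZ => ?_⟩
        rw [map_add, germHom_resHom, germHom_resHom, ← hb y hy.1 hyZ, ← hb' y hy.2 hyZ, ← mul_add]
        rfl
      zero_mem' := ⟨IsFun.zero _, fun W hW a x hx ha => ⟨W, le_rfl, hx, 0, fun y hy hyZ => by
        rw [map_zero]; exact mul_zero _⟩⟩
      smul_mem' := by
        rintro r g ⟨hg, hg2⟩
        refine ⟨hg.smul r, fun W hW a x hx ha => ?_⟩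
        obtain ⟨V, hV, hxV, b, hb⟩ := hg2 W hW a x hx ha
        refine ⟨V, hV, hxV, r • b, fun y hy hyZ => ?_⟩
        rw [map_smul, ← hb y hy hyZ, ← mul_smul_comm]
        rfl }
  res h g hg := ⟨hg.1.res (inf_le_inf_right _ h), fun W hW => hg.2 W (hW.trans h)⟩
  loc U g hg := by
    refine ⟨IsFun.loc fun x hx => ?_, fun W hW a x hx ha => ?_⟩
    · obtain ⟨V, h, hxV, hs'⟩ := hg x hx.1
      exact ⟨V ⊓ Z.compl, inf_le_inf_right _ h, ⟨hxV, hx.2⟩, hs'.1⟩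
    · obtain ⟨V, h, hxV, hs'⟩ := hg x (hW hx)
      obtain ⟨W', hW', hxW', b, hb⟩ := hs'.2 (W ⊓ V) inf_le_right (resHom k inf_le_left a) x
        ⟨hx, hxV⟩ (Set.mem_of_eq_of_mem (germHom_resHom k inf_le_left x ⟨hx, hxV⟩ a) ha)
      refine ⟨W', hW'.trans inf_le_left, hxW', b, fun y hy hyZ => ?_⟩
      rw [← hb y hy hyZ, germHom_resHom]

/-- The sheaf `I_Z⁻¹ Ω¹_X` of differential forms with poles bounded by `Z`: forms `ω` on `U ∖ |Z|`
such that `a ω` extends to a regular form near `x`, for every `x` and every function `a` near `x`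
with germ in `I_{Z,x}`. -/
def polarForms (Z : EffectiveDivisor X) : GermSheaf k X.toPresheafedSpace.carrier where
  dom := Z.compl
  germs x := ModuleCat.of k Ω[X.presheaf.stalk x⁄k]
  sections U :=
    { carrier := {ω : ∀ x : ↥(U ⊓ Z.compl), Ω[X.presheaf.stalk (x : X)⁄k] |
        IsForm k (U ⊓ Z.compl) ω ∧
        ∀ (W : X.Opens) (hW : W ≤ U) (a : Γ(X, W)) (x : X) (hx : x ∈ W),
          germHom k x hx a ∈ Z.idealAt x →
          ∃ (W' : X.Opens) (hW' : W' ≤ W) (_ : x ∈ W') (θ : Ω[Γ(X, W')⁄k]),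
            ∀ (y : X) (hy : y ∈ W') (hyZ : y ∈ Z.compl),
              germHom k y (hW' hy) a • ω ⟨y, hW (hW' hy), hyZ⟩ = kaehlerMap (germHom k y hy) θ}
      add_mem' := by
        rintro g g' ⟨hg, hg2⟩ ⟨hg', hg2'⟩
        refine ⟨hg.add hg', fun W hW a x hx ha => ?_⟩
        obtain ⟨V, hV, hxV, b, hb⟩ := hg2 W hW a x hx ha
        obtain ⟨V', hV', hxV', b', hb'⟩ := hg2' W hW a x hx ha
        refine ⟨V ⊓ V', inf_le_left.trans hV, ⟨hxV, hxV'⟩,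
          kaehlerMap (resHom k inf_le_left) b + kaehlerMap (resHom k inf_le_right) b',
          fun y hy hyZ => ?_⟩
        rw [map_add, kaehlerMap_comp, kaehlerMap_comp, germHom_comp_resHom, germHom_comp_resHom,
          ← hb y hy.1 hyZ, ← hb' y hy.2 hyZ, ← smul_add]
        rfl
      zero_mem' := ⟨IsForm.zero _, fun W hW a x hx ha => ⟨W, le_rfl, hx, 0, fun y hy hyZ => by
        rw [map_zero]; exact smul_zero _⟩⟩
      smul_mem' := by
        rintro r g ⟨hg, hg2⟩
        refine ⟨hg.smul r, fun W hW a x hx ha => ?_⟩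
        obtain ⟨V, hV, hxV, b, hb⟩ := hg2 W hW a x hx ha
        refine ⟨V, hV, hxV, r • b, fun y hy hyZ => ?_⟩
        rw [map_smul, ← hb y hy hyZ, smul_comm r]
        rfl }
  res h g hg := ⟨hg.1.res (inf_le_inf_right _ h), fun W hW => hg.2 W (hW.trans h)⟩
  loc U g hg := by
    refine ⟨IsForm.loc fun x hx => ?_, fun W hW a x hx ha => ?_⟩
    · obtain ⟨V, h, hxV, hs'⟩ := hg x hx.1
      exact ⟨V ⊓ Z.compl, inf_le_inf_right _ h, ⟨hxV, hx.2⟩, hs'.1⟩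
    · obtain ⟨V, h, hxV, hs'⟩ := hg x (hW hx)
      obtain ⟨W', hW', hxW', b, hb⟩ := hs'.2 (W ⊓ V) inf_le_right (resHom k inf_le_left a) x
        ⟨hx, hxV⟩ (Set.mem_of_eq_of_mem (germHom_resHom k inf_le_left x ⟨hx, hxV⟩ a) ha)
      refine ⟨W', hW'.trans inf_le_left, hxW', b, fun y hy hyZ => ?_⟩
      rw [← hb y hy hyZ, germHom_resHom]

variable {k}

/-- The inclusion `I_D ⊆ I_E` for `E ≤ D`. -/
def idealIncl (D E : EffectiveDivisor X) (h : ∀ x, D.idealAt x ≤ E.idealAt x) :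
    (D.ideal k).sheaf ⟶ (E.ideal k).sheaf :=
  GermSheaf.hom _ _ le_rfl (fun _ => LinearMap.id)
    fun _ _ hs => ⟨hs.1, fun x => h x (hs.2 x)⟩

/-- The inclusion `𝒪_X = I_0 ⊆ I_D⁻¹`. -/
def toInvIdeal (Z D : EffectiveDivisor X) :
    ((zero X).ideal k).sheaf ⟶ (invIdeal k Z D).sheaf :=
  GermSheaf.hom _ _ le_top (fun _ => LinearMap.id) fun U s hs => by
    refine ⟨hs.1.res (inf_le_inf_left _ le_top), fun W hW a x hx _ => ?_⟩
    obtain ⟨V, hxV, _, b, hb⟩ := hs.1 x ⟨hW hx, trivial⟩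
    refine ⟨W ⊓ V, inf_le_left, ⟨hx, hxV⟩, resHom k inf_le_left a * resHom k inf_le_right b,
      fun y hy hyZ => ?_⟩
    rw [map_mul, germHom_resHom, germHom_resHom, ← hb y hy.2]
    rfl

/-- The differential `d : I_Y → I_Z⁻¹ Ω¹_X`. -/
def diff (Y Z : EffectiveDivisor X) : (Y.ideal k).sheaf ⟶ (polarForms k Z).sheaf :=
  GermSheaf.hom _ _ le_top
    (fun x => ((KaehlerDifferential.D k (X.presheaf.stalk x) :
      Derivation k (X.presheaf.stalk x) Ω[X.presheaf.stalk x⁄k]) :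
        X.presheaf.stalk x →ₗ[k] Ω[X.presheaf.stalk x⁄k])) fun U s hs => by
    refine ⟨hs.1.d.res (inf_le_inf_left _ le_top), fun W hW a x hx _ => ?_⟩
    obtain ⟨V, hxV, _, b, hb⟩ := hs.1 x ⟨hW hx, trivial⟩
    refine ⟨W ⊓ V, inf_le_left, ⟨hx, hxV⟩,
      resHom k (V := W ⊓ V) inf_le_left a •
        KaehlerDifferential.D k Γ(X, W ⊓ V) (resHom k inf_le_right b),
      fun y hy hyZ => ?_⟩
    rw [kaehlerMap_smul, kaehlerMap_D, germHom_resHom, germHom_resHom, ← hb y hy.2]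
    rfl

section Pullback

variable {X' : Scheme.{u}} [X'.Over (Spec (CommRingCat.of k))] (f : X ⟶ X')
  [f.IsOver (Spec (CommRingCat.of k))]

/-- The pullback of functions `I_{D'} → f_* I_D` when `D ≤ f^* D'`. -/
def idealPull (D' : EffectiveDivisor X') (D : EffectiveDivisor X)
    (h : ∀ x, pullIdealAt f D' x ≤ D.idealAt x) :
    (D'.ideal k).sheaf ⟶ (pushf k f.base).obj (D.ideal k).sheaf :=
  GermSheaf.pull f.base (D'.ideal k) (D.ideal k) (fun _ _ => trivial) (fun x => (stalkHom k f x).toLinearMap)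
    fun U _ hs => ⟨IsFun.res (V := f ⁻¹ᵁ (U ⊓ ⊤)) (V' := f ⁻¹ᵁ U ⊓ ⊤)
      (fun _ hx => ⟨hx.1, trivial⟩) (IsFun.pull f hs.1),
      fun x => h x (Ideal.mem_map_of_mem (f.stalkMap x).hom (hs.2 ⟨f x, x.2.1, trivial⟩))⟩

theorem invIdeal_pull (Z' D' : EffectiveDivisor X') (Z D : EffectiveDivisor X)
    (hZ : ∀ x ∈ Z.compl, f x ∈ Z'.compl)
    (h : ∀ x, D.idealAt x ≤ pullIdealAt f D' x) (U : X'.Opens)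
    (s : ∀ x : ↥(U ⊓ Z'.compl), X'.presheaf.stalk (x : X'))
    (hs : s ∈ (invIdeal k Z' D').sections U) :
    (fun x : ↥(f ⁻¹ᵁ U ⊓ Z.compl) => stalkHom k f x (s ⟨f x, x.2.1, hZ x x.2.2⟩)) ∈
      (invIdeal k Z D).sections (f ⁻¹ᵁ U) := by
  refine ⟨IsFun.res (V := f ⁻¹ᵁ (U ⊓ Z'.compl)) (V' := f ⁻¹ᵁ U ⊓ Z.compl)
    (fun x hx => ⟨hx.1, hZ x hx.2⟩) (IsFun.pull f hs.1),
    fun W hW a x hx ha => ?_⟩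
  -- the germs `c` at `x` for which the assertion holds form an ideal
  have key : ∀ c ∈ pullIdealAt f D' x, ∃ (W' : X.Opens) (hW' : W' ≤ W) (hxW' : x ∈ W')
      (a' b : Γ(X, W')), germHom k x hxW' a' = c ∧
      ∀ (y : X) (hy : y ∈ W') (hyZ : y ∈ Z.compl),
        germHom k y hy a' * stalkHom k f y (s ⟨f y, hW (hW' hy), hZ y hyZ⟩) =
          germHom k y hy b := by
    intro c hc
    induction hc using Submodule.span_induction with
    | mem c hc =>
      obtain ⟨g, hg, rfl⟩ := hc
      obtain ⟨V, hxV, a₀, rfl⟩ := X'.presheaf.exists_germ_eq g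
      obtain ⟨V', hV', hxV', b, hb⟩ := hs.2 (V ⊓ U) inf_le_right
        (resHom k inf_le_left a₀) (f x) ⟨hxV, hW hx⟩
        (Set.mem_of_eq_of_mem (germHom_resHom k inf_le_left (f x) ⟨hxV, hW hx⟩ a₀) hg)
      have hm : x ∈ W ⊓ f ⁻¹ᵁ V' := ⟨hx, hxV'⟩
      refine ⟨W ⊓ f ⁻¹ᵁ V', inf_le_left, hm,
        resHom k inf_le_right (appHom k f V' (resHom k (hV'.trans inf_le_left) a₀)),
        resHom k inf_le_right (appHom k f V' b), ?_, fun y hy hyZ => ?_⟩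
      · rw [germHom_resHom]
        refine (stalkHom_germHom k f V' x hxV' _).symm.trans ?_
        rw [germHom_resHom]
        rfl
      · rw [germHom_resHom, germHom_resHom]
        have h1 := congrArg (stalkHom k f y) (hb (f y) hy.2 (hZ y hyZ))
        rw [map_mul, germHom_resHom] at h1
        refine Eq.trans ?_ (h1.trans (stalkHom_germHom k f V' y hy.2 b))
        congr 1
        refine (stalkHom_germHom k f V' y hy.2 _).symm.trans ?_
        exact congrArg (stalkHom k f y) (germHom_resHom k _ (f y) hy.2 a₀)
    | zero => exact ⟨W, le_rfl, hx, 0, 0, map_zero _, fun y hy hyZ => by simp⟩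
    | add c c' _ _ hc hc' =>
      obtain ⟨V, hV, hxV, a₁, b₁, h₁, h₁'⟩ := hc
      obtain ⟨V', hV', hxV', a₂, b₂, h₂, h₂'⟩ := hc'
      have hm : x ∈ V ⊓ V' := ⟨hxV, hxV'⟩
      refine ⟨V ⊓ V', inf_le_left.trans hV, hm,
        resHom k inf_le_left a₁ + resHom k inf_le_right a₂,
        resHom k inf_le_left b₁ + resHom k inf_le_right b₂, ?_, fun y hy hyZ => ?_⟩
      · rw [map_add, germHom_resHom, germHom_resHom, h₁, h₂]
      · rw [map_add, map_add, germHom_resHom, germHom_resHom, germHom_resHom, germHom_resHom,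
          ← h₁' y hy.1 hyZ, ← h₂' y hy.2 hyZ, add_mul]
    | smul r c _ hc =>
      obtain ⟨V, hV, hxV, a₁, b₁, h₁, h₁'⟩ := hc
      obtain ⟨V', hxV', r₀, rfl⟩ := X.presheaf.exists_germ_eq r
      have hm : x ∈ V ⊓ V' := ⟨hxV, hxV'⟩
      refine ⟨V ⊓ V', inf_le_left.trans hV, hm,
        resHom k inf_le_right r₀ * resHom k inf_le_left a₁,
        resHom k inf_le_right r₀ * resHom k inf_le_left b₁, ?_, fun y hy hyZ => ?_⟩
      · rw [map_mul, germHom_resHom, germHom_resHom, h₁]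
        rfl
      · rw [map_mul, map_mul, germHom_resHom, germHom_resHom, germHom_resHom,
          ← h₁' y hy.1 hyZ, mul_assoc]
  obtain ⟨W', hW', hxW', a', b, h₁, h₂⟩ := key _ (h x ha)
  obtain ⟨W'', hxW'', i, j, hij⟩ := X.presheaf.germ_eq x hxW' hx a' a h₁
  refine ⟨W'', j.le, hxW'', resHom k i.le b, fun y hy hyZ => ?_⟩
  have h3 : germHom k y (i.le hy) a' = germHom k y (j.le hy) a := by
    have h4 := congrArg (germHom k y hy) hij
    exact (germHom_resHom k i.le y hy a').symm.trans (h4.trans (germHom_resHom k j.le y hy a))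
  rw [germHom_resHom, ← h₂ y (i.le hy) hyZ, h3]

/-- The pullback of functions `I_{D'}⁻¹ → f_* I_D⁻¹` when `D ≥ f^* D'` and `f⁻¹ |Z'| ⊆ |Z|`. -/
def invIdealPull (Z' D' : EffectiveDivisor X') (Z D : EffectiveDivisor X)
    (hZ : ∀ x ∈ Z.compl, f x ∈ Z'.compl)
    (h : ∀ x, D.idealAt x ≤ pullIdealAt f D' x) :
    (invIdeal k Z' D').sheaf ⟶ (pushf k f.base).obj (invIdeal k Z D).sheaf :=
  GermSheaf.pull f.base (invIdeal k Z' D') (invIdeal k Z D) hZ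
    (fun x => (stalkHom k f x).toLinearMap) (invIdeal_pull f Z' D' Z D hZ h)

/-- Pullback of differential forms along `f` maps `I_{Z'}⁻¹ Ω¹_{X'}` to `f_* (I_Z⁻¹ Ω¹_X)`. -/
def PullsBackForms (Z' : EffectiveDivisor X') (Z : EffectiveDivisor X)
    (hZ : ∀ x ∈ Z.compl, f x ∈ Z'.compl) : Prop :=
  ∀ (U : X'.Opens) (ω : ∀ x : ↥(U ⊓ Z'.compl), Ω[X'.presheaf.stalk (x : X')⁄k]),
    ω ∈ (polarForms k Z').sections U →
    (fun x : ↥(f ⁻¹ᵁ U ⊓ Z.compl) =>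
      kaehlerMap (stalkHom k f x) (ω ⟨f x, x.2.1, hZ x x.2.2⟩)) ∈
        (polarForms k Z).sections (f ⁻¹ᵁ U)

/-- The pullback of differential forms `I_{Z'}⁻¹ Ω¹_{X'} → f_* (I_Z⁻¹ Ω¹_X)`. -/
def formsPull (Z' : EffectiveDivisor X') (Z : EffectiveDivisor X)
    (hZ : ∀ x ∈ Z.compl, f x ∈ Z'.compl) (h : PullsBackForms (k := k) f Z' Z hZ) :
    (polarForms k Z').sheaf ⟶ (pushf k f.base).obj (polarForms k Z).sheaf :=
  GermSheaf.pull f.base (polarForms k Z') (polarForms k Z) hZ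
    (fun x => kaehlerMap (stalkHom k f x)) h

theorem diff_pull (Y' Z' : EffectiveDivisor X') (Y Z : EffectiveDivisor X)
    (hY : ∀ x, pullIdealAt f Y' x ≤ Y.idealAt x)
    (hZ : ∀ x ∈ Z.compl, f x ∈ Z'.compl) (h : PullsBackForms (k := k) f Z' Z hZ) :
    idealPull f Y' Y hY ≫ (pushf k f.base).map (diff Y Z) =
      diff (k := k) Y' Z' ≫ formsPull f Z' Z hZ h := by
  apply Sheaf.hom_ext
  ext U s
  apply Subtype.ext
  funext x
  exact (kaehlerMap_D (stalkHom k f x) _).symm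

end Pullback

end EffectiveDivisor

end Divisors

/-! ### Curves with modulus -/

/-- A `k`-curve with modulus `(X, Y, Z)`: a smooth proper `k`-curve `X` (not necessarily connected)
with two effective divisors `Y`, `Z` whose supports are disjoint. -/
structure CurveWithModulus (k : Type u) [Field k] where
  X : Scheme.{u}
  [str : X.Over (Spec (CommRingCat.of k))]
  smooth : SmoothOfRelativeDimension 1 (X ↘ Spec (CommRingCat.of k))
  proper : IsProper (X ↘ Spec (CommRingCat.of k))
  Y : EffectiveDivisor X
  Z : EffectiveDivisor X
  disjoint : ∀ x, Y.mult x = 0 ∨ Z.mult x = 0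

attribute [instance] CurveWithModulus.str

namespace CurveWithModulus

open EffectiveDivisor

variable {k : Type u} [Field k]

/-- A morphism `(X, Y, Z) ⟶ (X', Y', Z')` of curves with modulus. An inequality `D ≤ E` between
effective divisors is expressed by the inclusion `I_E ⊆ I_D` of ideal sheaves. -/
@[ext]
structure Hom (P Q : CurveWithModulus k) where
  toHom : P.X ⟶ Q.X
  isOver : toHom.IsOver (Spec (CommRingCat.of k))
  /-- `Y ≤ f^* Y'`. -/
  Y_le : ∀ x, pullIdealAt toHom Q.Y x ≤ P.Y.idealAt x
  /-- `Z - Z_red ≥ f^* (Z' - Z'_red)`. -/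
  Z_sub_red_ge : ∀ x, P.Z.subRed.idealAt x ≤ pullIdealAt toHom Q.Z.subRed x
  /-- `Z_red ≥ (f^* Z')_red`, that is, `f⁻¹ |Z'| ⊆ |Z|`. -/
  Z_red_ge : ∀ x, Q.Z.mult (toHom x) ≠ 0 → P.Z.mult x ≠ 0

attribute [instance] Hom.isOver

theorem pullIdealAt_id {X : Scheme.{u}} (D : EffectiveDivisor X) (x : X) :
    pullIdealAt (𝟙 X) D x = D.idealAt x := by
  have h : (Scheme.Hom.stalkMap (𝟙 X) x).hom = RingHom.id _ := by
    rw [Scheme.Hom.stalkMap_id]; rfl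
  unfold pullIdealAt
  rw [h]
  exact Ideal.map_id _

theorem pullIdealAt_comp {X X' X'' : Scheme.{u}} (f : X ⟶ X') (g : X' ⟶ X'')
    (D : EffectiveDivisor X'') (x : X) :
    pullIdealAt (f ≫ g) D x = (pullIdealAt g D (f x)).map (f.stalkMap x).hom := by
  unfold pullIdealAt
  rw [Scheme.Hom.stalkMap_comp, Ideal.map_map]
  rfl

instance : Category (CurveWithModulus k) where
  Hom := Hom
  id P :=
    { toHom := 𝟙 P.X
      isOver := inferInstance
      Y_le := fun x => (pullIdealAt_id _ x).le
      Z_sub_red_ge := fun x => (pullIdealAt_id _ x).ge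
      Z_red_ge := fun _ h => h }
  comp {P Q R} f g :=
    { toHom := f.toHom ≫ g.toHom
      isOver := inferInstance
      Y_le := fun x => (pullIdealAt_comp _ _ _ x).le.trans
        ((Ideal.map_mono (g.Y_le (f.toHom x))).trans (f.Y_le x))
      Z_sub_red_ge := fun x => ((f.Z_sub_red_ge x).trans
        (Ideal.map_mono (g.Z_sub_red_ge (f.toHom x)))).trans (pullIdealAt_comp _ _ _ x).ge
      Z_red_ge := fun x h => f.Z_red_ge x (g.Z_red_ge (f.toHom x) h) }
  id_comp f := Hom.ext (Category.id_comp f.toHom)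
  comp_id f := Hom.ext (Category.comp_id f.toHom)
  assoc f g h := Hom.ext (Category.assoc f.toHom g.toHom h.toHom)

theorem Hom.map_compl {P Q : CurveWithModulus k} (f : P ⟶ Q) :
    ∀ x ∈ P.Z.compl, f.toHom x ∈ Q.Z.compl :=
  fun x hx => by_contra fun h => f.Z_red_ge x h hx

/-! #### De Rham cohomology -/

/-- The complex `[I_Y ⟶ I_Z⁻¹ Ω¹_X]`, with `I_Y` in degree `0`. -/
def deRham (P : CurveWithModulus k) : CochainComplex (Sh k P.X.toPresheafedSpace.carrier) ℤ :=
  twoTerm (diff P.Y P.Z)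

/-- `𝐇¹_dR(X, Y, Z) = 𝐇¹(X, [I_Y ⟶ I_Z⁻¹ Ω¹_X])`. -/
abbrev H1dR (P : CurveWithModulus k) : Type (u + 1) := Hyper 1 P.deRham

/-- Pullback of differential forms along `f : (X, Y, Z) ⟶ (X', Y', Z')` maps `I_{Z'}⁻¹ Ω¹_{X'}` to
`f_* (I_Z⁻¹ Ω¹_X)`. -/
def Hom.PullsBack {P Q : CurveWithModulus k} (f : P ⟶ Q) : Prop :=
  PullsBackForms (k := k) f.toHom Q.Z P.Z f.map_compl

/-- The pullback map `𝐇¹_dR(X', Y', Z') → 𝐇¹_dR(X, Y, Z)` along `f : (X, Y, Z) ⟶ (X', Y', Z')`,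
induced by the pullback of functions and of differential forms. -/
def H1dRMap {P Q : CurveWithModulus k} (f : P ⟶ Q) (hf : Hom.PullsBack f) :
    H1dR Q →ₗ[k] H1dR P :=
  Hyper.pull f.toHom.base 1 (twoTermHom f.toHom.base (idealPull f.toHom Q.Y P.Y f.Y_le)
    (formsPull f.toHom Q.Z P.Z f.map_compl hf) (diff_pull f.toHom Q.Y Q.Z P.Y P.Z f.Y_le _ hf))

/-! #### The reduced modulus -/

/-- The curve with modulus obtained by replacing `Y` and `Z` by smaller divisors. -/
def withDivisors (P : CurveWithModulus k) (Y Z : EffectiveDivisor P.X)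
    (h : ∀ x, Y.mult x = 0 ∨ Z.mult x = 0) : CurveWithModulus k where
  X := P.X
  smooth := P.smooth
  proper := P.proper
  Y := Y
  Z := Z
  disjoint := h

theorem red_mult {X : Scheme.{u}} (D : EffectiveDivisor X) (x : X) :
    D.red.mult x = min 1 (D.mult x) := rfl

/-- `(X, Y_red, Z)`. -/
def redY (P : CurveWithModulus k) : CurveWithModulus k :=
  P.withDivisors P.Y.red P.Z fun x => by
    have := P.disjoint x; rw [red_mult]; omega

/-- `(X, Y, Z_red)`. -/
def redZ (P : CurveWithModulus k) : CurveWithModulus k :=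
  P.withDivisors P.Y P.Z.red fun x => by
    have := P.disjoint x; rw [red_mult]; omega

/-- `(X, Y_red, Z_red)`. -/
def red (P : CurveWithModulus k) : CurveWithModulus k :=
  P.withDivisors P.Y.red P.Z.red fun x => by
    have := P.disjoint x; rw [red_mult, red_mult]; omega

theorem idealAt_red {X : Scheme.{u}} (D : EffectiveDivisor X) (x : X) :
    D.idealAt x ≤ D.red.idealAt x :=
  Ideal.pow_le_pow_right (by rw [red_mult]; omega)

theorem idealAt_red_subRed {X : Scheme.{u}} (D : EffectiveDivisor X) (x : X) :
    D.red.subRed.idealAt x = ⊤ := by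
  have h : D.red.subRed.mult x = 0 := by
    change min 1 (D.mult x) - 1 = 0
    omega
  rw [idealAt, h, pow_zero, Ideal.one_eq_top]

theorem pullIdealAt_red_subRed {X X' : Scheme.{u}} (f : X ⟶ X') (D : EffectiveDivisor X')
    (x : X) : pullIdealAt f D.red.subRed x = ⊤ := by
  rw [pullIdealAt, idealAt_red_subRed, Ideal.map_top]

theorem pullIdealAt_red_le {X X' : Scheme.{u}} (f : X ⟶ X') (D' : EffectiveDivisor X')
    (D : EffectiveDivisor X) (x : X) (h : pullIdealAt f D' x ≤ D.idealAt x) :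
    pullIdealAt f D'.red x ≤ D.red.idealAt x := by
  unfold pullIdealAt idealAt at *
  rw [red_mult, red_mult]
  rcases Nat.eq_zero_or_pos (D.mult x) with h0 | h0
  · simp [h0]
  · have h1 : IsLocalRing.maximalIdeal (X.presheaf.stalk x) ^ D.mult x ≤
        IsLocalRing.maximalIdeal (X.presheaf.stalk x) := Ideal.pow_le_self h0.ne'
    have h2 : D'.mult (f x) ≠ 0 := by
      intro h3
      rw [h3, pow_zero, Ideal.one_eq_top, Ideal.map_top] at h
      exact (IsLocalRing.maximalIdeal.isMaximal (X.presheaf.stalk x)).ne_top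
        (top_le_iff.1 (h.trans h1))
    rw [min_eq_left (Nat.one_le_iff_ne_zero.2 h2), min_eq_left h0, pow_one, pow_one]
    have h3 : IsLocalHom (f.stalkMap x).hom := inferInstance
    exact ((IsLocalRing.local_hom_TFAE (f.stalkMap x).hom).out 0 2).1 h3

/-- The morphism `(X, Y_red, Z_red) ⟶ (X', Y'_red, Z'_red)` given by a morphism
`(X, Y, Z) ⟶ (X', Y', Z')`. -/
def redMap {P Q : CurveWithModulus k} (f : P ⟶ Q) : P.red ⟶ Q.red where
  toHom := f.toHom
  isOver := f.isOver
  Y_le x := pullIdealAt_red_le f.toHom Q.Y P.Y x (f.Y_le x)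
  Z_sub_red_ge x := le_top.trans (pullIdealAt_red_subRed f.toHom Q.Z x).ge
  Z_red_ge x h := by
    have h1 := f.Z_red_ge x
    change min 1 (Q.Z.mult (f.toHom x)) ≠ 0 at h
    change min 1 (P.Z.mult x) ≠ 0
    omega

/-- The morphism `(X, Y_red, Z) ⟶ (X, Y, Z)` given by the identity of `X`. -/
def redYTo (P : CurveWithModulus k) : P.redY ⟶ P where
  toHom := 𝟙 P.X
  isOver := inferInstanceAs (HomIsOver (𝟙 P.X) (Spec (CommRingCat.of k)))
  Y_le x := (pullIdealAt_id P.Y x).le.trans (idealAt_red P.Y x)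
  Z_sub_red_ge x := (pullIdealAt_id P.Z.subRed x).ge
  Z_red_ge _ h := h

/-- The morphism `(X, Y_red, Z) ⟶ (X, Y_red, Z_red)` given by the identity of `X`. -/
def redYToRed (P : CurveWithModulus k) : P.redY ⟶ P.red where
  toHom := 𝟙 P.X
  isOver := inferInstanceAs (HomIsOver (𝟙 P.X) (Spec (CommRingCat.of k)))
  Y_le x := (pullIdealAt_id P.Y.red x).le
  Z_sub_red_ge x := le_top.trans (pullIdealAt_red_subRed (𝟙 P.X) P.Z x).ge
  Z_red_ge x h := by
    change min 1 (P.Z.mult x) ≠ 0 at h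
    change P.Z.mult x ≠ 0
    omega

/-- The morphism `(X, Y, Z) ⟶ (X, Y, Z_red)` given by the identity of `X`. -/
def toRedZ (P : CurveWithModulus k) : P ⟶ P.redZ where
  toHom := 𝟙 P.X
  isOver := inferInstanceAs (HomIsOver (𝟙 P.X) (Spec (CommRingCat.of k)))
  Y_le x := (pullIdealAt_id P.Y x).le
  Z_sub_red_ge x := le_top.trans (pullIdealAt_red_subRed (𝟙 P.X) P.Z x).ge
  Z_red_ge x h := by
    change min 1 (P.Z.mult x) ≠ 0 at h
    omega

/-- The morphism `(X, Y_red, Z_red) ⟶ (X, Y, Z_red)` given by the identity of `X`. -/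
def redToRedZ (P : CurveWithModulus k) : P.red ⟶ P.redZ where
  toHom := 𝟙 P.X
  isOver := inferInstanceAs (HomIsOver (𝟙 P.X) (Spec (CommRingCat.of k)))
  Y_le x := (pullIdealAt_id P.Y x).le.trans (idealAt_red P.Y x)
  Z_sub_red_ge x := (pullIdealAt_id P.Z.red.subRed x).ge
  Z_red_ge _ h := h

/-! #### The spaces `U(X, Y)` and `V(X, Z)` -/

section Coker

variable {T T' : TopCat.{u}} (f : T ⟶ T')

/-- Global sections of the quotient sheaf `B / A`, for a morphism `i : A ⟶ B`. -/
abbrev quotientSections {A B : Sh k T} (i : A ⟶ B) : ModuleCat.{u} k :=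
  (cokernel i).obj.obj (op ⊤)

/-- The map `H⁰(T', B' / A') → H⁰(T, B / A)` given by `A' ⟶ f_* A` and `B' ⟶ f_* B`. -/
def quotientSectionsPull {A' B' : Sh k T'} {i' : A' ⟶ B'} {A B : Sh k T} {i : A ⟶ B}
    (α : A' ⟶ (pushf k f).obj A) (β : B' ⟶ (pushf k f).obj B)
    (comm : i' ≫ β = α ≫ (pushf k f).map i) :
    quotientSections i' →ₗ[k] quotientSections i :=
  ((cokernel.desc i' (β ≫ (pushf k f).map (cokernel.π i)) (by
    rw [reassoc_of% comm, ← Functor.map_comp, cokernel.condition, Functor.map_zero,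
      comp_zero])).hom.app (op ⊤)).hom

end Coker

/-- `U(X, Y) = H⁰(X, I_{Y_red} / I_Y)`. -/
abbrev U (P : CurveWithModulus k) : ModuleCat.{u} k :=
  quotientSections (idealIncl (k := k) P.Y P.Y.red (idealAt_red P.Y))

/-- `V(X, Z) = H⁰(X, I_{Z_red} I_Z⁻¹ / 𝒪_X)`. Here `I_{Z_red} I_Z⁻¹` is the inverse of the ideal sheaf
of `Z - Z_red`. -/
abbrev V (P : CurveWithModulus k) : ModuleCat.{u} k :=
  quotientSections (toInvIdeal (k := k) P.Z P.Z.subRed)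

/-- The pullback of functions `U(X', Y') → U(X, Y)`. -/
def UMap {P Q : CurveWithModulus k} (f : P ⟶ Q) : U Q →ₗ[k] U P :=
  quotientSectionsPull f.toHom.base (idealPull f.toHom Q.Y P.Y f.Y_le)
    (idealPull f.toHom Q.Y.red P.Y.red
      fun x => pullIdealAt_red_le f.toHom Q.Y P.Y x (f.Y_le x)) rfl

/-- The pullback of functions `V(X', Z') → V(X, Z)`. -/
def VMap {P Q : CurveWithModulus k} (f : P ⟶ Q) : V Q →ₗ[k] V P :=
  quotientSectionsPull f.toHom.base
    (idealPull f.toHom (EffectiveDivisor.zero Q.X) (EffectiveDivisor.zero P.X) fun _ => by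
      simp [idealAt, EffectiveDivisor.zero])
    (invIdealPull f.toHom Q.Z Q.Z.subRed P.Z P.Z.subRed f.map_compl f.Z_sub_red_ge) rfl

end CurveWithModulus

end CurveModulus

end

noncomputable section

namespace CurveModulus

/-! ### Quasi-isomorphisms between two-term complexes -/

section TwoTerm

variable {C : Type*} [Category* C] [Abelian C]

/-! Call a commutative square A → A', A → B, A' → B', B → B' bicartesian if 0 → A → B ⊕ A' → B' → 0
is exact. Two things follow formally. The square is a quasi-isomorphism [A → B] → [A' → B'].
Moreover, if A → B' denotes the diagonal, the sum map [A → B] ⊕ [A → A'] → [A → B'] is a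
quasi-isomorphism too, because it is again given by a bicartesian square (`Bicartesian.sum`). Hence
the hypercohomology of the diagonal complex splits (`Bicartesian.decomposition`).

Two such squares give the theorem. Let F ⊆ I_{Z_red}⁻¹ Ω¹ consist of the forms generated, near |Y|,
by differentials of functions in I_Y (locally by t^m dt where Y has multiplicity m + 1). The maps
I_Y → I_{Y_red} and d : I_Y → F span a square with corner I_{Z_red}⁻¹ Ω¹ (`bicartesian_formsAlong`).
It splits [I_Y → I_{Z_red}⁻¹ Ω¹] into [I_Y → F], which is quasi-isomorphic to the complex of (X,
Y_red, Z_red), and [I_Y → I_{Y_red}], which computes U. The maps I_Y → I_Y I_{Z_red} I_Z⁻¹ and d :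
I_Y → I_{Z_red}⁻¹ Ω¹ span a square with corner I_Z⁻¹ Ω¹ (`bicartesian_polarForms`). It splits the
complex of (X, Y, Z) into [I_Y → I_{Z_red}⁻¹ Ω¹] and [I_Y → I_Y I_{Z_red} I_Z⁻¹]; since |Y| and |Z|
are disjoint, the latter computes V.

Both squares are checked locally. For a local coordinate t and δ = d/dt one has d(t^{-m} h) =
t^{-m-1} (tδ - m)h dt and d(th) = (tδ + 1)h dt. The operator tδ + s acts on t^i A / t^{i+1} A as the
scalar s + i, so in characteristic zero it is bijective modulo t^m for s = -m and for s = 1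
(`Derivation.exists_euler_add_pow_mul`, `Derivation.dvd_of_pow_dvd_euler`).

Functoriality is then automatic: all maps between the complexes are inclusions or d, and these
commute with pullback. Pullback of forms respects the bounds on poles because the logarithmic
derivative of a pulled back coordinate has at most a simple pole
(`IsLocalCoordinate.exists_pow_mul_deriv`). The map a is the inclusion of [I_Y → F]. The map b is
detected in [I_{Y_red} I_{Z_red} I_Z⁻¹ → I_Z⁻¹ Ω¹], which is quasi-isomorphic to the complex of (X,
Y_red, Z_red) and in which the summands U and V die (`toHInv_eq`). -/

theorem shortComplex_quasiIso_of_isPullback_right {S₁ S₂ : ShortComplex C} (φ : S₁ ⟶ S₂)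
    (h₁ : S₁.f = 0) (h₂ : S₂.f = 0) (sq : IsPullback φ.τ₂ S₁.g S₂.g φ.τ₃) :
    ShortComplex.QuasiIso φ := by
  have w : S₁.g ≫ φ.τ₃ = φ.τ₂ ≫ S₂.g := sq.w.symm
  have e : kernel.ι S₂.g ≫ S₂.g = (0 : kernel S₂.g ⟶ S₁.X₃) ≫ φ.τ₃ := by simp
  have : IsIso (kernel.map S₁.g S₂.g φ.τ₂ φ.τ₃ w) := by
    refine ⟨kernel.lift S₁.g (sq.lift (kernel.ι S₂.g) 0 e) (sq.lift_snd _ _ e), ?_, ?_⟩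
    · rw [← cancel_mono (kernel.ι S₁.g)]
      apply sq.hom_ext <;> simp
    · rw [← cancel_mono (kernel.ι S₂.g)]
      simp
  rw [(ShortComplex.LeftHomologyMapData.ofIsLimitKernelFork φ h₁ _ (kernelIsKernel S₁.g) h₂ _
    (kernelIsKernel S₂.g) (kernel.map S₁.g S₂.g φ.τ₂ φ.τ₃ w) (by simp)).quasiIso_iff]
  exact this

/-- Here the homology is the cokernel of the first map. A cartesian square in an abelian category
induces a monomorphism on cokernels, and the cancellation hypothesis makes it an epimorphism. -/
theorem shortComplex_quasiIso_of_isPullback_left {S₁ S₂ : ShortComplex C} (φ : S₁ ⟶ S₂)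
    (h₁ : S₁.g = 0) (h₂ : S₂.g = 0) (sq : IsPullback φ.τ₁ S₁.f S₂.f φ.τ₂)
    (epi : ∀ {Z : C} (g : S₂.X₂ ⟶ Z), S₂.f ≫ g = 0 → φ.τ₂ ≫ g = 0 → g = 0) :
    ShortComplex.QuasiIso φ := by
  have w : S₁.f ≫ φ.τ₂ = φ.τ₁ ≫ S₂.f := sq.w.symm
  rw [(ShortComplex.LeftHomologyMapData.ofIsColimitCokernelCofork φ h₁ _
    (cokernelIsCokernel S₁.f) h₂ _ (cokernelIsCokernel S₂.f)
    (cokernel.map S₁.f S₂.f φ.τ₁ φ.τ₂ w) (by simp)).quasiIso_iff]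
  change IsIso (cokernel.map S₁.f S₂.f φ.τ₁ φ.τ₂ w)
  have : Mono (cokernel.map S₁.f S₂.f φ.τ₁ φ.τ₂ w) :=
    Abelian.mono_cokernel_map_of_isPullback sq.flip
  have : Epi (cokernel.map S₁.f S₂.f φ.τ₁ φ.τ₂ w) := by
    refine Preadditive.epi_of_cancel_zero _ fun g hg => ?_
    rw [← cancel_epi (cokernel.π S₂.f), comp_zero]
    refine epi _ (by simp) ?_
    have := cokernel.π S₁.f ≫= hg
    simpa using this
  exact isIso_of_mono_of_epi _

variable {A B A' B' A'' B'' : C} {d : A ⟶ B} {d' : A' ⟶ B'} {d'' : A'' ⟶ B''}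

/-- The complex `[A ⟶ B]` with `A` placed in degree `0`. -/
abbrev doubleCx (d : A ⟶ B) : CochainComplex C ℤ :=
  HomologicalComplex.double d (c := .up ℤ) (i₀ := 0) (i₁ := 1) (by simp)

/-- `A` is the degree `0` term of `[A ⟶ B]`. -/
abbrev doubleX₀ (d : A ⟶ B) : (doubleCx d).X 0 ≅ A :=
  HomologicalComplex.doubleXIso₀ d (c := .up ℤ) (i₀ := 0) (i₁ := 1) (by simp)

/-- `B` is the degree `1` term of `[A ⟶ B]`. -/
abbrev doubleX₁ (d : A ⟶ B) : (doubleCx d).X 1 ≅ B :=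
  HomologicalComplex.doubleXIso₁ d (c := .up ℤ) (i₀ := 0) (i₁ := 1) (by simp) (by simp)

theorem doubleCx_d (d : A ⟶ B) :
    (doubleCx d).d 0 1 = (doubleX₀ d).hom ≫ d ≫ (doubleX₁ d).inv :=
  HomologicalComplex.double_d d (c := .up ℤ) (i₀ := 0) (i₁ := 1) (by simp) (by simp)

theorem doubleCx_d_eq_zero (d : A ⟶ B) (i j : ℤ) (h : i ≠ 0) : (doubleCx d).d i j = 0 :=
  HomologicalComplex.double_d_eq_zero₀ _ _ _ _ h

/-- The morphism of complexes given by a commutative square. -/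
def doubleMap (α : A ⟶ A') (β : B ⟶ B') (comm : α ≫ d' = d ≫ β) : doubleCx d ⟶ doubleCx d' :=
  HomologicalComplex.mkHomFromDouble (by simp) (by simp) (α ≫ (doubleX₀ d').inv)
    (β ≫ (doubleX₁ d').inv)
    (by rw [doubleCx_d, Category.assoc, Iso.inv_hom_id_assoc, reassoc_of% comm])
    (fun j _ => by
      rw [HomologicalComplex.double_d_eq_zero₀ _ _ _ _ (by simp), comp_zero])

theorem doubleMap_f₀ (α : A ⟶ A') (β : B ⟶ B') (comm : α ≫ d' = d ≫ β) :
    (doubleMap α β comm).f 0 = (doubleX₀ d).hom ≫ α ≫ (doubleX₀ d').inv :=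
  HomologicalComplex.mkHomFromDouble_f₀ ..

theorem doubleMap_f₁ (α : A ⟶ A') (β : B ⟶ B') (comm : α ≫ d' = d ≫ β) :
    (doubleMap α β comm).f 1 = (doubleX₁ d).hom ≫ β ≫ (doubleX₁ d').inv :=
  HomologicalComplex.mkHomFromDouble_f₁ ..

theorem doubleMap_comp (α : A ⟶ A') (β : B ⟶ B') (comm : α ≫ d' = d ≫ β)
    (α' : A' ⟶ A'') (β' : B' ⟶ B'') (comm' : α' ≫ d'' = d' ≫ β') :
    doubleMap α β comm ≫ doubleMap α' β' comm' =
      doubleMap (α ≫ α') (β ≫ β') (by rw [Category.assoc, comm', reassoc_of% comm]) := by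
  apply HomologicalComplex.from_double_hom_ext
  · rw [HomologicalComplex.comp_f]
    simp only [doubleMap_f₀, Category.assoc, Iso.inv_hom_id_assoc]
  · rw [HomologicalComplex.comp_f]
    simp only [doubleMap_f₁, Category.assoc, Iso.inv_hom_id_assoc]

theorem doubleMap_id (d : A ⟶ B) : doubleMap (d := d) (d' := d) (𝟙 A) (𝟙 B) (by simp) = 𝟙 _ := by
  apply HomologicalComplex.from_double_hom_ext
  · rw [doubleMap_f₀, Category.id_comp, Iso.hom_inv_id]; rfl
  · rw [doubleMap_f₁, Category.id_comp, Iso.hom_inv_id]; rfl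

theorem doubleMap_add (α α' : A ⟶ A') (β β' : B ⟶ B') (comm : α ≫ d' = d ≫ β)
    (comm' : α' ≫ d' = d ≫ β') :
    doubleMap (α + α') (β + β') (by rw [Preadditive.add_comp, Preadditive.comp_add, comm, comm']) =
      doubleMap α β comm + doubleMap α' β' comm' := by
  apply HomologicalComplex.from_double_hom_ext
  · rw [HomologicalComplex.add_f_apply]
    simp only [doubleMap_f₀, Preadditive.add_comp, Preadditive.comp_add]
  · rw [HomologicalComplex.add_f_apply]
    simp only [doubleMap_f₁, Preadditive.add_comp, Preadditive.comp_add]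

/-- A morphism of two-term complexes given by a bicartesian square is a quasi-isomorphism. -/
theorem doubleMap_quasiIso (α : A ⟶ A') (β : B ⟶ B') (sq : IsPullback α d d' β)
    (epi : ∀ {Z : C} (g : B' ⟶ Z), d' ≫ g = 0 → β ≫ g = 0 → g = 0) :
    QuasiIso (doubleMap α β sq.w) := by
  have sq' : IsPullback ((doubleMap α β sq.w).f 0) ((doubleCx d).d 0 1) ((doubleCx d').d 0 1)
      ((doubleMap α β sq.w).f 1) :=
    IsPullback.of_iso sq (doubleX₀ d).symm (doubleX₀ d').symm (doubleX₁ d).symm (doubleX₁ d').symm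
      (by simp [doubleMap_f₀]) (by simp [doubleCx_d]) (by simp [doubleCx_d])
      (by simp [doubleMap_f₁])
  refine ⟨fun i => ?_⟩
  by_cases h0 : i = 0
  · subst h0
    rw [quasiIsoAt_iff' _ (-1) 0 1 (by simp) (by simp)]
    exact shortComplex_quasiIso_of_isPullback_right _
      (doubleCx_d_eq_zero d (-1) 0 (by simp)) (doubleCx_d_eq_zero d' (-1) 0 (by simp)) sq'
  · by_cases h1 : i = 1
    · subst h1
      rw [quasiIsoAt_iff' _ 0 1 2 (by simp) (by simp)]
      have epi' : ∀ {Z : C} (g : (doubleCx d').X 1 ⟶ Z), (doubleCx d').d 0 1 ≫ g = 0 →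
          (doubleMap α β sq.w).f 1 ≫ g = 0 → g = 0 := by
        intro Z g hg hg'
        rw [← cancel_epi (doubleX₁ d').inv, comp_zero]
        refine epi _ ?_ ?_
        · rw [← cancel_epi (doubleX₀ d').hom, comp_zero, ← hg, doubleCx_d]
          simp
        · rw [← cancel_epi (doubleX₁ d).hom, comp_zero, ← hg', doubleMap_f₁]
          simp
      exact shortComplex_quasiIso_of_isPullback_left _ (doubleCx_d_eq_zero d 1 2 (by simp))
        (doubleCx_d_eq_zero d' 1 2 (by simp)) sq' epi'
    -- In all other degrees both complexes vanish.
    · have hz : ∀ {A B : C} (d : A ⟶ B), (doubleCx d).ExactAt i := fun d =>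
        ShortComplex.exact_of_isZero_X₂ _
          (HomologicalComplex.isZero_double_X d (c := .up ℤ) (by simp) i h0 h1)
      exact (quasiIsoAt_iff_exactAt _ _ (hz d)).2 (hz d')

end TwoTerm

end CurveModulus

namespace CurveModulus

/-! ### Functoriality of hypercohomology -/

section HyperMap

variable {k : Type u} [Field k] {T T' : TopCat.{u}}

/-- The map `𝐇ⁿ(T, K) → 𝐇ⁿ(T, L)` induced by a morphism of complexes. -/
def Hyper.map (n : ℤ) {K L : CochainComplex (Sh k T) ℤ} (φ : K ⟶ L) :
    Hyper n K →ₗ[k] Hyper n L where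
  toFun c := c ≫ (DerivedCategory.Q.map φ)⟦n⟧'
  map_add' c c' := by simp only [Preadditive.add_comp]
  map_smul' r c := by simp only [Linear.smul_comp, RingHom.id_apply]

theorem Hyper.map_apply (n : ℤ) {K L : CochainComplex (Sh k T) ℤ} (φ : K ⟶ L) (c : Hyper n K) :
    Hyper.map n φ c = c ≫ (DerivedCategory.Q.map φ)⟦n⟧' := rfl

theorem Hyper.map_id (n : ℤ) (K : CochainComplex (Sh k T) ℤ) (c : Hyper n K) :
    Hyper.map n (𝟙 K) c = c := by
  simp [Hyper.map_apply]

theorem Hyper.map_comp (n : ℤ) {K L M : CochainComplex (Sh k T) ℤ} (φ : K ⟶ L) (ψ : L ⟶ M)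
    (c : Hyper n K) : Hyper.map n (φ ≫ ψ) c = Hyper.map n ψ (Hyper.map n φ c) := by
  simp [Hyper.map_apply]

theorem Hyper.map_add (n : ℤ) {K L : CochainComplex (Sh k T) ℤ} (φ ψ : K ⟶ L)
    (c : Hyper n K) : Hyper.map n (φ + ψ) c = Hyper.map n φ c + Hyper.map n ψ c := by
  simp only [Hyper.map_apply, Functor.map_add, Preadditive.comp_add]

theorem Hyper.map_bijective (n : ℤ) {K L : CochainComplex (Sh k T) ℤ} (φ : K ⟶ L) [QuasiIso φ] :
    Function.Bijective (Hyper.map n φ) := by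
  refine Function.bijective_iff_has_inverse.2
    ⟨fun c => c ≫ (inv (DerivedCategory.Q.map φ))⟦n⟧', fun c => ?_, fun c => ?_⟩
  · simp only [Hyper.map_apply, Category.assoc, ← Functor.map_comp, IsIso.hom_inv_id,
      CategoryTheory.Functor.map_id, Category.comp_id]
  · simp only [Hyper.map_apply, Category.assoc, ← Functor.map_comp, IsIso.inv_hom_id,
      CategoryTheory.Functor.map_id, Category.comp_id]

variable (f : T ⟶ T')

theorem adjointHom_comp_left {K K' : CochainComplex (Sh k T') ℤ} {L : CochainComplex (Sh k T) ℤ}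
    (φ : K ⟶ K') (ψ : K' ⟶ ((pushf k f).mapHomologicalComplex (.up ℤ)).obj L) :
    adjointHom f (φ ≫ ψ) =
      ((pullf k f).mapHomologicalComplex (.up ℤ)).map φ ≫ adjointHom f ψ := by
  ext1 i
  exact (pullPush k f).homEquiv_naturality_left_symm (φ.f i) (ψ.f i)

theorem adjointHom_comp_right {K : CochainComplex (Sh k T') ℤ} {L L' : CochainComplex (Sh k T) ℤ}
    (ψ : K ⟶ ((pushf k f).mapHomologicalComplex (.up ℤ)).obj L) (φ : L ⟶ L') :
    adjointHom f (ψ ≫ ((pushf k f).mapHomologicalComplex (.up ℤ)).map φ) =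
      adjointHom f ψ ≫ φ := by
  ext1 i
  exact (pullPush k f).homEquiv_naturality_right_symm (ψ.f i) (φ.f i)

theorem Hyper.pull_map (n : ℤ) {K K' : CochainComplex (Sh k T') ℤ}
    {L : CochainComplex (Sh k T) ℤ} (φ : K ⟶ K')
    (ψ : K' ⟶ ((pushf k f).mapHomologicalComplex (.up ℤ)).obj L) (c : Hyper n K) :
    Hyper.pull f n ψ (Hyper.map n φ c) = Hyper.pull f n (φ ≫ ψ) c := by
  have h : (pullf k f).mapDerivedCategoryFactors.hom.app K ≫
      DerivedCategory.Q.map (adjointHom f (φ ≫ ψ)) =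
      (pullf k f).mapDerivedCategory.map (DerivedCategory.Q.map φ) ≫
        (pullf k f).mapDerivedCategoryFactors.hom.app K' ≫
          DerivedCategory.Q.map (adjointHom f ψ) := by
    rw [Functor.mapDerivedCategoryFactors_hom_naturality_assoc, adjointHom_comp_left,
      Functor.map_comp]
  have h' := ((pullf k f).mapDerivedCategory.commShiftIso n).hom.naturality
    (DerivedCategory.Q.map φ)
  simp only [Functor.comp_map] at h'
  simp only [Hyper.pull, LinearMap.coe_mk, AddHom.coe_mk, Hyper.map_apply, h, Functor.map_comp,
    Category.assoc]
  rw [reassoc_of% h']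

theorem Hyper.map_pull (n : ℤ) {K : CochainComplex (Sh k T') ℤ}
    {L L' : CochainComplex (Sh k T) ℤ} (φ : L ⟶ L')
    (ψ : K ⟶ ((pushf k f).mapHomologicalComplex (.up ℤ)).obj L) (c : Hyper n K) :
    Hyper.map n φ (Hyper.pull f n ψ c) =
      Hyper.pull f n (ψ ≫ ((pushf k f).mapHomologicalComplex (.up ℤ)).map φ) c := by
  simp only [Hyper.pull, LinearMap.coe_mk, AddHom.coe_mk, Hyper.map_apply, adjointHom_comp_right,
    Functor.map_comp, Category.assoc]

end HyperMap

/-! ### Hypercohomology of two-term complexes -/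

section TwoTermHyper

theorem comp_iso_inv_comp_iso_hom {C : Type*} [Category* C] {V W X X' Y Z : C} (a : W ⟶ X)
    (α : X ⟶ X') (b : Y ≅ X') (α' : X' ⟶ Z) (g : Z ⟶ V) :
    (a ≫ α ≫ b.inv) ≫ b.hom ≫ α' ≫ g = a ≫ (α ≫ α') ≫ g := by simp

variable {k : Type u} [Field k] {T T' : TopCat.{u}} {A B A' B' A'' B'' : Sh k T}
  {d : A ⟶ B} {d' : A' ⟶ B'} {d'' : A'' ⟶ B''}

/-- `A` is the degree `0` term of `[A ⟶ B]`. -/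
def twoTermX₀ (d : A ⟶ B) : (twoTerm d).X 0 ≅ A := doubleX₀ d

/-- `B` is the degree `1` term of `[A ⟶ B]`. -/
def twoTermX₁ (d : A ⟶ B) : (twoTerm d).X 1 ≅ B := doubleX₁ d

theorem twoTerm_hom_ext {K : CochainComplex (Sh k T) ℤ} {φ ψ : twoTerm d ⟶ K}
    (h₀ : φ.f 0 = ψ.f 0) (h₁ : φ.f 1 = ψ.f 1) : φ = ψ :=
  HomologicalComplex.from_double_hom_ext h₀ h₁

/-- The morphism of complexes given by a commutative square. -/
def twoTermMap (α : A ⟶ A') (β : B ⟶ B') (comm : α ≫ d' = d ≫ β) : twoTerm d ⟶ twoTerm d' :=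
  doubleMap α β comm

theorem twoTermMap_comp (α : A ⟶ A') (β : B ⟶ B') (comm : α ≫ d' = d ≫ β)
    (α' : A' ⟶ A'') (β' : B' ⟶ B'') (comm' : α' ≫ d'' = d' ≫ β') :
    twoTermMap α β comm ≫ twoTermMap α' β' comm' =
      twoTermMap (α ≫ α') (β ≫ β') (by rw [Category.assoc, comm', reassoc_of% comm]) :=
  doubleMap_comp ..

theorem twoTermMap_f₀ (α : A ⟶ A') (β : B ⟶ B') (comm : α ≫ d' = d ≫ β) :
    (twoTermMap α β comm).f 0 = (twoTermX₀ d).hom ≫ α ≫ (twoTermX₀ d').inv :=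
  doubleMap_f₀ ..

theorem twoTermMap_f₁ (α : A ⟶ A') (β : B ⟶ B') (comm : α ≫ d' = d ≫ β) :
    (twoTermMap α β comm).f 1 = (twoTermX₁ d).hom ≫ β ≫ (twoTermX₁ d').inv :=
  doubleMap_f₁ ..

variable (f : T ⟶ T') {F G F' G' : Sh k T'} {e : F ⟶ G} {e' : F' ⟶ G'}

theorem twoTermHom_f₀ (α : F ⟶ (pushf k f).obj A) (β : G ⟶ (pushf k f).obj B)
    (comm : α ≫ (pushf k f).map d = e ≫ β) :
    (twoTermHom f α β comm).f 0 = (twoTermX₀ e).hom ≫ α ≫ (pushf k f).map (twoTermX₀ d).inv :=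
  HomologicalComplex.mkHomFromDouble_f₀ ..

theorem twoTermHom_f₁ (α : F ⟶ (pushf k f).obj A) (β : G ⟶ (pushf k f).obj B)
    (comm : α ≫ (pushf k f).map d = e ≫ β) :
    (twoTermHom f α β comm).f 1 = (twoTermX₁ e).hom ≫ β ≫ (pushf k f).map (twoTermX₁ d).inv :=
  HomologicalComplex.mkHomFromDouble_f₁ ..

theorem twoTermMap_comp_twoTermHom (α : F ⟶ F') (β : G ⟶ G') (comm : α ≫ e' = e ≫ β)
    (α' : F' ⟶ (pushf k f).obj A) (β' : G' ⟶ (pushf k f).obj B)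
    (comm' : α' ≫ (pushf k f).map d = e' ≫ β') :
    twoTermMap α β comm ≫ twoTermHom f α' β' comm' =
      twoTermHom f (α ≫ α') (β ≫ β') (by rw [Category.assoc, comm', reassoc_of% comm]) := by
  apply twoTerm_hom_ext
  · exact (congrArg₂ (· ≫ ·) (twoTermMap_f₀ α β comm) (twoTermHom_f₀ f α' β' comm')).trans
      ((comp_iso_inv_comp_iso_hom _ α (twoTermX₀ e') α' _).trans (twoTermHom_f₀ f ..).symm)
  · exact (congrArg₂ (· ≫ ·) (twoTermMap_f₁ α β comm) (twoTermHom_f₁ f α' β' comm')).trans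
      ((comp_iso_inv_comp_iso_hom _ β (twoTermX₁ e') β' _).trans (twoTermHom_f₁ f ..).symm)

theorem twoTermHom_comp_map (α : F ⟶ (pushf k f).obj A) (β : G ⟶ (pushf k f).obj B)
    (comm : α ≫ (pushf k f).map d = e ≫ β) (α' : A ⟶ A') (β' : B ⟶ B')
    (comm' : α' ≫ d' = d ≫ β') :
    twoTermHom f α β comm ≫ ((pushf k f).mapHomologicalComplex (.up ℤ)).map
        (twoTermMap α' β' comm') =
      twoTermHom f (α ≫ (pushf k f).map α') (β ≫ (pushf k f).map β') (by
        rw [Category.assoc, ← Functor.map_comp, comm', Functor.map_comp, reassoc_of% comm]) := by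
  apply twoTerm_hom_ext
  · refine (congrArg₂ (· ≫ ·) (twoTermHom_f₀ f α β comm)
      (congrArg (pushf k f).map (twoTermMap_f₀ α' β' comm'))).trans ?_
    rw [Functor.map_comp, Functor.map_comp]
    exact (comp_iso_inv_comp_iso_hom _ α ((pushf k f).mapIso (twoTermX₀ d)) _ _).trans
      (twoTermHom_f₀ f ..).symm
  · refine (congrArg₂ (· ≫ ·) (twoTermHom_f₁ f α β comm)
      (congrArg (pushf k f).map (twoTermMap_f₁ α' β' comm'))).trans ?_
    rw [Functor.map_comp, Functor.map_comp]
    exact (comp_iso_inv_comp_iso_hom _ β ((pushf k f).mapIso (twoTermX₁ d)) _ _).trans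
      (twoTermHom_f₁ f ..).symm

end TwoTermHyper

end CurveModulus

namespace CurveModulus

/-! ### Bicartesian squares and the splitting of the diagonal complex. -/

section Bicartesian

variable {C : Type*} [Category* C] [Abelian C]

/-- By additivity, uniqueness of lifts only has to be tested on zero, and existence may be stated
without a choice. This is the form that can be verified on sections of sheaves. -/
theorem isPullback_of_exists_lift {A B A' B' : C} {α : A ⟶ A'} {d : A ⟶ B} {d' : A' ⟶ B'}
    {β : B ⟶ B'} (w : α ≫ d' = d ≫ β)
    (lift : ∀ {T : C} (x : T ⟶ A') (y : T ⟶ B), x ≫ d' = y ≫ β → ∃ l, l ≫ α = x ∧ l ≫ d = y)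
    (eq_zero : ∀ {T : C} (l : T ⟶ A), l ≫ α = 0 → l ≫ d = 0 → l = 0) : IsPullback α d d' β := by
  refine ⟨⟨w⟩, ⟨PullbackCone.IsLimit.mk _
    (fun s => (lift s.fst s.snd s.condition).choose)
    (fun s => (lift s.fst s.snd s.condition).choose_spec.1)
    (fun s => (lift s.fst s.snd s.condition).choose_spec.2) fun s m h₁ h₂ => ?_⟩⟩
  have h := (lift s.fst s.snd s.condition).choose_spec
  rw [← sub_eq_zero]
  apply eq_zero
  · rw [Preadditive.sub_comp, h₁, h.1, sub_self]
  · rw [Preadditive.sub_comp, h₂, h.2, sub_self]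

/-- A bicartesian square `A ⟶ B ⟶ B'`, `A ⟶ A' ⟶ B'` in an abelian category, that is, a commutative
square for which `0 ⟶ A ⟶ B ⊞ A' ⟶ B' ⟶ 0` is exact. -/
structure Bicartesian {A B A' B' : C} (α : A ⟶ A') (d : A ⟶ B) (d' : A' ⟶ B') (β : B ⟶ B') :
    Prop where
  isPullback : IsPullback α d d' β
  cancel : ∀ {Z : C} (g : B' ⟶ Z), d' ≫ g = 0 → β ≫ g = 0 → g = 0

variable {A B A' B' : C} {α : A ⟶ A'} {d : A ⟶ B} {d' : A' ⟶ B'} {β : B ⟶ B'}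

/-- The kernel of A ⊕ A → A is the antidiagonal copy of A; since the given square is cartesian, the
kernel of B ⊕ A' → B' is a copy of A as well, embedded by (d, -α). The new square matches these two
kernels. -/
theorem Bicartesian.sum (h : Bicartesian α d d' β) :
    Bicartesian (biprod.desc (𝟙 A) (𝟙 A)) (biprod.map d α) (α ≫ d') (biprod.desc β d') where
  isPullback := by
    refine isPullback_of_exists_lift (by ext <;> simp [h.isPullback.w]) (fun x y hxy => ?_)
      fun l h₁ h₂ => ?_
    -- Write y = (y₁, y₂). The hypothesis says that x α - y₂ and y₁ agree in B', so they come from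
    -- some l with values in A; the required lift is (l, x - l).
    · have e : (x ≫ α - y ≫ biprod.snd) ≫ d' = (y ≫ biprod.fst) ≫ β := by
        rw [Preadditive.sub_comp, sub_eq_iff_eq_add, Category.assoc, hxy, biprod.desc_eq]
        simp
      refine ⟨biprod.lift (h.isPullback.lift _ _ e) (x - h.isPullback.lift _ _ e), ?_, ?_⟩
      · simp [biprod.lift_desc]
      · ext <;> simp
    · have h₃ : l ≫ biprod.fst + l ≫ biprod.snd = 0 := by
        rw [← h₁, biprod.desc_eq]; simp
      have h₄ : l ≫ biprod.fst ≫ d = 0 := by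
        simpa using h₂ =≫ biprod.fst
      have h₅ : l ≫ biprod.snd ≫ α = 0 := by
        simpa using h₂ =≫ biprod.snd
      have h₆ : l ≫ biprod.fst = 0 := by
        apply h.isPullback.hom_ext
        · rw [eq_neg_of_add_eq_zero_left h₃]
          simp [h₅]
        · simp [h₄]
      ext
      · simp [h₆]
      · simpa [h₆] using h₃
  cancel g _ h₂ := h.cancel g (by simpa using biprod.inr ≫= h₂) (by simpa using biprod.inl ≫= h₂)

theorem Bicartesian.quasiIso (h : Bicartesian α d d' β) :
    QuasiIso (doubleMap α β h.isPullback.w) :=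
  doubleMap_quasiIso α β h.isPullback h.cancel

/-- The zero endomorphism of [B = B] is thereby a quasi-isomorphism, which is how the vanishing of
its hypercohomology is obtained. -/
theorem Bicartesian.zero (B : C) : Bicartesian (0 : B ⟶ B) (𝟙 B) (𝟙 B) 0 where
  isPullback := ⟨⟨by simp⟩, ⟨PullbackCone.IsLimit.mk _ (fun s => s.snd)
    (fun s => by simpa using s.condition.symm) (fun s => by simp) (fun s m _ h => by simpa using h)⟩⟩
  cancel g hg _ := by simpa using hg

theorem Bicartesian.cokernel {Z : C} (hZ : IsZero Z) (i : A ⟶ B) [Mono i] :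
    Bicartesian (0 : A ⟶ Z) i (0 : Z ⟶ cokernel i) (cokernel.π i) where
  isPullback := isPullback_of_exists_lift (by simp)
    (fun x y h => ⟨Abelian.monoLift i y (by rw [← h, comp_zero]), hZ.eq_of_tgt _ _,
      Abelian.monoLift_comp _ _ _⟩)
    (fun l _ h => by rw [← cancel_mono i, h, zero_comp])
  cancel g _ hg := by rw [← cancel_epi (Limits.cokernel.π i), hg, comp_zero]

theorem doubleMap_congr {α α' : A ⟶ A'} {β β' : B ⟶ B'} (hα : α = α') (hβ : β = β')
    (h : α ≫ d' = d ≫ β) : doubleMap α β h = doubleMap α' β' (by rw [← hα, h, hβ]) := by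
  subst hα hβ
  rfl

theorem doubleMap_zero (h : (0 : A ⟶ A') ≫ d' = d ≫ 0) :
    doubleMap (0 : A ⟶ A') (0 : B ⟶ B') h = 0 := by
  apply HomologicalComplex.from_double_hom_ext
  · rw [doubleMap_f₀, zero_comp, comp_zero]; rfl
  · rw [doubleMap_f₁, zero_comp, comp_zero]; rfl

/-- The map A ⊕ A → A is the identity on either summand, so the two restrictions of the
quasi-isomorphism σ are the identity in degree 0 and β or d' in degree 1. -/
theorem Bicartesian.exists_biproduct (h : Bicartesian α d d' β) :
    ∃ (K : CochainComplex C ℤ) (i₁ : doubleCx d ⟶ K) (i₂ : doubleCx α ⟶ K) (p₁ : K ⟶ doubleCx d)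
      (p₂ : K ⟶ doubleCx α) (σ : K ⟶ doubleCx (α ≫ d')), QuasiIso σ ∧
      i₁ ≫ p₁ = 𝟙 _ ∧ i₂ ≫ p₂ = 𝟙 _ ∧ i₁ ≫ p₂ = 0 ∧ i₂ ≫ p₁ = 0 ∧ p₁ ≫ i₁ + p₂ ≫ i₂ = 𝟙 _ ∧
      i₁ ≫ σ = doubleMap (𝟙 A) β (by rw [Category.id_comp, h.isPullback.w]) ∧
      i₂ ≫ σ = doubleMap (𝟙 A) d' (by rw [Category.id_comp]) := by
  refine ⟨doubleCx (biprod.map d α), doubleMap biprod.inl biprod.inl (by simp),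
    doubleMap biprod.inr biprod.inr (by simp), doubleMap biprod.fst biprod.fst (by simp),
    doubleMap biprod.snd biprod.snd (by simp), doubleMap _ _ h.sum.isPullback.w, h.sum.quasiIso,
    ?_, ?_, ?_, ?_, ?_, ?_, ?_⟩
  · exact (doubleMap_comp ..).trans ((doubleMap_congr (by simp) (by simp) _).trans (doubleMap_id _))
  · exact (doubleMap_comp ..).trans ((doubleMap_congr (by simp) (by simp) _).trans (doubleMap_id _))
  · exact (doubleMap_comp ..).trans ((doubleMap_congr (by simp) (by simp) _).trans
      (doubleMap_zero (by simp)))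
  · exact (doubleMap_comp ..).trans ((doubleMap_congr (by simp) (by simp) _).trans
      (doubleMap_zero (by simp)))
  · exact (congrArg₂ (· + ·) (doubleMap_comp ..) (doubleMap_comp ..)).trans
      ((doubleMap_add ..).symm.trans
        ((doubleMap_congr biprod.total biprod.total _).trans (doubleMap_id _)))
  · exact (doubleMap_comp ..).trans (doubleMap_congr (by simp) (by simp) _)
  · exact (doubleMap_comp ..).trans (doubleMap_congr (by simp) (by simp) _)

end Bicartesian

/-! ### Splitting of hypercohomology. -/

section Decomposition

variable {k : Type u} [Field k] {T : TopCat.{u}} {A B A' B' : Sh k T}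

theorem twoTermMap_zero {d : A ⟶ B} {d' : A' ⟶ B'} (h : (0 : A ⟶ A') ≫ d' = d ≫ 0) :
    twoTermMap (0 : A ⟶ A') (0 : B ⟶ B') h = 0 :=
  doubleMap_zero h

theorem twoTermMap_congr {d : A ⟶ B} {d' : A' ⟶ B'} {α α' : A ⟶ A'} {β β' : B ⟶ B'}
    (hα : α = α') (hβ : β = β') (h : α ≫ d' = d ≫ β) :
    twoTermMap α β h = twoTermMap α' β' (by rw [← hα, h, hβ]) := by
  subst hα hβ
  rfl

theorem Hyper.map_zero (n : ℤ) {K L : CochainComplex (Sh k T) ℤ} (c : Hyper n K) :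
    Hyper.map n (0 : K ⟶ L) c = 0 := by
  rw [Hyper.map_apply, Functor.map_zero, Functor.map_zero, comp_zero]

theorem Bicartesian.map_bijective {α : A ⟶ A'} {d : A ⟶ B} {d' : A' ⟶ B'} {β : B ⟶ B'}
    (h : Bicartesian α d d' β) (n : ℤ) :
    Function.Bijective (Hyper.map n (twoTermMap α β h.isPullback.w)) :=
  have : QuasiIso (twoTermMap α β h.isPullback.w) := h.quasiIso
  Hyper.map_bijective n _

/-- The zero endomorphism of [B = B] acts bijectively on hypercohomology. -/
theorem Hyper.eq_zero_of_id (n : ℤ) (c : Hyper n (twoTerm (𝟙 B))) : c = 0 := by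
  refine ((Bicartesian.zero B).map_bijective n).1 ?_
  rw [twoTermMap_zero, Hyper.map_zero, _root_.map_zero]

/-- A morphism of two-term complexes `[A ⟶ B] ⟶ [A' ⟶ B']` which extends to a morphism
`A' ⟶ A'` is trivial in cohomology. -/
theorem Hyper.map_eq_zero_of_lift (n : ℤ) {d : A ⟶ B} {d' : A' ⟶ B'} (α : A ⟶ A') (β : B ⟶ A')
    (h : α = d ≫ β) (c : Hyper n (twoTerm d)) :
    Hyper.map n (twoTermMap (d' := d') α (β ≫ d') (by rw [h, Category.assoc])) c = 0 := by
  -- The lift factors the morphism through [A' = A'], whose hypercohomology vanishes.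
  have e : twoTermMap (d' := d') α (β ≫ d') (by rw [h, Category.assoc]) =
      twoTermMap (d := d) (d' := 𝟙 A') α β (by rw [h, Category.comp_id]) ≫
        twoTermMap (𝟙 A') d' rfl := by
    rw [twoTermMap_comp]
    exact twoTermMap_congr (by simp) rfl _
  rw [e, Hyper.map_comp, Hyper.eq_zero_of_id n (Hyper.map n _ c),
    _root_.map_zero]

theorem Hyper.map_bijective_of_biproduct (n : ℤ) {K₁ K₂ K L : CochainComplex (Sh k T) ℤ}
    {i₁ : K₁ ⟶ K} {i₂ : K₂ ⟶ K} {p₁ : K ⟶ K₁} {p₂ : K ⟶ K₂} (σ : K ⟶ L) [QuasiIso σ]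
    (h₁₁ : i₁ ≫ p₁ = 𝟙 _) (h₂₂ : i₂ ≫ p₂ = 𝟙 _) (h₁₂ : i₁ ≫ p₂ = 0) (h₂₁ : i₂ ≫ p₁ = 0)
    (hsum : p₁ ≫ i₁ + p₂ ≫ i₂ = 𝟙 _) :
    Function.Bijective fun p : Hyper n K₁ × Hyper n K₂ =>
      Hyper.map n (i₁ ≫ σ) p.1 + Hyper.map n (i₂ ≫ σ) p.2 := by
  have key : ∀ p : Hyper n K₁ × Hyper n K₂,
      Hyper.map n (i₁ ≫ σ) p.1 + Hyper.map n (i₂ ≫ σ) p.2 =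
      Hyper.map n σ (Hyper.map n i₁ p.1 + Hyper.map n i₂ p.2) := fun p => by
    rw [_root_.map_add, ← Hyper.map_comp, ← Hyper.map_comp]
  simp only [key]
  refine (Hyper.map_bijective n σ).comp (Function.bijective_iff_has_inverse.2
    ⟨fun c => (Hyper.map n p₁ c, Hyper.map n p₂ c), fun p => ?_, fun c => ?_⟩)
  · refine Prod.ext ?_ ?_
    · change Hyper.map n p₁ _ = _
      rw [_root_.map_add, ← Hyper.map_comp, ← Hyper.map_comp, h₁₁, h₂₁, Hyper.map_id,
        Hyper.map_zero, add_zero]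
    · change Hyper.map n p₂ _ = _
      rw [_root_.map_add, ← Hyper.map_comp, ← Hyper.map_comp, h₂₂, h₁₂, Hyper.map_id,
        Hyper.map_zero, zero_add]
  · change Hyper.map n i₁ (Hyper.map n p₁ c) + Hyper.map n i₂ (Hyper.map n p₂ c) = c
    rw [← Hyper.map_comp, ← Hyper.map_comp, ← Hyper.map_add, hsum, Hyper.map_id]

/-- The decomposition of the hypercohomology of `[A ⟶ B']` given by a bicartesian square. -/
theorem Bicartesian.decomposition {α : A ⟶ A'} {d : A ⟶ B} {d' : A' ⟶ B'} {β : B ⟶ B'}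
    (h : Bicartesian α d d' β) {e : A ⟶ B'} (he : α ≫ d' = e) (n : ℤ) :
    Function.Bijective fun p : Hyper n (twoTerm d) × Hyper n (twoTerm α) =>
      Hyper.map n (twoTermMap (d' := e) (𝟙 A) β
          (by rw [Category.id_comp, ← he, h.isPullback.w])) p.1 +
        Hyper.map n (twoTermMap (d' := e) (𝟙 A) d' (by rw [Category.id_comp, he])) p.2 := by
  subst he
  obtain ⟨K, i₁, i₂, p₁, p₂, σ, _, h₁₁, h₂₂, h₁₂, h₂₁, hsum, e₁, e₂⟩ := h.exists_biproduct
  have := Hyper.map_bijective_of_biproduct n σ h₁₁ h₂₂ h₁₂ h₂₁ hsum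
  rw [e₁, e₂] at this
  exact this

end Decomposition

end CurveModulus

namespace CurveModulus

/-! ### Pullback of classes represented by morphisms of complexes. -/

section ExactFunctor

variable {C D : Type*} [Category* C] [Abelian C] [HasDerivedCategory C] [Category* D] [Abelian D]
  [HasDerivedCategory D] (F : C ⥤ D) [F.Additive] [PreservesFiniteLimits F]
  [PreservesFiniteColimits F]

/-- On a morphism of the derived category which comes from complexes, an exact functor can be
computed degreewise; the content is that `mapDerivedCategoryFactors` commutes with shifts. The
hypothesis `h` says that the source comparison `s` is also represented by a morphism of complexes.
-/
theorem comp_mapDerivedCategory_map {S K : CochainComplex C ℤ} {S' : CochainComplex D ℤ} (n : ℤ)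
    (g : S ⟶ K⟦n⟧) (s : DerivedCategory.Q.obj S' ⟶ F.mapDerivedCategory.obj (DerivedCategory.Q.obj S))
    (t : S' ⟶ (F.mapHomologicalComplex (.up ℤ)).obj S)
    (h : s ≫ F.mapDerivedCategoryFactors.hom.app S = DerivedCategory.Q.map t) :
    s ≫ F.mapDerivedCategory.map (DerivedCategory.Q.map g ≫
        (DerivedCategory.Q.commShiftIso n).hom.app K) ≫
      (F.mapDerivedCategory.commShiftIso n).hom.app (DerivedCategory.Q.obj K) ≫
      (F.mapDerivedCategoryFactors.hom.app K)⟦n⟧' =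
    DerivedCategory.Q.map (t ≫ (F.mapHomologicalComplex (.up ℤ)).map g ≫
        ((F.mapHomologicalComplex (.up ℤ)).commShiftIso n).hom.app K) ≫
      (DerivedCategory.Q.commShiftIso n).hom.app
        ((F.mapHomologicalComplex (.up ℤ)).obj K) := by
  have h₁ := NatTrans.shift_app_comm F.mapDerivedCategoryFactors.hom n K
  rw [Functor.commShiftIso_comp_hom_app, Functor.commShiftIso_comp_hom_app, Category.assoc] at h₁
  have h₂ := F.mapDerivedCategoryFactors_hom_naturality g
  rw [Functor.map_comp, Category.assoc]
  refine (congrArg (fun z => s ≫ F.mapDerivedCategory.map (DerivedCategory.Q.map g) ≫ z) h₁).trans ?_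
  rw [reassoc_of% h₂, reassoc_of% h, Functor.map_comp, Functor.map_comp, Category.assoc, Category.assoc]

theorem comp_mapDerivedCategory_map_comp {S K : CochainComplex C ℤ} {R S' L : CochainComplex D ℤ}
    (n : ℤ) (g : S ⟶ K⟦n⟧)
    (s : DerivedCategory.Q.obj S' ⟶ F.mapDerivedCategory.obj (DerivedCategory.Q.obj S))
    (t : S' ⟶ (F.mapHomologicalComplex (.up ℤ)).obj S)
    (h : s ≫ F.mapDerivedCategoryFactors.hom.app S = DerivedCategory.Q.map t) (r : R ⟶ S')
    (a : (F.mapHomologicalComplex (.up ℤ)).obj K ⟶ L) :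
    DerivedCategory.Q.map r ≫ s ≫ F.mapDerivedCategory.map (DerivedCategory.Q.map g ≫
        (DerivedCategory.Q.commShiftIso n).hom.app K) ≫
      (F.mapDerivedCategory.commShiftIso n).hom.app (DerivedCategory.Q.obj K) ≫
      (F.mapDerivedCategoryFactors.hom.app K ≫ DerivedCategory.Q.map a)⟦n⟧' =
    DerivedCategory.Q.map (r ≫ t ≫ (F.mapHomologicalComplex (.up ℤ)).map g ≫
        ((F.mapHomologicalComplex (.up ℤ)).commShiftIso n).hom.app K ≫ a⟦n⟧') ≫
      (DerivedCategory.Q.commShiftIso n).hom.app L := by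
  have h₁ := comp_mapDerivedCategory_map F n g s t h =≫ (DerivedCategory.Q.map a)⟦n⟧'
  have h₂ := (DerivedCategory.Q.commShiftIso n).hom.naturality a
  simp only [Functor.comp_map] at h₂
  simp only [Category.assoc] at h₁
  rw [← h₂, ← Functor.map_comp_assoc] at h₁
  simp only [Category.assoc] at h₁
  rw [Functor.map_comp (shiftFunctor _ n), Functor.map_comp DerivedCategory.Q r, Category.assoc,
    ← h₁]

end ExactFunctor

section Pull

variable {k : Type u} [Field k] {T T' : TopCat.{u}} (f : T ⟶ T')

/-- The class in hypercohomology of a morphism of complexes `k ⟶ K[n]`. -/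
def Hyper.mk (n : ℤ) {K : CochainComplex (Sh k T) ℤ}
    (g : (CochainComplex.singleFunctor (Sh k T) 0).obj (constSheaf k T) ⟶ K⟦n⟧) : Hyper n K :=
  DerivedCategory.Q.map g ≫ (DerivedCategory.Q.commShiftIso n).hom.app K

/-- This removes the derived category from the computation of a pullback: both sides are described
by morphisms of complexes, which can be compared one degree at a time. -/
theorem Hyper.pull_mk (n : ℤ) {K : CochainComplex (Sh k T') ℤ} {L : CochainComplex (Sh k T) ℤ}
    (ψ : K ⟶ ((pushf k f).mapHomologicalComplex (.up ℤ)).obj L)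
    (g : (CochainComplex.singleFunctor (Sh k T') 0).obj (constSheaf k T') ⟶ K⟦n⟧) :
    Hyper.pull f n ψ (Hyper.mk n g) = Hyper.mk n
      ((CochainComplex.singleFunctor (Sh k T) 0).map (constPullbackIso k f).inv ≫
        ((pullf k f).mapCochainComplexSingleFunctor 0).inv.app (constSheaf k T') ≫
        ((pullf k f).mapHomologicalComplex (.up ℤ)).map g ≫
        (((pullf k f).mapHomologicalComplex (.up ℤ)).commShiftIso n).hom.app K ≫
        (adjointHom f ψ)⟦n⟧') :=
  comp_mapDerivedCategory_map_comp (pullf k f) n g _ _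
    ((pullf k f).mapDerivedCategorySingleFunctor_inv_app_mapDerivedCategoryFactors_hom_app
      (constSheaf k T')) _ _

end Pull

end CurveModulus

namespace CurveModulus

open ZeroObject

/-! ### Sections of a sheaf as the first hypercohomology of a sheaf placed in degree one. -/

section Adjoint

variable {C D : Type*} [Category* C] [Category* D]

theorem map_comp_iso_bijective (S : C ⥤ D) [S.Full] [S.Faithful] {G F : C} {Y : D}
    (e : S.obj F ≅ Y) : Function.Bijective fun σ : G ⟶ F => S.map σ ≫ e.hom := by
  refine ⟨fun σ τ h => S.map_injective ((cancel_mono e.hom).1 h), fun c => ?_⟩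
  obtain ⟨σ, hσ⟩ := S.map_surjective (c ≫ e.inv)
  refine ⟨σ, ?_⟩
  change S.map σ ≫ e.hom = c
  rw [hσ, Category.assoc, Iso.inv_hom_id, Category.comp_id]

/-- Naturality of the adjunction in both variables, with the identifications of single terms of
complexes inserted; these cancel in pairs. -/
theorem adjunction_comp_eq {L : D ⥤ C} {R : C ⥤ D} (adj : L ⊣ R) {K K₀ K' F F₀ F₁ : C}
    {G G₀ H H₀ H₁ : D} (s : K₀ ≅ K) (c : K ⟶ L.obj G) (s₂ : K' ≅ L.obj G) (s₁ : G₀ ≅ G)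
    (σ : G ⟶ H) (s₃ : H₁ ≅ H) (x₁ : H₀ ≅ H) (β : H ⟶ R.obj F) (x : F₀ ≅ F) (s₄ : F₁ ≅ F) :
    (s.hom ≫ c ≫ s₂.inv) ≫ (s₂.hom ≫ L.map s₁.inv) ≫
      L.map ((s₁.hom ≫ σ ≫ s₃.inv) ≫ s₃.hom ≫ x₁.inv) ≫ 𝟙 _ ≫
        (adj.homEquiv _ _).symm (x₁.hom ≫ β ≫ R.map x.inv) =
    (s.hom ≫ (c ≫ (adj.homEquiv _ _).symm (σ ≫ β)) ≫ s₄.inv) ≫ s₄.hom ≫ x.inv := by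
  rw [adj.homEquiv_naturality_left_symm, adj.homEquiv_naturality_right_symm,
    adj.homEquiv_naturality_left_symm]
  simp

end Adjoint

section Sections

variable {k : Type u} [Field k] {T T' : TopCat.{u}}

/-- The complex `[0 ⟶ F]`, with `F` in degree `1`. -/
abbrev degOne (F : Sh k T) : CochainComplex (Sh k T) ℤ := twoTerm (0 : (0 : Sh k T) ⟶ F)

/-- `F` is the degree `0` term of `[0 ⟶ F][1]`. -/
def degOneX (F : Sh k T) : ((degOne F)⟦(1 : ℤ)⟧).X 0 ≅ F := twoTermX₁ (0 : (0 : Sh k T) ⟶ F)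

theorem degOne_shift_isZero (F : Sh k T) (i : ℤ) (hi : i ≠ 0) :
    IsZero (((degOne F)⟦(1 : ℤ)⟧).X i) := by
  change IsZero ((degOne F).X (i + 1))
  by_cases h : i + 1 = 0
  · rw [h]
    exact (isZero_zero _).of_iso (twoTermX₀ _)
  · exact HomologicalComplex.isZero_double_X _ _ _ h (by omega)

/-- The isomorphism of complexes `F ≅ [0 ⟶ F][1]`. -/
def singleToDegOne (F : Sh k T) :
    (CochainComplex.singleFunctor (Sh k T) 0).obj F ⟶ (degOne F)⟦(1 : ℤ)⟧ :=
  HomologicalComplex.mkHomFromSingle (degOneX F).inv fun j hj =>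
    (degOne_shift_isZero F j (by rintro rfl; simp at hj)).eq_of_tgt _ _

theorem singleToDegOne_f (F : Sh k T) :
    (singleToDegOne F).f 0 =
      (HomologicalComplex.singleObjXSelf (.up ℤ) 0 F).hom ≫ (degOneX F).inv :=
  HomologicalComplex.mkHomFromSingle_f _ _

instance (F : Sh k T) : IsIso (singleToDegOne F) := by
  have : ∀ i, IsIso ((singleToDegOne F).f i) := by
    intro i
    by_cases hi : i = 0
    · subst hi
      rw [singleToDegOne_f]
      exact (HomologicalComplex.singleObjXSelf (.up ℤ) 0 F ≪≫ (degOneX F).symm).isIso_hom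
    · exact ⟨0, (HomologicalComplex.isZero_single_obj_X _ _ _ _ hi).eq_of_src _ _,
        (degOne_shift_isZero F i hi).eq_of_src _ _⟩
  exact HomologicalComplex.Hom.isIso_of_components _

/-- The isomorphism `F ≅ [0 ⟶ F][1]` in the derived category. -/
def singleIsoDegOne (F : Sh k T) :
    (DerivedCategory.singleFunctor (Sh k T) 0).obj F ≅ (DerivedCategory.Q.obj (degOne F))⟦(1 : ℤ)⟧ :=
  DerivedCategory.Q.mapIso (asIso (singleToDegOne F)) ≪≫
    ((DerivedCategory.Q (C := Sh k T)).commShiftIso (1 : ℤ)).app (degOne F)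

/-- Morphisms `k ⟶ F` are the same as classes in `𝐇¹(T, [0 ⟶ F])`. -/
def Hyper.ofHom (F : Sh k T) : (constSheaf k T ⟶ F) ≃ₗ[k] Hyper 1 (degOne F) :=
  LinearEquiv.ofBijective
    { toFun := fun σ => (DerivedCategory.singleFunctor (Sh k T) 0).map σ ≫ (singleIsoDegOne F).hom
      map_add' := fun σ τ => by rw [Functor.map_add, Preadditive.add_comp]
      map_smul' := fun r σ => by rw [Functor.map_smul, Linear.smul_comp, RingHom.id_apply] }
    (map_comp_iso_bijective (DerivedCategory.singleFunctor (Sh k T) 0) (singleIsoDegOne F))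

theorem Hyper.ofHom_eq_mk (F : Sh k T) (σ : constSheaf k T ⟶ F) :
    Hyper.ofHom F σ = Hyper.mk 1
      ((CochainComplex.singleFunctor (Sh k T) 0).map σ ≫ singleToDegOne F) := by
  unfold Hyper.mk
  rw [Functor.map_comp]
  exact (Category.assoc ((DerivedCategory.singleFunctor (Sh k T) 0).map σ)
    (DerivedCategory.Q.map (singleToDegOne F))
    (((DerivedCategory.Q (C := Sh k T)).commShiftIso (1 : ℤ)).hom.app (degOne F))).symm

variable (f : T ⟶ T')

/-- The pullback of a section `σ : k ⟶ F'` along `f` and `β : F' ⟶ f_* F`. -/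
def pullSection {F' : Sh k T'} {F : Sh k T} (β : F' ⟶ (pushf k f).obj F)
    (σ : constSheaf k T' ⟶ F') : constSheaf k T ⟶ F :=
  (constPullbackIso k f).inv ≫ ((pullPush k f).homEquiv _ _).symm (σ ≫ β)

theorem Hyper.pull_ofHom {F' : Sh k T'} {F : Sh k T} (β : F' ⟶ (pushf k f).obj F)
    (α : (0 : Sh k T') ⟶ (pushf k f).obj (0 : Sh k T))
    (comm : α ≫ (pushf k f).map (0 : (0 : Sh k T) ⟶ F) = (0 : (0 : Sh k T') ⟶ F') ≫ β)
    (σ : constSheaf k T' ⟶ F') :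
    Hyper.pull f 1 (twoTermHom f α β comm) (Hyper.ofHom F' σ) =
      Hyper.ofHom F (pullSection f β σ) := by
  rw [Hyper.ofHom_eq_mk, Hyper.ofHom_eq_mk, Hyper.pull_mk]
  -- The source complex is concentrated in degree 0, so only the component in degree 0 has to be
  -- compared.
  refine congrArg (Hyper.mk 1) (HomologicalComplex.from_single_hom_ext ?_)
  have e₁ := HomologicalComplex.single_map_f_self (c := .up ℤ) 0 (constPullbackIso k f).inv
  have e₂ := HomologicalComplex.singleMapHomologicalComplex_inv_app_self (pullf k f) (.up ℤ) 0
    (constSheaf k T')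
  have e₃ := HomologicalComplex.single_map_f_self (c := .up ℤ) 0 σ
  have e₄ := HomologicalComplex.single_map_f_self (c := .up ℤ) 0 (pullSection f β σ)
  have e₅ := twoTermHom_f₁ f α β comm
  refine Eq.trans ?_ ((adjunction_comp_eq (pullPush k f)
    (HomologicalComplex.singleObjXSelf (.up ℤ) 0 (constSheaf k T)) (constPullbackIso k f).inv
    (HomologicalComplex.singleObjXSelf (.up ℤ) 0 ((pullf k f).obj (constSheaf k T')))
    (HomologicalComplex.singleObjXSelf (.up ℤ) 0 (constSheaf k T')) σ
    (HomologicalComplex.singleObjXSelf (.up ℤ) 0 F') (degOneX F') β (degOneX F)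
    (HomologicalComplex.singleObjXSelf (.up ℤ) 0 F)).trans ?_)
  · exact congrArg₂ (· ≫ ·) e₁ (congrArg₂ (· ≫ ·) e₂ (congrArg₂ (· ≫ ·)
      (congrArg (pullf k f).map (congrArg₂ (· ≫ ·) e₃ (singleToDegOne_f F')))
      (congrArg (𝟙 _ ≫ ·) (congrArg ((pullPush k f).homEquiv _ _).symm e₅))))
  · exact (congrArg₂ (· ≫ ·) e₄ (singleToDegOne_f F)).symm

end Sections

end CurveModulus

namespace CurveModulus

open ZeroObject

/-! ### Global sections of quotient sheaves. -/

section Adjunction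

variable {M C D : Type*} [Category* M] [Category* C] [Category* D]

theorem homEquiv_leftAdjointUniq_inv_comp {L L' : M ⥤ C} {G : C ⥤ M} (adj : L ⊣ G)
    (adj' : L' ⊣ G) (x : M) (F : C) (g : L'.obj x ⟶ F) :
    adj.homEquiv x F ((Adjunction.leftAdjointUniq adj' adj).inv.app x ≫ g) =
      adj'.homEquiv x F g := by
  rw [Adjunction.leftAdjointUniq_inv_app, Adjunction.homEquiv_naturality_right,
    Adjunction.homEquiv_leftAdjointUniq_hom_app, Adjunction.homEquiv_unit]

theorem comp_homEquiv_homEquiv_symm {L : M ⥤ D} {G : D ⥤ M} (adj : L ⊣ G) {P : D ⥤ C} {R : C ⥤ D}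
    (adj' : P ⊣ R) (x : M) (F : C) (h : L.obj x ⟶ R.obj F) :
    (adj.comp adj').homEquiv x F ((adj'.homEquiv _ _).symm h) = adj.homEquiv x (R.obj F) h := by
  rw [Adjunction.comp_homEquiv]
  simp

end Adjunction

section Quotient

variable {k : Type u} [Field k] {T T' : TopCat.{u}}

/-- The adjunction defining the constant sheaf. -/
abbrev constAdj (k : Type u) [Field k] (T : TopCat.{u}) :=
  constantSheafAdj (Opens.grothendieckTopology T) (ModuleCat.{u} k) (isTerminalTop (α := Opens T))

/-- The section `1` of the constant sheaf. -/
def constOne (k : Type u) [Field k] (T : TopCat.{u}) : (constSheaf k T).obj.obj (op ⊤) :=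
  ((constAdj k T).unit.app (ModuleCat.of k k)).hom (1 : k)

/-- Morphisms `k ⟶ F` are global sections of `F`. -/
def evalOne (F : Sh k T) : (constSheaf k T ⟶ F) →ₗ[k] F.obj.obj (op ⊤) where
  toFun σ := (σ.hom.app (op ⊤)).hom (constOne k T)
  map_add' _ _ := rfl
  map_smul' _ _ := rfl

theorem evalOne_eq (F : Sh k T) (σ : constSheaf k T ⟶ F) :
    evalOne F σ = ((constAdj k T).homEquiv (ModuleCat.of k k) F σ).hom (1 : k) := by
  exact congrArg (fun g : ModuleCat.of k k ⟶ F.obj.obj (op ⊤) => g.hom (1 : k))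
    ((constAdj k T).homEquiv_unit (X := ModuleCat.of k k) (f := σ)).symm

theorem evalOne_bijective (F : Sh k T) : Function.Bijective (evalOne F) := by
  refine ⟨fun σ τ h => ?_, fun s => ?_⟩
  · rw [evalOne_eq, evalOne_eq] at h
    apply ((constAdj k T).homEquiv (ModuleCat.of k k) F).injective
    ext
    exact h
  · refine ⟨((constAdj k T).homEquiv (ModuleCat.of k k) F).symm
      (ModuleCat.ofHom (LinearMap.toSpanSingleton k _ s)), ?_⟩
    refine (evalOne_eq F _).trans ((congrArg
      (fun g : ModuleCat.of k k ⟶ F.obj.obj (op ⊤) => g.hom (1 : k))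
      (Equiv.apply_symm_apply _ _)).trans ?_)
    exact one_smul k s

variable (f : T ⟶ T')

/-- The isomorphism f⁻¹ k ≅ k compares two left adjoints of the global sections functor. Therefore
the pulled back section and σ ≫ β have the same transpose, and evaluation at 1 depends only on the
transpose. -/
theorem evalOne_pullSection {F' : Sh k T'} {F : Sh k T} (β : F' ⟶ (pushf k f).obj F)
    (σ : constSheaf k T' ⟶ F') :
    evalOne F (pullSection f β σ) = (β.hom.app (op ⊤)).hom (evalOne F' σ) := by
  have h : (constAdj k T).homEquiv (ModuleCat.of k k) F (pullSection f β σ) =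
      (constAdj k T').homEquiv (ModuleCat.of k k) ((pushf k f).obj F) (σ ≫ β) :=
    (homEquiv_leftAdjointUniq_inv_comp (constAdj k T) ((constAdj k T').comp (pullPush k f))
      (ModuleCat.of k k) F _).trans
      (comp_homEquiv_homEquiv_symm (constAdj k T') (pullPush k f) (ModuleCat.of k k) F _)
  refine (evalOne_eq F _).trans ((congrArg
      (fun g : ModuleCat.of k k ⟶ F.obj.obj (op ⊤) => g.hom (1 : k)) h).trans ?_)
  exact (evalOne_eq _ (σ ≫ β)).symm

/-- The isomorphism between global sections of `F` and `𝐇¹(T, [0 ⟶ F])`. -/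
def hyperDegOne (F : Sh k T) : Hyper 1 (degOne F) ≃ₗ[k] F.obj.obj (op ⊤) :=
  (Hyper.ofHom F).symm.trans (LinearEquiv.ofBijective (evalOne F) (evalOne_bijective F))

theorem hyperDegOne_pull {F' : Sh k T'} {F : Sh k T} (β : F' ⟶ (pushf k f).obj F)
    (α : (0 : Sh k T') ⟶ (pushf k f).obj (0 : Sh k T))
    (comm : α ≫ (pushf k f).map (0 : (0 : Sh k T) ⟶ F) = (0 : (0 : Sh k T') ⟶ F') ≫ β)
    (c : Hyper 1 (degOne F')) :
    hyperDegOne F (Hyper.pull f 1 (twoTermHom f α β comm) c) =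
      (β.hom.app (op ⊤)).hom (hyperDegOne F' c) := by
  obtain ⟨σ, rfl⟩ := (Hyper.ofHom F').surjective c
  rw [Hyper.pull_ofHom]
  simp only [hyperDegOne, LinearEquiv.trans_apply, LinearEquiv.symm_apply_apply,
    LinearEquiv.ofBijective_apply]
  exact evalOne_pullSection f β σ

variable {A B : Sh k T} (i : A ⟶ B) [Mono i] {A' B' : Sh k T'} (i' : A' ⟶ B') [Mono i']

/-- The quasi-isomorphism `[A ⟶ B] ⟶ [0 ⟶ B / A]` for a monomorphism `A ⟶ B`. -/
def toDegOneCokernel : twoTerm i ⟶ degOne (cokernel i) :=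
  twoTermMap 0 (cokernel.π i) (Bicartesian.cokernel (isZero_zero (Sh k T)) i).isPullback.w

theorem toDegOneCokernel_bijective (n : ℤ) :
    Function.Bijective (Hyper.map n (toDegOneCokernel i)) :=
  (Bicartesian.cokernel (isZero_zero (Sh k T)) i).map_bijective n

/-- The isomorphism `𝐇¹(T, [A ⟶ B]) ≅ H⁰(T, B / A)` for a monomorphism `A ⟶ B`. -/
def hyperQuotient : Hyper 1 (twoTerm i) ≃ₗ[k] CurveWithModulus.quotientSections i :=
  (LinearEquiv.ofBijective (Hyper.map 1 (toDegOneCokernel i)) (toDegOneCokernel_bijective i 1)).trans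
    (hyperDegOne (cokernel i))

theorem toDegOneCokernel_twoTermHom (α : A' ⟶ (pushf k f).obj A) (β : B' ⟶ (pushf k f).obj B)
    (comm : α ≫ (pushf k f).map i = i' ≫ β) (δ : cokernel i' ⟶ (pushf k f).obj (cokernel i))
    (hδ : cokernel.π i' ≫ δ = β ≫ (pushf k f).map (cokernel.π i))
    (h : (0 : (0 : Sh k T') ⟶ (pushf k f).obj (0 : Sh k T)) ≫
      (pushf k f).map (0 : (0 : Sh k T) ⟶ cokernel i) = (0 : (0 : Sh k T') ⟶ cokernel i') ≫ δ) :
    twoTermHom f α β comm ≫ ((pushf k f).mapHomologicalComplex (.up ℤ)).map (toDegOneCokernel i) =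
      toDegOneCokernel i' ≫ twoTermHom f 0 δ h := by
  refine (twoTermHom_comp_map ..).trans (Eq.trans ?_ (twoTermMap_comp_twoTermHom ..).symm)
  congr 1
  exact hδ.symm

/-- The projection [A ⟶ B] ⟶ [0 ⟶ B / A] is compatible with pullback, and for [0 ⟶ B / A] pullback
is the map on global sections. -/
theorem hyperQuotient_pull (α : A' ⟶ (pushf k f).obj A) (β : B' ⟶ (pushf k f).obj B)
    (comm : α ≫ (pushf k f).map i = i' ≫ β) (c : Hyper 1 (twoTerm i')) :
    hyperQuotient i (Hyper.pull f 1 (twoTermHom f α β comm) c) =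
      CurveWithModulus.quotientSectionsPull f α β comm.symm (hyperQuotient i' c) := by
  have hw : i' ≫ β ≫ (pushf k f).map (cokernel.π i) = 0 := by
    rw [← reassoc_of% comm, ← Functor.map_comp, cokernel.condition, Functor.map_zero, comp_zero]
  have h : (0 : (0 : Sh k T') ⟶ (pushf k f).obj (0 : Sh k T)) ≫
      (pushf k f).map (0 : (0 : Sh k T) ⟶ cokernel i) =
      (0 : (0 : Sh k T') ⟶ cokernel i') ≫
        cokernel.desc i' (β ≫ (pushf k f).map (cokernel.π i)) hw := by simp
  have e : Hyper.map 1 (toDegOneCokernel i) (Hyper.pull f 1 (twoTermHom f α β comm) c) =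
      Hyper.pull f 1 (twoTermHom f 0 (cokernel.desc i' _ hw) h)
        (Hyper.map 1 (toDegOneCokernel i') c) :=
    (Hyper.map_pull ..).trans ((congrArg (fun φ => Hyper.pull f 1 φ c)
      (toDegOneCokernel_twoTermHom f i i' α β comm _ (cokernel.π_desc ..) h)).trans
      (Hyper.pull_map ..).symm)
  exact (congrArg (hyperDegOne (cokernel i)) e).trans
    (hyperDegOne_pull f (cokernel.desc i' _ hw) 0 h _)

end Quotient

end CurveModulus

namespace CurveModulus

/-! ### Bicartesian squares of sheaves, tested on sections. -/

section Sections

variable {k : Type u} [Field k] {T : TopCat.{u}} {A B A' B' : Sh k T}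

theorem Sh.eq_zero_of_locally (F : Sh k T) (U : Opens T) (s : F.obj.obj (op U))
    (h : ∀ x ∈ U, ∃ (V : Opens T) (hV : V ≤ U), x ∈ V ∧ (F.obj.map (homOfLE hV).op).hom s = 0) :
    s = 0 := by
  choose V hV hx hs using h
  refine TopCat.Sheaf.eq_of_locally_eq' F (fun x : U => V x.1 x.2) U
    (fun x => homOfLE (hV x.1 x.2)) (fun x hxU => Opens.mem_iSup.2 ⟨⟨x, hxU⟩, hx x hxU⟩) s 0 ?_
  intro x
  exact (hs x.1 x.2).trans (map_zero (F.obj.map (homOfLE (hV x.1 x.2)).op).hom).symm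

/-- A square of sheaves is bicartesian if it is cartesian on sections, and if every section of the
corner is locally a sum of images. -/
theorem Bicartesian.of_sections {α : A ⟶ A'} {d : A ⟶ B} {d' : A' ⟶ B'} {β : B ⟶ B'}
    (w : α ≫ d' = d ≫ β)
    (inj : ∀ (U : Opens T) (a : A.obj.obj (op U)), (α.hom.app (op U)).hom a = 0 →
      (d.hom.app (op U)).hom a = 0 → a = 0)
    (lift : ∀ (U : Opens T) (a' : A'.obj.obj (op U)) (b : B.obj.obj (op U)),
      (d'.hom.app (op U)).hom a' = (β.hom.app (op U)).hom b →
      ∃ a, (α.hom.app (op U)).hom a = a' ∧ (d.hom.app (op U)).hom a = b)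
    (surj : ∀ (U : Opens T) (s : B'.obj.obj (op U)), ∀ x ∈ U, ∃ (V : Opens T) (hV : V ≤ U),
      x ∈ V ∧ ∃ (a' : A'.obj.obj (op V)) (b : B.obj.obj (op V)),
        (B'.obj.map (homOfLE hV).op).hom s =
          (d'.hom.app (op V)).hom a' + (β.hom.app (op V)).hom b) :
    Bicartesian α d d' β where
  isPullback := by
    refine isPullback_of_exists_lift w (fun {F} x y h => ?_) (fun {F} l hl hl' => ?_)
    · have h' : ∀ (U : (Opens T)ᵒᵖ) (s : F.obj.obj U), ∃ a,
          (α.hom.app U).hom a = (x.hom.app U).hom s ∧ (d.hom.app U).hom a = (y.hom.app U).hom s :=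
        fun U s => lift U.unop _ _ (congrArg (fun φ : F ⟶ B' => (φ.hom.app U).hom s) h)
      -- Lifts of sections are unique by `inj`; this forces the chosen lifts to be linear and
      -- compatible with restriction, so that they form a morphism of sheaves.
      choose g hg hg' using h'
      have ext : ∀ (U : (Opens T)ᵒᵖ) (a a' : A.obj.obj U),
          (α.hom.app U).hom a = (α.hom.app U).hom a' → (d.hom.app U).hom a = (d.hom.app U).hom a' →
          a = a' := fun U a a' h₁ h₂ => by
        refine sub_eq_zero.1 (inj U.unop _ ?_ ?_)
        · exact (map_sub (α.hom.app U).hom a a').trans (sub_eq_zero.2 h₁)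
        · exact (map_sub (d.hom.app U).hom a a').trans (sub_eq_zero.2 h₂)
      let l : F ⟶ A := ⟨{
        app := fun U => ModuleCat.ofHom
          { toFun := g U
            map_add' := fun s s' => ext U _ _ (by simp [hg]) (by simp [hg'])
            map_smul' := fun r s => ext U _ _ (by simp [hg]) (by simp [hg']) }
        naturality := fun U V i => by
          ext s
          refine ext V _ _ ?_ ?_
          · refine (hg V _).trans ?_
            refine (congrArg (fun φ => φ.hom s) (x.hom.naturality i)).trans ?_
            refine Eq.trans ?_ (congrArg (fun φ => φ.hom (g U s)) (α.hom.naturality i)).symm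
            exact congrArg (A'.obj.map i).hom (hg U s).symm
          · refine (hg' V _).trans ?_
            refine (congrArg (fun φ => φ.hom s) (y.hom.naturality i)).trans ?_
            refine Eq.trans ?_ (congrArg (fun φ => φ.hom (g U s)) (d.hom.naturality i)).symm
            exact congrArg (B.obj.map i).hom (hg' U s).symm }⟩
      refine ⟨l, ?_, ?_⟩
      · apply Sheaf.hom_ext
        ext U s
        exact hg U s
      · apply Sheaf.hom_ext
        ext U s
        exact hg' U s
    · apply Sheaf.hom_ext
      ext U s
      exact inj U.unop _ (congrArg (fun φ : F ⟶ A' => (φ.hom.app U).hom s) hl)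
        (congrArg (fun φ : F ⟶ B => (φ.hom.app U).hom s) hl')
  cancel {F} g hg hg' := by
    apply Sheaf.hom_ext
    ext U s
    refine F.eq_zero_of_locally U.unop _ fun x hx => ?_
    obtain ⟨V, hV, hxV, a', b, e⟩ := surj U.unop s x hx
    refine ⟨V, hV, hxV, ?_⟩
    refine (congrArg (fun φ => φ.hom s) (g.hom.naturality (homOfLE hV).op)).symm.trans ?_
    refine (congrArg (g.hom.app (op V)).hom e).trans ?_
    refine (map_add (g.hom.app (op V)).hom _ _).trans ?_
    have h₁ := congrArg (fun φ : A' ⟶ F => (φ.hom.app (op V)).hom a') hg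
    have h₂ := congrArg (fun φ : B ⟶ F => (φ.hom.app (op V)).hom b) hg'
    exact (congrArg₂ (· + ·) h₁ h₂).trans (add_zero _)

end Sections

end CurveModulus

namespace CurveModulus

open KaehlerDifferential TensorProduct

/-! ### Coordinates on algebras. -/

section Coordinate

variable (k : Type*) [Field k] {A : Type*} [CommRing A] [Algebra k A]

/-- `t` is a coordinate on `A` if `Ω_{A/k}` is free of rank one, generated by `dt`. -/
def IsCoordinate (t : A) : Prop := Function.Bijective fun a : A => a • D k A t

variable {k}

namespace IsCoordinate

variable {t : A} (ht : IsCoordinate k t)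

include ht

/-- The isomorphism `A ≅ Ω_{A/k}` given by a coordinate. -/
def equiv : A ≃ₗ[A] Ω[A⁄k] := LinearEquiv.ofBijective (LinearMap.toSpanSingleton A _ (D k A t)) ht

/-- The derivation `d/dt`. -/
def deriv : Derivation k A A := ht.equiv.symm.toLinearMap.compDer (D k A)

theorem D_eq (a : A) : D k A a = ht.deriv a • D k A t :=
  (ht.equiv.apply_symm_apply (D k A a)).symm

theorem deriv_self : ht.deriv t = 1 :=
  ht.1 ((ht.D_eq t).symm.trans (one_smul A _).symm)

/-- For a formally étale extension, B ⊗ Ω_{A/k} → Ω_{B/k} is an isomorphism, and it carries 1 ⊗ dt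
to the differential of the image of t. -/
theorem of_formallyEtale {B : Type*} [CommRing B] [Algebra k B] [Algebra A B] [IsScalarTower k A B]
    [Algebra.FormallyEtale A B] : IsCoordinate k (algebraMap A B t) := by
  let e : B ≃ₗ[B] Ω[B⁄k] := (AlgebraTensorModule.rid A B B).symm.trans
    ((AlgebraTensorModule.congr (LinearEquiv.refl B B) ht.equiv).trans
      (tensorKaehlerEquivOfFormallyEtale k A B))
  have h : ∀ b, e b = b • D k B (algebraMap A B t) := fun b => by
    have h₁ : ht.equiv 1 = D k A t := one_smul A (D k A t)
    simp only [e, LinearEquiv.trans_apply, AlgebraTensorModule.rid_symm_apply,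
      AlgebraTensorModule.congr_tmul, LinearEquiv.refl_apply,
      tensorKaehlerEquivOfFormallyEtale_apply, mapBaseChange_tmul]
    rw [h₁, map_D]
  have := e.bijective
  rwa [show (e : B → _) = _ from funext h] at this

theorem of_isUnit_mul {s c : A} (h : D k A s = c • D k A t) (hc : IsUnit c) :
    IsCoordinate k s := by
  have : (fun a : A => a • D k A s) = (fun a : A => a • D k A t) ∘ fun a => a * c := by
    funext a
    simp [h, mul_smul]
  unfold IsCoordinate
  rw [this]
  exact ht.comp (IsUnit.isUnit_iff_mulRight_bijective.1 hc)

end IsCoordinate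

end Coordinate

/-! ### The Euler operator tδ + s. -/

section Derivation

variable {k : Type*} [Field k] {A : Type*} [CommRing A] [Algebra k A] (δ : Derivation k A A)
  {t : A} (ht : δ t = 1)

include ht

/-- Multiplication by t turns δ(t^n) = n t^{n-1} into n t^n, so that no negative exponent occurs for
n = 0. -/
theorem Derivation.apply_pow_mul (n : ℕ) (c : A) :
    t * δ (t ^ n * c) = t ^ n * ((n : k) • c + t * δ c) := by
  rw [Derivation.leibniz, Derivation.leibniz_pow, ht]
  rcases n with _ | n
  · simp
  · simp only [smul_eq_mul, ← Nat.cast_smul_eq_nsmul k, Algebra.smul_def, map_natCast,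
      Nat.add_sub_cancel]
    ring

/-- Surjectivity of tδ + s modulo t^m: the operator acts on t^i A / t^{i+1} A as s + i, which is
invertible for i < m, and the error is removed one power of t at a time. -/
theorem Derivation.exists_euler_add_pow_mul (s : k) (m : ℕ) (hs : ∀ i < m, s + i ≠ 0) (a : A) :
    ∃ h c, a = t * δ h + s • h + t ^ m * c := by
  induction m with
  | zero => exact ⟨0, a, by simp⟩
  | succ m ih =>
    obtain ⟨h, c, e⟩ := ih fun i hi => hs i (hi.trans m.lt_succ_self)
    have hm := hs m m.lt_succ_self
    -- The operator sends (s + m)⁻¹ t^m c to t^m c + (s + m)⁻¹ t^{m+1} δc; the first term cancels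
    -- the old error and the second one is the new error.
    refine ⟨h + (s + m)⁻¹ • (t ^ m * c), -((s + m)⁻¹ • δ c), ?_⟩
    have h₁ := Derivation.apply_pow_mul δ ht m c
    have h₂ : algebraMap k A (s + m)⁻¹ * (algebraMap k A s + m) = 1 := by
      rw [← map_natCast (algebraMap k A), ← map_add, ← map_mul, inv_mul_cancel₀ hm, map_one]
    rw [map_add, Derivation.map_smul]
    simp only [Algebra.smul_def, map_natCast] at h₁ e ⊢
    linear_combination e - algebraMap k A (s + m)⁻¹ * h₁ - t ^ m * c * h₂

/-- Injectivity of tδ + s modulo t^m: if h = t^i c, then (tδ + s)h is (s + i) t^i c modulo t^{i+1},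
so divisibility by t^{i+1} passes to h. -/
theorem Derivation.dvd_of_pow_dvd_euler (s : k) (m : ℕ) (hs : ∀ i < m, s + i ≠ 0) (h : A)
    (hh : t ^ m ∣ t * δ h + s • h) : t ^ m ∣ h := by
  have key : ∀ i ≤ m, t ^ i ∣ h := by
    intro i
    induction i with
    | zero => simp
    | succ i ih =>
      intro hi
      obtain ⟨c, rfl⟩ := ih (Nat.le_of_succ_le hi)
      have h₁ : t ^ (i + 1) ∣ (s + i) • (t ^ i * c) + t ^ (i + 1) * δ c := by
        refine (pow_dvd_pow t hi).trans (hh.trans (dvd_of_eq ?_))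
        rw [Derivation.apply_pow_mul δ ht, add_smul, mul_add, mul_smul_comm, pow_succ]
        ring
      have h₂ := (dvd_add_left (dvd_mul_right _ _)).1 h₁
      have h₃ : t ^ i * c = algebraMap k A (s + i)⁻¹ * ((s + i : k) • (t ^ i * c)) := by
        rw [← Algebra.smul_def, smul_smul, inv_mul_cancel₀ (hs i hi), one_smul]
      rw [h₃]
      exact h₂.mul_left _
  exact key m le_rfl

end Derivation

/-! ### Coordinates in local rings. -/

section LocalRing

variable {k : Type*} [Field k] {A : Type*} [CommRing A] [Algebra k A] [IsLocalRing A]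

/-- The differentials of B = A/(t) are generated by the image of dt, which is zero. So B is
unramified and essentially of finite type over k, hence reduced and finite; being local, it is a
field. -/
theorem IsCoordinate.maximalIdeal_eq [Algebra.EssFiniteType k A] {t : A} (ht : IsCoordinate k t)
    (hm : t ∈ IsLocalRing.maximalIdeal A) : IsLocalRing.maximalIdeal A = Ideal.span {t} := by
  have hle : Ideal.span {t} ≤ IsLocalRing.maximalIdeal A := by
    rwa [Ideal.span_singleton_le_iff_mem]
  let B := A ⧸ Ideal.span {t}
  have : Nontrivial B := Ideal.Quotient.nontrivial_iff.2 fun h =>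
    (IsLocalRing.maximalIdeal.isMaximal A).ne_top (top_le_iff.1 (h ▸ hle))
  have hsurj : Function.Surjective (algebraMap A B) := Ideal.Quotient.mk_surjective
  have : IsLocalRing B := IsLocalRing.of_surjective' _ hsurj
  have hΩ : Subsingleton Ω[B⁄k] := by
    refine subsingleton_of_forall_eq 0 fun ω => ?_
    obtain ⟨θ, rfl⟩ := KaehlerDifferential.map_surjective_of_surjective k k A B hsurj ω
    obtain ⟨a, rfl⟩ := ht.2 θ
    have h0 : algebraMap A B t = 0 :=
      Ideal.Quotient.eq_zero_iff_mem.2 (Ideal.mem_span_singleton_self t)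
    simp [h0]
  have : Algebra.FormallyUnramified k B := ⟨hΩ⟩
  have : IsReduced B := Algebra.FormallyUnramified.isReduced_of_field k B
  have : Module.Finite k B := Algebra.FormallyUnramified.finite_of_free k B
  have : IsArtinianRing B := IsArtinianRing.of_finite k B
  have hB : IsField B := by
    exact Ring.KrullDimLE.isField_of_isReduced
  exact (Ideal.IsMaximal.eq_of_le (Ideal.Quotient.maximal_of_isField _ hB)
    (IsLocalRing.maximalIdeal.isMaximal A).ne_top hle).symm

theorem IsLocalRing.exists_eq_pow_mul [IsNoetherianRing A] {t : A}
    (hm : IsLocalRing.maximalIdeal A = Ideal.span {t}) {a : A} (ha : a ≠ 0) :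
    ∃ (n : ℕ) (u : A), IsUnit u ∧ a = t ^ n * u := by
  classical
  have h : ∃ n, ¬ t ^ n ∣ a := by
    by_contra! h
    refine ha ?_
    have h₁ : a ∈ (⨅ n : ℕ, IsLocalRing.maximalIdeal A ^ n) := by
      refine (Ideal.mem_iInf).2 fun n => ?_
      rw [hm, Ideal.span_singleton_pow]
      exact Ideal.mem_span_singleton.2 (h n)
    rwa [Ideal.iInf_pow_eq_bot_of_isLocalRing _ (IsLocalRing.maximalIdeal.isMaximal A).ne_top] at h₁
  -- The least exponent for which t^n does not divide a is positive, because t^0 divides a; it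
  -- exists by Krull's intersection theorem.
  obtain ⟨n, hn⟩ : ∃ n, Nat.find h = n + 1 := by
    refine Nat.exists_eq_succ_of_ne_zero fun h0 => ?_
    have := Nat.find_spec h
    rw [h0] at this
    simp at this
  obtain ⟨u, hu⟩ := not_not.1 (Nat.find_min h (m := n) (by omega))
  refine ⟨n, u, ?_, hu⟩
  by_contra hu'
  have h₂ : u ∈ IsLocalRing.maximalIdeal A := hu'
  rw [hm, Ideal.mem_span_singleton] at h₂
  obtain ⟨v, rfl⟩ := h₂
  have := Nat.find_spec h
  rw [hn] at this
  exact this ⟨v, by rw [hu, pow_succ]; ring⟩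

/-- If ta = 0 and a = t^n c, applying δ gives a + tδa = 0, that is, (n + 1) t^n c = -t^{n+1} δc. In
characteristic zero this makes a divisible by t^{n+1}. Thus a lies in every power of the maximal
ideal and vanishes by Krull's intersection theorem. -/
theorem IsCoordinate.eq_zero_of_mul_eq_zero [CharZero k] [IsNoetherianRing A] {t : A}
    (ht : IsCoordinate k t) (hm : t ∈ IsLocalRing.maximalIdeal A) {a : A} (h : t * a = 0) :
    a = 0 := by
  have key : ∀ n : ℕ, t ^ n ∣ a := by
    intro n
    induction n with
    | zero => simp
    | succ n ih =>
      obtain ⟨c, rfl⟩ := ih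
      have h₁ := ht.deriv.leibniz t (t ^ n * c)
      have h₂ := Derivation.apply_pow_mul ht.deriv ht.deriv_self n c
      rw [h, map_zero, ht.deriv_self, smul_eq_mul, smul_eq_mul, h₂] at h₁
      have h₃ : ((n + 1 : ℕ) : k) ≠ 0 := Nat.cast_ne_zero.2 n.succ_ne_zero
      have h₄ : algebraMap k A ((n + 1 : ℕ) : k)⁻¹ * (n + 1) = 1 := by
        rw [← Nat.cast_succ, ← map_natCast (algebraMap k A), ← map_mul, inv_mul_cancel₀ h₃, map_one]
      simp only [Algebra.smul_def, map_natCast] at h₁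
      refine ⟨-(algebraMap k A ((n + 1 : ℕ) : k)⁻¹ * ht.deriv c), ?_⟩
      linear_combination - t ^ n * c * h₄ - algebraMap k A ((n + 1 : ℕ) : k)⁻¹ * h₁
  have h₁ : a ∈ (⨅ n : ℕ, IsLocalRing.maximalIdeal A ^ n) :=
    (Ideal.mem_iInf).2 fun n => Ideal.mem_of_dvd _ (key n) (Ideal.pow_mem_pow hm n)
  rwa [Ideal.iInf_pow_eq_bot_of_isLocalRing _ (IsLocalRing.maximalIdeal.isMaximal A).ne_top] at h₁

end LocalRing

/-! ### Existence of coordinates on standard smooth algebras. -/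

section Smooth

variable (k : Type*) [Field k] (A : Type*) [CommRing A] [Algebra k A]

/-- Such an algebra is étale over a polynomial ring in one variable X, and dX is a basis of the
differentials there. -/
theorem exists_isCoordinate [Algebra.IsStandardSmoothOfRelativeDimension 1 k A] :
    ∃ t : A, IsCoordinate k t := by
  obtain ⟨g, hg⟩ :=
    Algebra.IsStandardSmoothOfRelativeDimension.exists_etale_mvPolynomial 1 k A
  let : Algebra (MvPolynomial (Fin 1) k) A := g.toRingHom.toAlgebra
  have : IsScalarTower k (MvPolynomial (Fin 1) k) A :=
    IsScalarTower.of_algebraMap_eq fun r => (g.commutes r).symm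
  have : Algebra.Etale (MvPolynomial (Fin 1) k) A := hg
  have h : IsCoordinate k (MvPolynomial.X 0 : MvPolynomial (Fin 1) k) := by
    let e := (Finsupp.uniqueLinearEquiv (MvPolynomial (Fin 1) k) (MvPolynomial (Fin 1) k)
      (0 : Fin 1)).symm.trans (mvPolynomialBasis k (Fin 1)).repr.symm
    have he : ∀ a, e a = a • D k _ (MvPolynomial.X 0 : MvPolynomial (Fin 1) k) := fun a => by
      have : (Finsupp.uniqueLinearEquiv (MvPolynomial (Fin 1) k) (MvPolynomial (Fin 1) k)
          (0 : Fin 1)).symm a = Finsupp.single 0 a := by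
        rw [LinearEquiv.symm_apply_eq]
        simp
      simp [e, this, mvPolynomialBasis_apply]
    have := e.bijective
    rwa [show (e : _ → _) = _ from funext he] at this
  exact ⟨_, h.of_formallyEtale⟩

end Smooth

end CurveModulus

namespace CurveModulus

open KaehlerDifferential Topology Filter

/-! ### Spreading germs to neighbourhoods. -/

section Spread

variable {k : Type u} [Field k] {X : Scheme.{u}} [X.Over (Spec (CommRingCat.of k))] {x : X}

theorem exists_germHom_eq (k : Type u) [Field k] [X.Over (Spec (CommRingCat.of k))]
    (c : X.presheaf.stalk x) :
    ∃ (V : X.Opens) (hx : x ∈ V) (a : Γ(X, V)), germHom k x hx a = c :=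
  X.presheaf.exists_germ_eq c

open Classical in
/-- An extension of a germ of a function at `x` to a family of germs at all points, regular on a
neighbourhood of `x`. -/
def spread (k : Type u) [Field k] [X.Over (Spec (CommRingCat.of k))]
    (c : X.presheaf.stalk x) (y : X) : X.presheaf.stalk y :=
  if hy : y ∈ (exists_germHom_eq k c).choose then
    germHom k y hy (exists_germHom_eq k c).choose_spec.choose_spec.choose
  else 0

theorem eventually_mem (V : X.Opens) (hx : x ∈ V) : ∀ᶠ y in 𝓝 x, y ∈ V :=
  V.isOpen.mem_nhds hx

theorem exists_opens_of_eventually {p : X → Prop} (h : ∀ᶠ y in 𝓝 x, p y) :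
    ∃ V : X.Opens, x ∈ V ∧ ∀ y ∈ V, p y := by
  obtain ⟨s, hs, ho, hx⟩ := mem_nhds_iff.1 h
  exact ⟨⟨s, ho⟩, hx, hs⟩

/-- The property that characterizes `spread` near x. Since the extension of each germ is chosen
separately, algebraic identities between germs hold between their extensions only on a possibly
smaller neighbourhood. -/
theorem exists_spread_eq (c : X.presheaf.stalk x) :
    ∃ (V : X.Opens) (hx : x ∈ V) (a : Γ(X, V)), germHom k x hx a = c ∧
      ∀ (y : X) (hy : y ∈ V), spread k c y = germHom k y hy a :=
  ⟨_, _, _, (exists_germHom_eq k c).choose_spec.choose_spec.choose_spec,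
    fun _ hy => dif_pos hy⟩

theorem spread_self (c : X.presheaf.stalk x) : spread k c x = c := by
  obtain ⟨V, hx, a, ha, h⟩ := exists_spread_eq (k := k) c
  rw [h x hx, ha]

theorem eventually_germHom_eq {V V' : X.Opens} (hx : x ∈ V) (hx' : x ∈ V') (a : Γ(X, V))
    (a' : Γ(X, V')) (h : germHom k x hx a = germHom k x hx' a') :
    ∀ᶠ y in 𝓝 x, ∀ (hy : y ∈ V) (hy' : y ∈ V'), germHom k y hy a = germHom k y hy' a' := by
  obtain ⟨W, hxW, i, j, hij⟩ := X.presheaf.germ_eq x hx hx' a a' h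
  filter_upwards [eventually_mem W hxW] with y hyW hy hy'
  have h := congrArg (germHom k y hyW) hij
  exact (germHom_resHom k i.le y hyW a).symm.trans (h.trans (germHom_resHom k j.le y hyW a'))

theorem spread_germHom {V : X.Opens} (hx : x ∈ V) (a : Γ(X, V)) :
    ∀ᶠ y in 𝓝 x, ∀ hy : y ∈ V, spread k (germHom k x hx a) y = germHom k y hy a := by
  obtain ⟨W, hxW, b, hb, h⟩ := exists_spread_eq (k := k) (germHom k x hx a)
  filter_upwards [eventually_mem W hxW, eventually_germHom_eq hxW hx b a hb] with y hyW hy hyV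
  rw [h y hyW, hy hyW hyV]

theorem spread_add (c c' : X.presheaf.stalk x) :
    ∀ᶠ y in 𝓝 x, spread k (c + c') y = spread k c y + spread k c' y := by
  obtain ⟨V, hx, a, rfl, h⟩ := exists_spread_eq (k := k) c
  obtain ⟨V', hx', a', rfl, h'⟩ := exists_spread_eq (k := k) c'
  have hm : x ∈ V ⊓ V' := ⟨hx, hx'⟩
  have h₁ := spread_germHom (k := k) hm (resHom k inf_le_left a + resHom k inf_le_right a')
  rw [map_add, germHom_resHom, germHom_resHom] at h₁
  filter_upwards [h₁, eventually_mem _ hm] with y hy hyV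
  rw [hy hyV, h y hyV.1, h' y hyV.2, map_add, germHom_resHom, germHom_resHom]

theorem spread_mul (c c' : X.presheaf.stalk x) :
    ∀ᶠ y in 𝓝 x, spread k (c * c') y = spread k c y * spread k c' y := by
  obtain ⟨V, hx, a, rfl, h⟩ := exists_spread_eq (k := k) c
  obtain ⟨V', hx', a', rfl, h'⟩ := exists_spread_eq (k := k) c'
  have hm : x ∈ V ⊓ V' := ⟨hx, hx'⟩
  have h₁ := spread_germHom (k := k) hm (resHom k inf_le_left a * resHom k inf_le_right a')
  rw [map_mul, germHom_resHom, germHom_resHom] at h₁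
  filter_upwards [h₁, eventually_mem _ hm] with y hy hyV
  rw [hy hyV, h y hyV.1, h' y hyV.2, map_mul, germHom_resHom, germHom_resHom]

theorem spread_algebraMap (r : k) :
    ∀ᶠ y in 𝓝 x, spread k (algebraMap k (X.presheaf.stalk x) r) y = algebraMap k _ r := by
  have hm : x ∈ (⊤ : X.Opens) := trivial
  have h := spread_germHom (k := k) hm (algebraMap k Γ(X, ⊤) r)
  rw [AlgHom.commutes] at h
  filter_upwards [h] with y hy
  rw [hy trivial, AlgHom.commutes]

theorem spread_zero : ∀ᶠ y in 𝓝 x, spread k (0 : X.presheaf.stalk x) y = 0 := by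
  simpa using spread_algebraMap (k := k) (x := x) 0

theorem spread_one : ∀ᶠ y in 𝓝 x, spread k (1 : X.presheaf.stalk x) y = 1 := by
  simpa using spread_algebraMap (k := k) (x := x) 1

theorem spread_smul (r : k) (c : X.presheaf.stalk x) :
    ∀ᶠ y in 𝓝 x, spread k (r • c) y = r • spread k c y := by
  filter_upwards [spread_mul (k := k) (algebraMap k _ r) c, spread_algebraMap (x := x) r]
    with y h₁ h₂
  rw [Algebra.smul_def, Algebra.smul_def, h₁, h₂]

theorem spread_pow (c : X.presheaf.stalk x) (n : ℕ) :
    ∀ᶠ y in 𝓝 x, spread k (c ^ n) y = spread k c y ^ n := by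
  induction n with
  | zero => simpa using spread_one (k := k) (x := x)
  | succ n ih =>
    filter_upwards [ih, spread_mul (k := k) (c ^ n) c] with y h₁ h₂
    rw [pow_succ, h₂, h₁, pow_succ]

/-- The relation c b = 1 at x persists near x. -/
theorem isUnit_spread {c : X.presheaf.stalk x} (hc : IsUnit c) :
    ∀ᶠ y in 𝓝 x, IsUnit (spread k c y) := by
  obtain ⟨b, hb⟩ := hc.exists_right_inv
  have h := spread_mul (k := k) c b
  rw [hb] at h
  filter_upwards [h, spread_one (k := k) (x := x)] with y h₁ h₂
  exact IsUnit.of_mul_eq_one _ (h₁.symm.trans h₂)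

/-- The family of germs `spread c` is a regular function near `x`. -/
theorem exists_isFun_spread (c : X.presheaf.stalk x) :
    ∃ V : X.Opens, x ∈ V ∧ IsFun k V fun y => spread k c y := by
  obtain ⟨V, hx, a, -, h⟩ := exists_spread_eq (k := k) c
  exact ⟨V, hx, fun y hy => ⟨V, hy, le_rfl, a, h⟩⟩

theorem IsFun.eventually {V : X.Opens} {s : ∀ y : V, X.presheaf.stalk (y : X)} (hs : IsFun k V s)
    (hx : x ∈ V) : ∀ᶠ y in 𝓝 x, ∀ hy : y ∈ V, s ⟨y, hy⟩ = spread k (s ⟨x, hx⟩) y := by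
  obtain ⟨W, hxW, hW, a, ha⟩ := hs x hx
  rw [ha x hxW]
  filter_upwards [spread_germHom (k := k) hxW a, eventually_mem W hxW] with y hy hyW hyV
  rw [hy hyW, ← ha y hyW]

end Spread

end CurveModulus

namespace CurveModulus

open KaehlerDifferential Topology Filter

/-! ### Existence of local coordinates at closed points. -/

section LocalCoordinate

variable {k : Type u} [Field k] {X : Scheme.{u}} [X.Over (Spec (CommRingCat.of k))]

variable (k) in
/-- A germ `t` at `x` is a local coordinate at `x` if it generates the maximal ideal, `dt` is a basis
of the differential forms near `x`, and `x` is the only zero of `t` near `x`. -/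
structure IsLocalCoordinate (x : X) (t : X.presheaf.stalk x) : Prop where
  isCoordinate : IsCoordinate k t
  isNoetherianRing : IsNoetherianRing (X.presheaf.stalk x)
  maximalIdeal_eq : IsLocalRing.maximalIdeal (X.presheaf.stalk x) = Ideal.span {t}
  eq_zero_of_mul : ∀ a, t * a = 0 → a = 0
  isCoordinate_spread : ∀ᶠ y in 𝓝 x, IsCoordinate k (spread k t y)
  exists_form : ∀ (V : X.Opens) (_ : x ∈ V) (θ : Ω[Γ(X, V)⁄k]), ∃ c : X.presheaf.stalk x,
    ∀ᶠ y in 𝓝 x, ∀ hy : y ∈ V,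
      kaehlerMap (germHom k y hy) θ = spread k c y • D k _ (spread k t y)
  isUnit_spread : ∀ᶠ y in 𝓝 x, y ≠ x → IsUnit (spread k t y)

theorem isStandardSmooth_sections (V : X.Opens) (U : (Spec (CommRingCat.of k)).Opens)
    (e : V ≤ (X ↘ Spec (CommRingCat.of k)) ⁻¹ᵁ U) (hV : (V : Set X).Nonempty)
    (h : ((X ↘ Spec (CommRingCat.of k)).appLE U V e).hom.IsStandardSmoothOfRelativeDimension 1) :
    Algebra.IsStandardSmoothOfRelativeDimension 1 k Γ(X, V) := by
  -- Spec k has a single point, and U contains the image of a point of V.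
  have hU : U = ⊤ := by
    obtain ⟨x, hx⟩ := hV
    refine top_le_iff.1 fun y _ => ?_
    have : y = (X ↘ Spec (CommRingCat.of k)) x := Subsingleton.elim (α := PrimeSpectrum k) _ _
    rw [this]
    exact e hx
  subst hU
  have h₁ := h.comp (RingHom.IsStandardSmoothOfRelativeDimension.equiv
    (Scheme.ΓSpecIso (CommRingCat.of k)).symm.commRingCatIsoToRingEquiv)
  rw [← RingHom.isStandardSmoothOfRelativeDimension_algebraMap]
  exact h₁

/-- The localization map `Γ(X, V) → 𝒪_{X,x}` as an algebra structure. -/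
abbrev germAlgebra (V : X.Opens) (x : X) (hx : x ∈ V) : Algebra Γ(X, V) (X.presheaf.stalk x) :=
  X.presheaf.algebra_section_stalk ⟨x, hx⟩

theorem isScalarTower_germ (V : X.Opens) (x : X) (hx : x ∈ V) :
    letI := germAlgebra V x hx
    IsScalarTower k Γ(X, V) (X.presheaf.stalk x) :=
  letI := germAlgebra V x hx
  IsScalarTower.of_algebraMap_eq fun r => ((germHom k x hx).commutes r).symm

theorem IsCoordinate.germ {V : X.Opens} (hV : IsAffineOpen V) {t : Γ(X, V)} (ht : IsCoordinate k t)
    (x : X) (hx : x ∈ V) : IsCoordinate k (germHom k x hx t) := by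
  let := germAlgebra V x hx
  have := isScalarTower_germ (k := k) V x hx
  have := hV.isLocalization_stalk ⟨x, hx⟩
  have : Algebra.FormallyEtale Γ(X, V) (X.presheaf.stalk x) :=
    Algebra.FormallyEtale.of_isLocalization (hV.primeIdealOf ⟨x, hx⟩).asIdeal.primeCompl
  exact ht.of_formallyEtale

theorem IsCoordinate.basicOpen {V : X.Opens} (hV : IsAffineOpen V) {t : Γ(X, V)}
    (ht : IsCoordinate k t) (r : Γ(X, V)) :
    IsCoordinate k (resHom k (X.basicOpen_le r) t) := by
  have := hV.isLocalization_basicOpen r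
  have : Algebra.FormallyEtale Γ(X, V) Γ(X, X.basicOpen r) :=
    Algebra.FormallyEtale.of_isLocalization (Submonoid.powers r)
  have : IsScalarTower k Γ(X, V) Γ(X, X.basicOpen r) :=
    IsScalarTower.of_algebraMap_eq fun a => ((resHom k (X.basicOpen_le r)).commutes a).symm
  exact ht.of_formallyEtale

/-- On a basic open neighbourhood of x inside V ⊓ V', the differentials are still free on dt, and
the coefficient of θ there provides c. -/
theorem IsCoordinate.exists_form {V : X.Opens} (hV : IsAffineOpen V) {t : Γ(X, V)}
    (ht : IsCoordinate k t) {x : X} (hx : x ∈ V) (V' : X.Opens) (hx' : x ∈ V') (θ : Ω[Γ(X, V')⁄k]) :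
    ∃ c : X.presheaf.stalk x, ∀ᶠ y in 𝓝 x, ∀ (hy : y ∈ V) (hy' : y ∈ V'),
      kaehlerMap (germHom k y hy') θ = spread k c y • D k _ (germHom k y hy t) := by
  obtain ⟨r, hr, hxr⟩ := hV.exists_basicOpen_le (V := V ⊓ V') ⟨x, hx, hx'⟩ hx
  obtain ⟨c, hc⟩ := (ht.basicOpen hV r).2 (kaehlerMap (resHom k (hr.trans inf_le_right)) θ)
  refine ⟨germHom k x hxr c, ?_⟩
  filter_upwards [spread_germHom (k := k) hxr c, eventually_mem _ hxr] with y hy hyr hyV hyV'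
  have := congrArg (kaehlerMap (germHom k y hyr)) hc
  rw [kaehlerMap_comp, germHom_comp_resHom, kaehlerMap_smul, kaehlerMap_D, germHom_resHom] at this
  rw [hy hyr, this]

theorem mem_primeIdealOf_iff {V : X.Opens} (hV : IsAffineOpen V) (x : X) (hx : x ∈ V)
    (a : Γ(X, V)) : a ∈ (hV.primeIdealOf ⟨x, hx⟩).asIdeal ↔
      germHom k x hx a ∈ IsLocalRing.maximalIdeal (X.presheaf.stalk x) := by
  let := germAlgebra V x hx
  have := hV.isLocalization_stalk ⟨x, hx⟩
  exact (IsLocalization.AtPrime.to_map_mem_maximal_iff (X.presheaf.stalk x)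
    (hV.primeIdealOf ⟨x, hx⟩).asIdeal a).symm

theorem primeIdealOf_injective {V : X.Opens} (hV : IsAffineOpen V) {x y : X} (hx : x ∈ V)
    (hy : y ∈ V) (h : (hV.primeIdealOf ⟨x, hx⟩).asIdeal = (hV.primeIdealOf ⟨y, hy⟩).asIdeal) :
    x = y := by
  have h₁ := hV.fromSpec_primeIdealOf ⟨x, hx⟩
  rw [PrimeSpectrum.ext h, hV.fromSpec_primeIdealOf] at h₁
  exact h₁.symm

/-- A coordinate t₀ on an affine neighbourhood need not vanish at x. It is replaced by t₁ = p(t₀),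
where p is the minimal polynomial of the value of t₀ in the residue field, which is finite over k.
Then dt₁ = p'(t₀) dt₀, and p'(t₀) is a unit at x because p is separable in characteristic zero. -/
theorem exists_isLocalCoordinate [CharZero k]
    [h : SmoothOfRelativeDimension 1 (X ↘ Spec (CommRingCat.of k))] (x : X)
    (hx : IsClosed ({x} : Set X)) : ∃ t, IsLocalCoordinate k x t := by
  obtain ⟨U, _, V, hV, hxV, e, hf⟩ := h.exists_isStandardSmoothOfRelativeDimension x
  have := isStandardSmooth_sections V U e ⟨x, hxV⟩ hf
  have : Algebra.IsStandardSmooth k Γ(X, V) :=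
    Algebra.IsStandardSmoothOfRelativeDimension.isStandardSmooth 1
  have : IsNoetherianRing Γ(X, V) := Algebra.FiniteType.isNoetherianRing k _
  obtain ⟨t₀, ht₀⟩ := exists_isCoordinate k Γ(X, V)
  let q := (hV.primeIdealOf ⟨x, hxV⟩).asIdeal
  have hq : q.IsMaximal := hV.primeIdealOf_isMaximal_of_isClosed ⟨x, hxV⟩ hx
  let := Ideal.Quotient.field q
  have : Module.Finite k (Γ(X, V) ⧸ q) := finite_of_finite_type_of_isJacobsonRing k _
  let p := minpoly k (Ideal.Quotient.mk q t₀)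
  have hp : Polynomial.aeval t₀ p ∈ q := by
    rw [← Ideal.Quotient.eq_zero_iff_mem, ← Ideal.Quotient.mkₐ_eq_mk k, ← Polynomial.aeval_algHom_apply]
    exact minpoly.aeval k _
  have hp' : Polynomial.aeval t₀ p.derivative ∉ q := by
    rw [← Ideal.Quotient.eq_zero_iff_mem, ← Ideal.Quotient.mkₐ_eq_mk k, ← Polynomial.aeval_algHom_apply]
    exact (Algebra.IsSeparable.isSeparable k (Ideal.Quotient.mk q t₀)).aeval_derivative_ne_zero
      (minpoly.aeval k _)
  set t₁ := Polynomial.aeval t₀ p with ht₁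
  set w := Polynomial.aeval t₀ p.derivative with hw
  have hD : ∀ (y : X) (hy : y ∈ V), D k _ (germHom k y hy t₁) =
      germHom k y hy w • D k _ (germHom k y hy t₀) := fun y hy => by
    have h₁ := congrArg (kaehlerMap (germHom k y hy)) ((D k Γ(X, V)).map_aeval p t₀)
    rwa [kaehlerMap_D, kaehlerMap_smul, kaehlerMap_D] at h₁
  have hwx : IsUnit (germHom k x hxV w) := by
    by_contra h'
    exact hp' ((mem_primeIdealOf_iff (k := k) hV x hxV w).2 h')
  let t := germHom k x hxV t₁
  have ht : IsCoordinate k t := (ht₀.germ hV x hxV).of_isUnit_mul (hD x hxV) hwx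
  have htm : t ∈ IsLocalRing.maximalIdeal (X.presheaf.stalk x) :=
    (mem_primeIdealOf_iff (k := k) hV x hxV t₁).1 hp
  have hspread : ∀ᶠ y in 𝓝 x, ∀ hy : y ∈ V, spread k t y = germHom k y hy t₁ :=
    spread_germHom hxV t₁
  let := germAlgebra V x hxV
  have := isScalarTower_germ (k := k) V x hxV
  have hloc := hV.isLocalization_stalk ⟨x, hxV⟩
  have hnoeth : IsNoetherianRing (X.presheaf.stalk x) :=
    IsLocalization.isNoetherianRing q.primeCompl _ inferInstance
  have : Algebra.EssFiniteType Γ(X, V) (X.presheaf.stalk x) :=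
    Algebra.EssFiniteType.of_isLocalization _ q.primeCompl
  have : Algebra.EssFiniteType k (X.presheaf.stalk x) := Algebra.EssFiniteType.comp k Γ(X, V) _
  have hmax := ht.maximalIdeal_eq htm
  refine ⟨t, ht, hnoeth, hmax, fun a ha => ht.eq_zero_of_mul_eq_zero htm ha, ?_, ?_, ?_⟩
  · filter_upwards [eventually_mem V hxV, hspread, isUnit_spread (k := k) hwx,
      spread_germHom (k := k) hxV w] with y hy h₁ h₂ h₃
    rw [h₁ hy]
    rw [h₃ hy] at h₂
    exact (ht₀.germ hV y hy).of_isUnit_mul (hD y hy) h₂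
  · intro V' hx' θ
    obtain ⟨c, hc⟩ := ht₀.exists_form hV hxV V' hx' θ
    -- The coefficient with respect to dt₀ is divided by p'(t₀), near x, to give the one with
    -- respect to dt₁.
    obtain ⟨v, hv⟩ := hwx.exists_left_inv
    refine ⟨c * v, ?_⟩
    have h₄ := spread_mul (k := k) (c * v) (germHom k x hxV w)
    rw [mul_assoc, hv, mul_one] at h₄
    filter_upwards [eventually_mem V hxV, hspread, spread_germHom (k := k) hxV w, hc, h₄]
      with y hy h₁ h₃ h₅ h₆ hy'
    rw [h₁ hy, h₅ hy hy', hD, smul_smul, h₆, h₃ hy]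
  -- Finitely many generators of the maximal ideal q of x are divisible by t₁ near x. If t₁ is not a
  -- unit at such a point y, the prime of y contains q, hence equals it, and y = x.
  · obtain ⟨S, hS⟩ : q.FG := IsNoetherian.noetherian q
    have h₁ : ∀ s ∈ S, ∀ᶠ y in 𝓝 x, ∀ hy : y ∈ V,
        germHom k y hy t₁ ∣ germHom k y hy s := by
      intro s hs
      have h₂ : germHom k x hxV s ∈ IsLocalRing.maximalIdeal (X.presheaf.stalk x) :=
        (mem_primeIdealOf_iff (k := k) hV x hxV s).1 (Submodule.span_le.1 hS.le hs)
      rw [hmax, Ideal.mem_span_singleton] at h₂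
      obtain ⟨b, hb⟩ := h₂
      have h₃ := spread_mul (k := k) t b
      rw [← hb] at h₃
      filter_upwards [h₃, hspread, spread_germHom (k := k) hxV s] with y h₄ h₅ h₆ hy
      rw [← h₅ hy, ← h₆ hy, h₄]
      exact dvd_mul_right _ _
    filter_upwards [hspread, eventually_mem V hxV, (Filter.eventually_all_finset S).2 h₁]
      with y h₂ hy h₃ hyx
    rw [h₂ hy]
    by_contra hu
    refine hyx (primeIdealOf_injective hV hxV hy (hq.eq_of_le ?_ ?_)).symm
    · exact (hV.primeIdealOf ⟨y, hy⟩).isPrime.ne_top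
    · refine hS.ge.trans (Submodule.span_le.2 fun s hs => ?_)
      refine (mem_primeIdealOf_iff (k := k) hV y hy s).2 ?_
      exact Ideal.mem_of_dvd _ (h₃ s hs hy) hu

end LocalCoordinate

end CurveModulus

namespace CurveModulus

open KaehlerDifferential Topology Filter

/-! ### Functions and forms expressed in a local coordinate. -/

section LocalCoordinate

variable {k : Type u} [Field k] {X : Scheme.{u}} [X.Over (Spec (CommRingCat.of k))]

theorem IsFun.mul {V : X.Opens} {s t : ∀ x : V, X.presheaf.stalk (x : X)}
    (hs : IsFun k V s) (ht : IsFun k V t) : IsFun k V fun x => s x * t x := by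
  intro x hx
  obtain ⟨W, hxW, hW, a, ha⟩ := hs x hx
  obtain ⟨W', hxW', hW', a', ha'⟩ := ht x hx
  refine ⟨W ⊓ W', ⟨hxW, hxW'⟩, inf_le_left.trans hW,
    resHom k inf_le_left a * resHom k inf_le_right a', fun y hy => ?_⟩
  rw [map_mul, germHom_resHom, germHom_resHom, ← ha y hy.1, ← ha' y hy.2]

theorem IsFun.pow {V : X.Opens} {s : ∀ x : V, X.presheaf.stalk (x : X)}
    (hs : IsFun k V s) (n : ℕ) : IsFun k V fun x => s x ^ n := by
  intro x hx
  obtain ⟨W, hxW, hW, a, ha⟩ := hs x hx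
  exact ⟨W, hxW, hW, a ^ n, fun y hy => by rw [map_pow, ← ha y hy]⟩

theorem IsFun.inverse {V : X.Opens} {s : ∀ x : V, X.presheaf.stalk (x : X)} (hs : IsFun k V s)
    (hu : ∀ x, IsUnit (s x)) : IsFun k V fun x => Ring.inverse (s x) := by
  intro x hx
  obtain ⟨W, hxW, hW, a, ha⟩ := hs x hx
  have hunit : IsUnit a := by
    refine X.toRingedSpace.isUnit_of_isUnit_germ W a fun y hy => ?_
    exact (ha y hy) ▸ hu ⟨y, hW hy⟩
  obtain ⟨b, hb⟩ := hunit.exists_right_inv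
  refine ⟨W, hxW, hW, b, fun y hy => ?_⟩
  have h₁ : s ⟨y, hW hy⟩ * germHom k y hy b = 1 := by rw [ha y hy, ← map_mul, hb, map_one]
  change Ring.inverse (s ⟨y, hW hy⟩) = _
  rw [← mul_one (Ring.inverse _), ← h₁, Ring.inverse_mul_cancel_left _ _ (hu _)]

theorem IsForm.sub {V : X.Opens} {s t : ∀ x : V, Ω[X.presheaf.stalk (x : X)⁄k]}
    (hs : IsForm k V s) (ht : IsForm k V t) : IsForm k V (s - t) := by
  have := hs.add (ht.smul (-1 : k))
  rwa [neg_one_smul, ← sub_eq_add_neg] at this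

variable {x : X}

theorem exists_spread_form (c t : X.presheaf.stalk x) :
    ∃ (V : X.Opens) (_ : x ∈ V) (θ : Ω[Γ(X, V)⁄k]), ∀ (y : X) (hy : y ∈ V),
      spread k c y • D k _ (spread k t y) = kaehlerMap (germHom k y hy) θ := by
  obtain ⟨V, hx, a, -, ha⟩ := exists_spread_eq (k := k) c
  obtain ⟨V', hx', b, -, hb⟩ := exists_spread_eq (k := k) t
  refine ⟨V ⊓ V', ⟨hx, hx'⟩,
    resHom k (V := V ⊓ V') inf_le_left a • D k Γ(X, V ⊓ V') (resHom k inf_le_right b), fun y hy => ?_⟩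
  rw [kaehlerMap_smul, kaehlerMap_D, germHom_resHom, germHom_resHom, ha y hy.1, hb y hy.2]

namespace IsLocalCoordinate

variable {t : X.presheaf.stalk x} (ht : IsLocalCoordinate k x t)

include ht

theorem mem_maximalIdeal : t ∈ IsLocalRing.maximalIdeal (X.presheaf.stalk x) :=
  ht.maximalIdeal_eq.ge (Ideal.mem_span_singleton_self t)

theorem mem_pow_iff (n : ℕ) (a : X.presheaf.stalk x) :
    a ∈ IsLocalRing.maximalIdeal (X.presheaf.stalk x) ^ n ↔ t ^ n ∣ a := by
  rw [ht.maximalIdeal_eq, Ideal.span_singleton_pow, Ideal.mem_span_singleton]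

theorem eq_zero_of_pow_mul (n : ℕ) {a : X.presheaf.stalk x} (h : t ^ n * a = 0) : a = 0 := by
  induction n with
  | zero => simpa using h
  | succ n ih => exact ih (ht.eq_zero_of_mul _ (by rw [← mul_assoc, ← pow_succ', h]))

/-- On an affine neighbourhood the function vanishes where t is invertible, a locus that avoids x.
So a power of t kills it, and t is not a zero divisor at x. -/
theorem eq_zero_of_eventually {c : X.presheaf.stalk x}
    (h : ∀ᶠ y in 𝓝 x, y ≠ x → spread k c y = 0) : c = 0 := by
  obtain ⟨V₁, hx₁, a, ha, hV₁⟩ := exists_spread_eq (k := k) c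
  obtain ⟨V₂, hx₂, b, hb, hV₂⟩ := exists_spread_eq (k := k) t
  obtain ⟨V₃, hx₃, hV₃⟩ := exists_opens_of_eventually h
  obtain ⟨V, hV, hx, hle⟩ := exists_isAffineOpen_mem_and_subset (X := X) (x := x) (U := V₁ ⊓ V₂ ⊓ V₃)
    ⟨⟨hx₁, hx₂⟩, hx₃⟩
  let a' := resHom k (hle.trans (inf_le_left.trans inf_le_left)) a
  let b' := resHom k (hle.trans (inf_le_left.trans inf_le_right)) b
  have ha' : germHom k x hx a' = c := (germHom_resHom k _ x hx a).trans ha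
  have hb' : germHom k x hx b' = t := (germHom_resHom k _ x hx b).trans hb
  have hres : resHom k (X.basicOpen_le b') a' = 0 := by
    refine TopCat.Presheaf.section_ext X.sheaf _ _ _ fun y hy => ?_
    have hyV := X.basicOpen_le b' hy
    have h₁ : IsUnit (germHom k y hyV b') := (X.mem_basicOpen b' y hyV).1 hy
    refine (germHom_resHom k (X.basicOpen_le b') y hy a').trans ?_
    refine (germHom_resHom k _ y hyV a).trans ?_
    rw [← hV₁ y]
    refine (hV₃ y (hle hyV).2 ?_).trans (map_zero (germHom k y hy)).symm
    rintro rfl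
    rw [hb'] at h₁
    exact ht.mem_maximalIdeal h₁
  obtain ⟨n, hn⟩ := exists_pow_mul_eq_zero_of_res_basicOpen_eq_zero_of_isCompact X
    hV.isCompact a' b' hres
  have h₂ := congrArg (germHom k x hx) hn
  rw [map_mul, map_pow, ha', hb', map_zero] at h₂
  exact ht.eq_zero_of_pow_mul n h₂

/-- Near x the form dc is a multiple of dt; comparing at x itself identifies the coefficient as δc.
-/
theorem D_spread (c : X.presheaf.stalk x) : ∀ᶠ y in 𝓝 x,
    D k _ (spread k c y) = spread k (ht.isCoordinate.deriv c) y • D k _ (spread k t y) := by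
  obtain ⟨V, hx, a, rfl, h⟩ := exists_spread_eq (k := k) c
  obtain ⟨c', hc'⟩ := ht.exists_form V hx (D k _ a)
  have h₁ : c' = ht.isCoordinate.deriv (germHom k x hx a) := by
    refine ht.isCoordinate.1 ?_
    have := hc'.self_of_nhds hx
    rw [kaehlerMap_D, spread_self, spread_self] at this
    exact this.symm.trans (ht.isCoordinate.D_eq _)
  filter_upwards [hc', eventually_mem V hx] with y hy hyV
  rw [← h₁, ← hy hyV, kaehlerMap_D, h y hyV]

end IsLocalCoordinate

end LocalCoordinate

namespace EffectiveDivisor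

variable {k : Type u} [Field k] {X : Scheme.{u}} [X.Over (Spec (CommRingCat.of k))] {x : X}
  {t : X.presheaf.stalk x} (ht : IsLocalCoordinate k x t)

include ht

/-- The bound on poles is tested on the generator t^n of I_{Z,x}; the germ g is the numerator in ω =
t^{-n} g dt. -/
theorem exists_of_mem_polarForms {Z : EffectiveDivisor X} {U : X.Opens}
    {ω : ∀ x : ↥(U ⊓ Z.compl), Ω[X.presheaf.stalk (x : X)⁄k]}
    (hω : ω ∈ (polarForms k Z).sections U) (hx : x ∈ U) :
    ∃ g : X.presheaf.stalk x, ∀ᶠ y in 𝓝 x, ∀ hy : y ∈ U ⊓ Z.compl,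
      spread k t y ^ Z.mult x • ω ⟨y, hy⟩ = spread k g y • D k _ (spread k t y) := by
  obtain ⟨V, hxV, a, ha, hV⟩ := exists_spread_eq (k := k) t
  have hm : x ∈ V ⊓ U := ⟨hxV, hx⟩
  obtain ⟨W, hW, hxW, θ, hθ⟩ := hω.2 (V ⊓ U) inf_le_right (resHom k inf_le_left a ^ Z.mult x) x hm
    (by
      rw [map_pow, germHom_resHom, ha]
      exact Ideal.pow_mem_pow ht.mem_maximalIdeal _)
  obtain ⟨g, hg⟩ := ht.exists_form W hxW θ
  refine ⟨g, ?_⟩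
  filter_upwards [hg, eventually_mem W hxW] with y hy hyW hyU
  rw [← hy hyW, ← hθ y hyW hyU.2, map_pow, germHom_resHom, hV y]

theorem exists_of_mem_invIdeal {Z E : EffectiveDivisor X} {U : X.Opens}
    {s : ∀ x : ↥(U ⊓ Z.compl), X.presheaf.stalk (x : X)}
    (hs : s ∈ (invIdeal k Z E).sections U) (hx : x ∈ U) :
    ∃ g : X.presheaf.stalk x, ∀ᶠ y in 𝓝 x, ∀ hy : y ∈ U ⊓ Z.compl,
      spread k t y ^ E.mult x * s ⟨y, hy⟩ = spread k g y := by
  obtain ⟨V, hxV, a, ha, hV⟩ := exists_spread_eq (k := k) t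
  have hm : x ∈ V ⊓ U := ⟨hxV, hx⟩
  obtain ⟨W, hW, hxW, b, hb⟩ := hs.2 (V ⊓ U) inf_le_right (resHom k inf_le_left a ^ E.mult x) x hm
    (by
      rw [map_pow, germHom_resHom, ha]
      exact Ideal.pow_mem_pow ht.mem_maximalIdeal _)
  refine ⟨germHom k x hxW b, ?_⟩
  filter_upwards [spread_germHom (k := k) hxW b, eventually_mem W hxW] with y hy hyW hyU
  rw [hy hyW, ← hb y hyW hyU.2, map_pow, germHom_resHom, hV y]

omit ht

/-- Away from |Z| a regular form satisfies the pole condition. At a point of |Z| every germ in I_Z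
is a multiple b t^n, so the generator t^n suffices. -/
theorem mem_polarForms {Z : EffectiveDivisor X} {U : X.Opens}
    {ω : ∀ x : ↥(U ⊓ Z.compl), Ω[X.presheaf.stalk (x : X)⁄k]} (hω : IsForm k (U ⊓ Z.compl) ω)
    (h : ∀ x ∈ U, x ∉ Z.compl → ∃ t, IsLocalCoordinate k x t ∧ ∃ g : X.presheaf.stalk x,
      ∀ᶠ y in 𝓝 x, ∀ hy : y ∈ U ⊓ Z.compl,
        spread k t y ^ Z.mult x • ω ⟨y, hy⟩ = spread k g y • D k _ (spread k t y)) :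
    ω ∈ (polarForms k Z).sections U := by
  refine ⟨hω, fun W hW a x hx ha => ?_⟩
  by_cases hxZ : x ∈ Z.compl
  · obtain ⟨V, hxV, hV, θ, hθ⟩ := hω x ⟨hW hx, hxZ⟩
    refine ⟨W ⊓ V, inf_le_left, ⟨hx, hxV⟩, resHom k (V := W ⊓ V) inf_le_left a •
      kaehlerMap (resHom k inf_le_right) θ, fun y hy hyZ => ?_⟩
    rw [kaehlerMap_smul, kaehlerMap_comp, germHom_comp_resHom, germHom_resHom, ← hθ y hy.2]
  · obtain ⟨t, ht, g, hg⟩ := h x (hW hx) hxZ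
    obtain ⟨b, hb⟩ := (ht.mem_pow_iff _ _).1 ha
    obtain ⟨V, hxV, θ, hθ⟩ := exists_spread_form (k := k) (b * g) t
    have h₁ := spread_mul (k := k) (t ^ Z.mult x) b
    rw [← hb] at h₁
    obtain ⟨V', hxV', hV'⟩ := exists_opens_of_eventually (hg.and (h₁.and
      ((spread_pow (k := k) t (Z.mult x)).and ((spread_mul (k := k) b g).and
        (spread_germHom (k := k) hx a)))))
    refine ⟨V ⊓ V' ⊓ W, inf_le_right, ⟨⟨hxV, hxV'⟩, hx⟩,
      kaehlerMap (resHom k (inf_le_left.trans inf_le_left)) θ, fun y hy hyZ => ?_⟩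
    obtain ⟨h₂, h₃, h₄, h₅, h₆⟩ := hV' y hy.1.2
    rw [kaehlerMap_comp, germHom_comp_resHom, ← hθ y hy.1.1, ← h₆ hy.2, h₃, h₄, h₅,
      mul_comm, mul_smul, h₂ ⟨hW hy.2, hyZ⟩, mul_smul]

theorem mem_invIdeal {Z E : EffectiveDivisor X} {U : X.Opens}
    {s : ∀ x : ↥(U ⊓ Z.compl), X.presheaf.stalk (x : X)} (hs : IsFun k (U ⊓ Z.compl) s)
    (h : ∀ x ∈ U, x ∉ Z.compl → ∃ t, IsLocalCoordinate k x t ∧ ∃ g : X.presheaf.stalk x,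
      ∀ᶠ y in 𝓝 x, ∀ hy : y ∈ U ⊓ Z.compl,
        spread k t y ^ E.mult x * s ⟨y, hy⟩ = spread k g y) :
    s ∈ (invIdeal k Z E).sections U := by
  refine ⟨hs, fun W hW a x hx ha => ?_⟩
  by_cases hxZ : x ∈ Z.compl
  · obtain ⟨V, hxV, hV, b, hb⟩ := hs x ⟨hW hx, hxZ⟩
    refine ⟨W ⊓ V, inf_le_left, ⟨hx, hxV⟩, resHom k (V := W ⊓ V) inf_le_left a *
      resHom k inf_le_right b, fun y hy hyZ => ?_⟩
    rw [map_mul, germHom_resHom, germHom_resHom, ← hb y hy.2]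
  · obtain ⟨t, ht, g, hg⟩ := h x (hW hx) hxZ
    obtain ⟨b, hb⟩ := (ht.mem_pow_iff _ _).1 ha
    obtain ⟨V, hxV, c, -, hc⟩ := exists_spread_eq (k := k) (b * g)
    have h₁ := spread_mul (k := k) (t ^ E.mult x) b
    rw [← hb] at h₁
    obtain ⟨V', hxV', hV'⟩ := exists_opens_of_eventually (hg.and (h₁.and
      ((spread_pow (k := k) t (E.mult x)).and ((spread_mul (k := k) b g).and
        (spread_germHom (k := k) hx a)))))
    refine ⟨V ⊓ V' ⊓ W, inf_le_right, ⟨⟨hxV, hxV'⟩, hx⟩,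
      resHom k (inf_le_left.trans inf_le_left) c, fun y hy hyZ => ?_⟩
    obtain ⟨h₂, h₃, h₄, h₅, h₆⟩ := hV' y hy.1.2
    rw [germHom_resHom, ← hc y hy.1.1, ← h₆ hy.2, h₃, h₄, h₅, ← h₂ ⟨hW hy.2, hyZ⟩]
    ring

end EffectiveDivisor

end CurveModulus

namespace CurveModulus

open KaehlerDifferential Topology Filter

/-! ### Pullback of forms with poles. -/

section Pullback

variable {k : Type u} [Field k] {X X' : Scheme.{u}} [X.Over (Spec (CommRingCat.of k))]
  [X'.Over (Spec (CommRingCat.of k))] (f : X ⟶ X') [f.IsOver (Spec (CommRingCat.of k))]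

theorem kaehlerMap_stalkHom_germHom (U : X'.Opens) (x : X) (hx : f x ∈ U) (θ : Ω[Γ(X', U)⁄k]) :
    kaehlerMap (stalkHom k f x) (kaehlerMap (germHom k (f x) hx) θ) =
      kaehlerMap (germHom k (U := f ⁻¹ᵁ U) x hx) (kaehlerMap (appHom k f U) θ) := by
  rw [kaehlerMap_comp, kaehlerMap_comp]
  congr 1
  exact congrArg kaehlerMap (AlgHom.ext (stalkHom_germHom k f U x hx))

theorem IsForm.pull {V : X'.Opens} {ω : ∀ x : V, Ω[X'.presheaf.stalk (x : X')⁄k]}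
    (hω : IsForm k V ω) :
    IsForm k (f ⁻¹ᵁ V) fun x => kaehlerMap (stalkHom k f x) (ω ⟨f x, x.2⟩) := by
  intro x hx
  obtain ⟨W, hxW, hW, θ, hθ⟩ := hω (f x) hx
  refine ⟨f ⁻¹ᵁ W, hxW, fun y hy => hW hy, kaehlerMap (appHom k f W) θ, fun y hy => ?_⟩
  exact (congrArg (kaehlerMap (stalkHom k f y)) (hθ (f y) hy)).trans
    (kaehlerMap_stalkHom_germHom f W y hy θ)

theorem eventually_comp {x : X} {p : X' → Prop} (h : ∀ᶠ y in 𝓝 (f x), p y) :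
    ∀ᶠ y in 𝓝 x, p (f y) :=
  (f.continuous.tendsto x).eventually h

theorem stalkHom_spread {x : X} (c : X'.presheaf.stalk (f x)) :
    ∀ᶠ y in 𝓝 x, stalkHom k f y (spread k c (f y)) = spread k (stalkHom k f x c) y := by
  obtain ⟨V, hx, a, rfl, h⟩ := exists_spread_eq (k := k) c
  have hx' : x ∈ f ⁻¹ᵁ V := hx
  rw [stalkHom_germHom]
  filter_upwards [spread_germHom (k := k) hx' (appHom k f V a), eventually_mem _ hx'] with y hy hyV
  rw [hy hyV, h (f y) hyV]
  exact stalkHom_germHom k f V y hyV a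

theorem IsForm.eventually {V : X.Opens} {ω : ∀ x : V, Ω[X.presheaf.stalk (x : X)⁄k]}
    (hω : IsForm k V ω) {x : X} (hx : x ∈ V) {t : X.presheaf.stalk x}
    (ht : IsLocalCoordinate k x t) : ∃ c : X.presheaf.stalk x, ∀ᶠ y in 𝓝 x, ∀ hy : y ∈ V,
      ω ⟨y, hy⟩ = spread k c y • D k _ (spread k t y) := by
  obtain ⟨W, hxW, hW, θ, hθ⟩ := hω x hx
  obtain ⟨c, hc⟩ := ht.exists_form W hxW θ
  refine ⟨c, ?_⟩
  filter_upwards [hc, eventually_mem W hxW] with y hy hyW hyV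
  rw [← hy hyW, ← hθ y hyW]

/-- Write τ = t^e u with u a unit. Then tδτ = t^e (eu + tδu) is a multiple of τ: the logarithmic
derivative has at most a simple pole. Multiplying by t^m = τ^{m'} c gives the claim. -/
theorem IsLocalCoordinate.exists_pow_mul_deriv {x : X} {t τ c : X.presheaf.stalk x}
    (ht : IsLocalCoordinate k x t) (hτ : τ ≠ 0) {m m' : ℕ} (h : t ^ m = τ ^ m' * c) :
    ∃ w, t ^ (m + 1) * ht.isCoordinate.deriv τ = τ ^ (m' + 1) * w := by
  have := ht.isNoetherianRing
  obtain ⟨e, u, hu, rfl⟩ := IsLocalRing.exists_eq_pow_mul ht.maximalIdeal_eq hτ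
  obtain ⟨v, hv⟩ := hu.exists_right_inv
  have h₁ := Derivation.apply_pow_mul ht.isCoordinate.deriv ht.isCoordinate.deriv_self e u
  refine ⟨c * (v * ((e : k) • u + t * ht.isCoordinate.deriv u)), ?_⟩
  rw [pow_succ t, mul_assoc, h₁, h, pow_succ (t ^ e * u)]
  linear_combination - ((t ^ e * u) ^ m' * c * t ^ e *
    ((e : k) • u + t * ht.isCoordinate.deriv u)) * hv

namespace EffectiveDivisor

theorem subRed_mult (D : EffectiveDivisor X) (x : X) : D.subRed.mult x = D.mult x - 1 := rfl

/-- If ω has numerator g for the pole order m' + 1 and τ is the pullback of t', then τ^{m'+1} f^*ω =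
f^*g · δτ dt. The hypothesis on Z - Z_red says t^m = τ^{m'} c, so t^{m+1} δτ is divisible by
τ^{m'+1}. As τ is a unit near x off |Z|, that power cancels. -/
theorem pullsBackForms (hX : ∀ x : X, IsClosed ({x} : Set X) → ∃ t, IsLocalCoordinate k x t)
    (hX' : ∀ x : X', IsClosed ({x} : Set X') → ∃ t, IsLocalCoordinate k x t)
    (Z' : EffectiveDivisor X') (Z : EffectiveDivisor X)
    (hZ : ∀ x ∈ Z.compl, f x ∈ Z'.compl)
    (h : ∀ x, Z.subRed.idealAt x ≤ pullIdealAt f Z'.subRed x) :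
    PullsBackForms (k := k) f Z' Z hZ := by
  intro U ω hω
  have hform := IsForm.pull f hω.1
  refine mem_polarForms (IsForm.res (V := f ⁻¹ᵁ (U ⊓ Z'.compl)) (V' := f ⁻¹ᵁ U ⊓ Z.compl)
    (fun x hx => ⟨hx.1, hZ x hx.2⟩) hform) fun x hx hxZ => ?_
  obtain ⟨t, ht⟩ := hX x (Z.isClosed_singleton x hxZ)
  refine ⟨t, ht, ?_⟩
  -- If f x is not in |Z'|, the pulled back form is regular at x and any pole bound holds.
  by_cases hfx : f x ∈ Z'.compl
  · obtain ⟨c, hc⟩ := hform.eventually (x := x) ⟨hx, hfx⟩ ht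
    refine ⟨t ^ Z.mult x * c, ?_⟩
    filter_upwards [hc, spread_mul (k := k) (t ^ Z.mult x) c, spread_pow (k := k) t (Z.mult x)]
      with y h₁ h₂ h₃ hy
    rw [h₂, h₃, mul_smul, ← h₁ ⟨hy.1, hZ y hy.2⟩]
  · obtain ⟨t', ht'⟩ := hX' (f x) (Z'.isClosed_singleton _ hfx)
    obtain ⟨g, hg⟩ := exists_of_mem_polarForms ht' hω hx
    let τ := stalkHom k f x t'
    have hτs : ∀ᶠ y in 𝓝 x, stalkHom k f y (spread k t' (f y)) = spread k τ y :=
      stalkHom_spread f t'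
    have hunit : ∀ᶠ y in 𝓝 x, y ∈ Z.compl → IsUnit (spread k τ y) := by
      filter_upwards [eventually_comp f ht'.isUnit_spread, hτs] with y h₁ h₂ hy
      rw [← h₂]
      refine (h₁ ?_).map _
      intro h₃
      exact hfx (h₃ ▸ hZ y hy)
    -- If τ vanishes, the invertibility of τ off |Z| shows that no point near x lies outside |Z|,
    -- and the condition to be checked is empty.
    by_cases hτ : τ = 0
    · refine ⟨0, ?_⟩
      have h₀ := spread_zero (k := k) (x := x)
      rw [← hτ] at h₀
      filter_upwards [hunit, h₀] with y h₁ h₂ hy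
      rw [h₂] at h₁
      exact absurd (h₁ hy.2) not_isUnit_zero
    · obtain ⟨n, hn⟩ := Nat.exists_eq_succ_of_ne_zero hxZ
      obtain ⟨n', hn'⟩ := Nat.exists_eq_succ_of_ne_zero hfx
      have h₁ := h x
      simp only [idealAt, pullIdealAt, subRed_mult, hn, hn', Nat.succ_sub_one, ht.maximalIdeal_eq,
        ht'.maximalIdeal_eq, Ideal.span_singleton_pow, Ideal.map_span, Set.image_singleton,
        map_pow, Ideal.span_singleton_le_span_singleton] at h₁
      obtain ⟨c, hc⟩ : τ ^ n' ∣ t ^ n := h₁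
      obtain ⟨w, hw⟩ := ht.exists_pow_mul_deriv hτ hc
      refine ⟨w * stalkHom k f x g, ?_⟩
      have h₂ := spread_mul (k := k) (t ^ (n + 1)) (ht.isCoordinate.deriv τ)
      rw [hw] at h₂
      filter_upwards [hunit, hτs, eventually_comp f hg, stalkHom_spread (k := k) f g,
        spread_mul (k := k) w (stalkHom k f x g), h₂, spread_mul (k := k) (τ ^ (n' + 1)) w,
        spread_pow (k := k) t (n + 1), spread_pow (k := k) τ (n' + 1), ht.D_spread τ]
        with y e₁ e₂ e₃ e₄ e₅ e₆ e₇ e₈ e₉ e₁₀ hy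
      have e₁₁ := congrArg (kaehlerMap (stalkHom k f y)) (e₃ ⟨hy.1, hZ y hy.2⟩)
      rw [kaehlerMap_smul, kaehlerMap_smul, kaehlerMap_D, map_pow, e₂, e₄, e₁₀, hn'] at e₁₁
      refine ((e₁ hy.2).pow (n' + 1)).smul_left_cancel.1 ?_
      rw [hn, smul_comm, e₁₁, e₅, smul_smul, smul_smul, smul_smul]
      congr 1
      rw [← e₉, ← mul_assoc, ← e₇, e₆, e₈]
      simp only [Nat.succ_eq_add_one]
      ring

end EffectiveDivisor

end Pullback

theorem CurveWithModulus.Hom.pullsBack {k : Type u} [Field k] [CharZero k]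
    {P Q : CurveWithModulus k} (f : P ⟶ Q) : f.PullsBack := by
  have := P.smooth
  have := Q.smooth
  exact EffectiveDivisor.pullsBackForms f.toHom (fun x hx => exists_isLocalCoordinate x hx)
    (fun x hx => exists_isLocalCoordinate x hx) _ _ _ f.Z_sub_red_ge

end CurveModulus

/-! ### The auxiliary sheaves and the square for V. -/

namespace CurveModulus

open KaehlerDifferential Topology Filter

/-- The subsheaf of sections whose germ at each `x` lies in `N x`. -/
def GermSheaf.sub {k : Type u} [Field k] {T : TopCat.{u}} (F : GermSheaf k T)
    (N : ∀ x, Submodule k (F.germs x)) : GermSheaf k T where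
  dom := F.dom
  germs := F.germs
  sections U :=
    { carrier := {s | s ∈ F.sections U ∧ ∀ x : ↥(U ⊓ F.dom), s x ∈ N x}
      add_mem' := fun hs ht => ⟨add_mem hs.1 ht.1, fun x => add_mem (hs.2 x) (ht.2 x)⟩
      zero_mem' := ⟨zero_mem _, fun _ => zero_mem _⟩
      smul_mem' := fun r _ hs => ⟨Submodule.smul_mem _ r hs.1,
        fun x => Submodule.smul_mem _ r (hs.2 x)⟩ }
  res h s hs := ⟨F.res h s hs.1, fun x => hs.2 ⟨x, h x.2.1, x.2.2⟩⟩
  loc U s hs := by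
    refine ⟨F.loc U s fun x hx => ?_, fun x => ?_⟩
    · obtain ⟨V, h, hxV, hs'⟩ := hs x hx
      exact ⟨V, h, hxV, hs'.1⟩
    · obtain ⟨V, h, hxV, hs'⟩ := hs x x.2.1
      exact hs'.2 ⟨x, hxV, x.2.2⟩

namespace EffectiveDivisor

variable {k : Type u} [Field k] {X : Scheme.{u}} [X.Over (Spec (CommRingCat.of k))]

theorem idealAt_eq_top (Y : EffectiveDivisor X) {x : X} (h : Y.mult x = 0) : Y.idealAt x = ⊤ := by
  rw [idealAt, h, pow_zero, Ideal.one_eq_top]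

theorem eventually_mem_compl (Z : EffectiveDivisor X) (x : X) :
    ∀ᶠ y in 𝓝 x, y ≠ x → y ∈ Z.compl := by
  classical
  have hc : IsClosed (⋃ y ∈ Z.mult.support.erase x, ({y} : Set X)) :=
    (Finset.finite_toSet _).isClosed_biUnion fun y hy =>
      Z.isClosed_singleton y (Finsupp.mem_support_iff.1 (Finset.mem_of_mem_erase hy))
  have hx : x ∉ ⋃ y ∈ Z.mult.support.erase x, ({y} : Set X) := fun h => by
    obtain ⟨y, hy, hxy⟩ := Set.mem_iUnion₂.1 h
    exact Finset.ne_of_mem_erase hy (Set.mem_singleton_iff.1 hxy).symm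
  filter_upwards [hc.isOpen_compl.mem_nhds hx] with y hy hyx
  by_contra h'
  exact hy (Set.mem_biUnion (Finset.mem_erase.2 ⟨hyx, Finsupp.mem_support_iff.2 h'⟩)
    (Set.mem_singleton y))

theorem mem_compl_red {Z : EffectiveDivisor X} {x : X} : x ∈ Z.red.compl ↔ x ∈ Z.compl := by
  change min 1 (Z.mult x) = 0 ↔ Z.mult x = 0
  omega

variable (k) in
/-- The submodule of `Ω_{𝒪_{X,x}/k}` generated by the differentials of functions in `I_{Y,x}`. -/
def diffIdealAt (Y : EffectiveDivisor X) (x : X) :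
    Submodule (X.presheaf.stalk x) Ω[X.presheaf.stalk x⁄k] :=
  Submodule.span _ (D k (X.presheaf.stalk x) '' Y.idealAt x)

theorem D_mem_diffIdealAt {Y : EffectiveDivisor X} {x : X} {a : X.presheaf.stalk x}
    (ha : a ∈ Y.idealAt x) : D k _ a ∈ Y.diffIdealAt k x :=
  Submodule.subset_span ⟨a, ha, rfl⟩

theorem diffIdealAt_eq_top (Y : EffectiveDivisor X) {x : X} (h : Y.mult x = 0) :
    Y.diffIdealAt k x = ⊤ := by
  rw [diffIdealAt, idealAt_eq_top Y h, Submodule.top_coe, Set.image_univ, span_range_derivation]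

variable (k)

/-- The stalk of `I_Y` as a vector space over `k`. -/
def kIdealAt (Y : EffectiveDivisor X) (x : X) : Submodule k (X.presheaf.stalk x) :=
  Submodule.restrictScalars k (Y.idealAt x)

/-- The sheaf of forms with poles bounded by `Z`, generated near `|Y|` by differentials of functions
in `I_Y`. -/
def formsAlong (Y Z : EffectiveDivisor X) : GermSheaf k X.toPresheafedSpace.carrier :=
  (polarForms k Z).sub fun x => (Y.diffIdealAt k x).restrictScalars k

/-- The sheaf `I_Y I_{Z_red} I_Z⁻¹`, for `Y` and `Z` with disjoint supports. -/
def invIdealAlong (Y Z : EffectiveDivisor X) : GermSheaf k X.toPresheafedSpace.carrier :=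
  (invIdeal k Z Z.subRed).sub fun x => kIdealAt k Y x

variable {k}

/-- The inclusion of `formsAlong` in all forms. -/
def formsAlongIncl (Y Z : EffectiveDivisor X) :
    (formsAlong k Y Z).sheaf ⟶ (polarForms k Z).sheaf :=
  GermSheaf.hom _ _ le_rfl (fun _ => LinearMap.id) fun _ _ hs => hs.1

/-- The inclusion `I_Y I_{Z_red} I_Z⁻¹ ⊆ I_{Z_red} I_Z⁻¹`. -/
def invIdealAlongIncl (Y Z : EffectiveDivisor X) :
    (invIdealAlong k Y Z).sheaf ⟶ (invIdeal k Z Z.subRed).sheaf :=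
  GermSheaf.hom _ _ le_rfl (fun _ => LinearMap.id) fun _ _ hs => hs.1

/-- The inclusion `I_Y I_{Z_red} I_Z⁻¹ ⊆ I_{Y'} I_{Z_red} I_Z⁻¹` for `Y' ≤ Y`. -/
def invIdealAlongMono (Y Y' Z : EffectiveDivisor X) (h : ∀ x, Y.idealAt x ≤ Y'.idealAt x) :
    (invIdealAlong k Y Z).sheaf ⟶ (invIdealAlong k Y' Z).sheaf :=
  GermSheaf.hom _ _ le_rfl (fun _ => LinearMap.id) fun _ _ hs => ⟨hs.1, fun x => h x (hs.2 x)⟩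

/-- The differential `d : I_Y → formsAlong`. -/
def diffAlong (Y Z : EffectiveDivisor X) : (Y.ideal k).sheaf ⟶ (formsAlong k Y Z).sheaf :=
  GermSheaf.hom _ _ le_top
    (fun x => ((D k (X.presheaf.stalk x) :
      Derivation k (X.presheaf.stalk x) Ω[X.presheaf.stalk x⁄k]) :
        X.presheaf.stalk x →ₗ[k] Ω[X.presheaf.stalk x⁄k])) fun U s hs =>
    ⟨(((diff (k := k) Y Z).hom.app (op U)).hom ⟨s, hs⟩).2,
      fun x => D_mem_diffIdealAt (hs.2 ⟨x, x.2.1, trivial⟩)⟩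

theorem ideal_le_zero (Y : EffectiveDivisor X) (x : X) :
    Y.idealAt x ≤ (EffectiveDivisor.zero X).idealAt x :=
  le_top.trans (idealAt_eq_top _ rfl).ge

/-- The inclusion `I_Y ⊆ I_Y I_{Z_red} I_Z⁻¹`. -/
def toInvIdealAlong (Y Z : EffectiveDivisor X) :
    (Y.ideal k).sheaf ⟶ (invIdealAlong k Y Z).sheaf :=
  GermSheaf.hom _ _ le_top (fun _ => LinearMap.id) fun U s hs =>
    ⟨(((toInvIdeal (k := k) Z Z.subRed).hom.app (op U)).hom
      ⟨s, hs.1, fun x => ideal_le_zero Y x (hs.2 x)⟩).2, fun x => hs.2 ⟨x, x.2.1, trivial⟩⟩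

/-- The inclusion `I_{Z_red}⁻¹ Ω¹ ⊆ I_Z⁻¹ Ω¹`. -/
def redFormsIncl (Z : EffectiveDivisor X) :
    (polarForms k Z.red).sheaf ⟶ (polarForms k Z).sheaf :=
  GermSheaf.hom _ _ (fun _ hx => mem_compl_red.2 hx) (fun _ => LinearMap.id) fun U ω hω => by
    refine ⟨hω.1.res (inf_le_inf_left _ fun _ hx => mem_compl_red.2 hx), fun W hW a x hx ha => ?_⟩
    obtain ⟨V, hV, hxV, θ, hθ⟩ := hω.2 W hW a x hx (CurveWithModulus.idealAt_red Z x ha)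
    exact ⟨V, hV, hxV, θ, fun y hy hyZ => hθ y hy (mem_compl_red.2 hyZ)⟩

/-- The formula ds = t^{-m-1} (t dg - m g dt) for s = t^{-m} g, freed of denominators. -/
theorem pow_succ_smul_D {A : Type*} [CommRing A] [Algebra k A] (t s : A) (m : ℕ) :
    t ^ (m + 1) • D k A s = t • D k A (t ^ m * s) - ((m : k) • (t ^ m * s)) • D k A t := by
  rcases m with _ | m
  · simp
  · rw [Derivation.leibniz, Derivation.leibniz_pow, Nat.add_sub_cancel, ← Nat.cast_smul_eq_nsmul A]
    simp only [Algebra.smul_def, map_natCast]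
    module

variable (hX : ∀ x : X, IsClosed ({x} : Set X) → ∃ t, IsLocalCoordinate k x t)

include hX in
theorem d_mem_polarForms (Z : EffectiveDivisor X) (U : X.Opens)
    (s : ∀ x : ↥(U ⊓ Z.compl), X.presheaf.stalk (x : X))
    (hs : s ∈ (invIdeal k Z Z.subRed).sections U) :
    (fun x : ↥(U ⊓ Z.compl) => D k _ (s x)) ∈ (polarForms k Z).sections U := by
  refine mem_polarForms hs.1.d fun x hx hxZ => ?_
  obtain ⟨t, ht⟩ := hX x (Z.isClosed_singleton x hxZ)
  obtain ⟨m, hm⟩ := Nat.exists_eq_succ_of_ne_zero hxZ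
  obtain ⟨g, hg⟩ := exists_of_mem_invIdeal ht hs hx
  rw [subRed_mult, hm, Nat.succ_sub_one] at hg
  -- For s = t^{-m} g the numerator of ds is (tδ - m)g.
  refine ⟨t, ht, t * ht.isCoordinate.deriv g + -(m : k) • g, ?_⟩
  filter_upwards [hg, ht.D_spread g, spread_mul (k := k) t (ht.isCoordinate.deriv g),
    spread_smul (k := k) (-(m : k)) g,
    spread_add (k := k) (t * ht.isCoordinate.deriv g) (-(m : k) • g)] with y h₁ h₂ h₃ h₄ h₅ hy
  rw [hm, Nat.succ_eq_add_one, pow_succ_smul_D, h₁ hy, h₂, h₅, h₃, h₄, smul_smul, neg_smul, add_smul, neg_smul,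
    sub_eq_add_neg]

/-- The differential `d : I_Y I_{Z_red} I_Z⁻¹ → I_Z⁻¹ Ω¹`. -/
def diffInv (Y Z : EffectiveDivisor X) :
    (invIdealAlong k Y Z).sheaf ⟶ (polarForms k Z).sheaf :=
  GermSheaf.hom _ _ le_rfl
    (fun x => ((D k (X.presheaf.stalk x) :
      Derivation k (X.presheaf.stalk x) Ω[X.presheaf.stalk x⁄k]) :
        X.presheaf.stalk x →ₗ[k] Ω[X.presheaf.stalk x⁄k])) fun U s hs =>
    d_mem_polarForms hX Z U s hs.1

/-- This uses only that |Y| and |Z| are disjoint: off |Z| the sheaf I_{Z_red} I_Z⁻¹ coincides with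
𝒪_X, and off |Y| it coincides with I_Y I_{Z_red} I_Z⁻¹. -/
theorem bicartesian_invIdeal {Y Z : EffectiveDivisor X} (h : ∀ x, Y.mult x = 0 ∨ Z.mult x = 0) :
    Bicartesian (idealIncl (k := k) Y (EffectiveDivisor.zero X) (ideal_le_zero Y))
      (toInvIdealAlong Y Z) (toInvIdeal Z Z.subRed) (invIdealAlongIncl Y Z) := by
  refine Bicartesian.of_sections rfl ?_ ?_ ?_
  · intro U a ha _
    apply Subtype.ext
    exact congrArg (fun b : ((EffectiveDivisor.zero X).ideal k).sections U => b.1) ha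
  · rintro U ⟨s, hs⟩ ⟨g, hg⟩ e
    have e' : ∀ x : ↥(U ⊓ Z.compl), s ⟨x, x.2.1, trivial⟩ = g x :=
      fun x => congrFun (congrArg Subtype.val e) x
    refine ⟨⟨s, hs.1, fun x => ?_⟩, rfl, Subtype.ext (funext e')⟩
    by_cases hx : (x : X) ∈ Z.compl
    · exact Set.mem_of_eq_of_mem (e' ⟨x, x.2.1, hx⟩) (hg.2 ⟨x, x.2.1, hx⟩)
    · exact (idealAt_eq_top Y ((h x).resolve_right hx)).ge trivial
  · rintro U ⟨g, hg⟩ x hx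
    by_cases hxZ : x ∈ Z.compl
    · refine ⟨U ⊓ Z.compl, inf_le_left, ⟨hx, hxZ⟩,
        ⟨fun y => g ⟨y, y.2.1⟩, hg.1.res inf_le_left, fun y => ?_⟩, 0, ?_⟩
      · exact (idealAt_eq_top _ rfl).ge trivial
      · rw [map_zero, add_zero]
        rfl
    · refine ⟨U ⊓ Y.compl, inf_le_left, ⟨hx, (h x).resolve_right hxZ⟩, 0,
        ⟨fun y => g ⟨y, y.2.1.1, y.2.2⟩, (invIdeal k Z Z.subRed).res inf_le_left g hg, fun y => ?_⟩, ?_⟩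
      · exact (idealAt_eq_top Y y.2.1.2).ge trivial
      · rw [map_zero, zero_add]
        rfl

end EffectiveDivisor

end CurveModulus

/-! ### The square for Z: reducing the order of poles. -/

namespace CurveModulus

open KaehlerDifferential Topology Filter

namespace EffectiveDivisor

variable {k : Type u} [Field k] {X : Scheme.{u}} [X.Over (Spec (CommRingCat.of k))]

/-- A function on `U ∖ |Z|` which extends near every point of `|Z|` extends to `U`. -/
theorem exists_isFun_extension {Z : EffectiveDivisor X} {U : X.Opens}
    {h : ∀ x : ↥(U ⊓ Z.compl), X.presheaf.stalk (x : X)} (hh : IsFun k (U ⊓ Z.compl) h)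
    (H : ∀ x ∈ U, x ∉ Z.compl → ∃ c : X.presheaf.stalk x, ∀ᶠ y in 𝓝 x,
      ∀ hy : y ∈ U ⊓ Z.compl, h ⟨y, hy⟩ = spread k c y) :
    ∃ s : ∀ x : ↥(U ⊓ ⊤), X.presheaf.stalk (x : X), IsFun k (U ⊓ ⊤) s ∧
      ∀ (x : X) (hx : x ∈ U ⊓ Z.compl), s ⟨x, hx.1, trivial⟩ = h ⟨x, hx⟩ := by
  classical
  choose c hc using H
  let s : ∀ x : ↥(U ⊓ ⊤), X.presheaf.stalk (x : X) := fun x =>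
    if hx : (x : X) ∈ Z.compl then h ⟨x, x.2.1, hx⟩ else c x x.2.1 hx
  have hs : ∀ (x : X) (hx : x ∈ U ⊓ Z.compl), s ⟨x, hx.1, trivial⟩ = h ⟨x, hx⟩ :=
    fun x hx => dif_pos hx.2
  refine ⟨s, fun x hx => ?_, hs⟩
  by_cases hxZ : x ∈ Z.compl
  · obtain ⟨W, hxW, hW, a, ha⟩ := hh x ⟨hx.1, hxZ⟩
    exact ⟨W, hxW, hW.trans (inf_le_inf_left _ le_top), a,
      fun y hy => (hs y (hW hy)).trans (ha y hy)⟩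
  · have hsx : s ⟨x, hx⟩ = c x hx.1 hxZ := dif_neg hxZ
    obtain ⟨V, hxV, a, -, ha⟩ := exists_spread_eq (k := k) (c x hx.1 hxZ)
    -- The neighbourhood is shrunk until x is its only point in |Z|.
    obtain ⟨V', hxV', hV'⟩ := exists_opens_of_eventually
      ((hc x hx.1 hxZ).and (eventually_mem_compl Z x))
    refine ⟨V ⊓ V' ⊓ U, ⟨⟨hxV, hxV'⟩, hx.1⟩, le_inf inf_le_right le_top,
      resHom k (inf_le_left.trans inf_le_left) a, fun y hy => ?_⟩
    rw [germHom_resHom, ← ha y hy.1.1]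
    by_cases hyx : y = x
    · subst hyx
      exact hsx.trans (spread_self _).symm
    · have hyZ := (hV' y hy.1.2).2 hyx
      exact (hs y ⟨hy.2, hyZ⟩).trans ((hV' y hy.1.2).1 ⟨hy.2, hyZ⟩)

variable [CharZero k] (hX : ∀ x : X, IsClosed ({x} : Set X) → ∃ t, IsLocalCoordinate k x t)

/-- A function with poles bounded by `Z - Z_red` whose differential has at most simple poles is
regular. -/
theorem exists_eventually_eq_spread {x : X} {t : X.presheaf.stalk x} (ht : IsLocalCoordinate k x t)
    {Z : EffectiveDivisor X} {U : X.Opens} {h : ∀ x : ↥(U ⊓ Z.compl), X.presheaf.stalk (x : X)}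
    {ω : ∀ x : ↥(U ⊓ Z.red.compl), Ω[X.presheaf.stalk (x : X)⁄k]}
    (hh : h ∈ (invIdeal k Z Z.subRed).sections U) (hω : ω ∈ (polarForms k Z.red).sections U)
    (e : ∀ (x : X) (hx : x ∈ U ⊓ Z.compl),
      D k _ (h ⟨x, hx⟩) = ω ⟨x, hx.1, mem_compl_red.2 hx.2⟩)
    (hx : x ∈ U) (hxZ : x ∉ Z.compl) :
    ∃ c : X.presheaf.stalk x, ∀ᶠ y in 𝓝 x, ∀ hy : y ∈ U ⊓ Z.compl, h ⟨y, hy⟩ = spread k c y := by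
  obtain ⟨m, hm⟩ := Nat.exists_eq_succ_of_ne_zero hxZ
  obtain ⟨g, hg⟩ := exists_of_mem_invIdeal ht hh hx
  rw [subRed_mult, hm, Nat.succ_sub_one] at hg
  obtain ⟨g₁, hg₁⟩ := exists_of_mem_polarForms ht hω hx
  have hred : Z.red.mult x = 1 := by
    change min 1 (Z.mult x) = 1
    omega
  rw [hred] at hg₁
  set δ := ht.isCoordinate.deriv
  -- With h = t^{-m} g and ω = t^{-1} g₁ dt, comparison of the coefficients of dt in t^{m+1} dh =
  -- t^{m+1} ω gives (tδ - m)g = t^m g₁ off x, hence at x.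
  have key : t * δ g + -(m : k) • g + -(1 : k) • (t ^ m * g₁) = 0 := by
    refine ht.eq_zero_of_eventually ?_
    filter_upwards [hg, hg₁, ht.D_spread g, ht.isCoordinate_spread, eventually_mem U hx,
      eventually_mem_compl Z x, spread_mul (k := k) t (δ g), spread_smul (k := k) (-(m : k)) g,
      spread_add (k := k) (t * δ g) (-(m : k) • g), spread_mul (k := k) (t ^ m) g₁,
      spread_pow (k := k) t m, spread_smul (k := k) (-(1 : k)) (t ^ m * g₁),
      spread_add (k := k) (t * δ g + -(m : k) • g) (-(1 : k) • (t ^ m * g₁))]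
      with y h₁ h₂ h₃ h₄ hyU hyZ h₅ h₆ h₇ h₈ h₉ h₁₀ h₁₁ hyx
    have hy : y ∈ U ⊓ Z.compl := ⟨hyU, hyZ hyx⟩
    have h₁₂ := pow_succ_smul_D (k := k) (spread k t y) (h ⟨y, hy⟩) m
    rw [h₁ hy, h₃, e y hy, pow_succ, mul_smul] at h₁₂
    have h₁₃ := h₂ ⟨hyU, mem_compl_red.2 hy.2⟩
    rw [pow_one] at h₁₃
    rw [h₁₃] at h₁₂
    refine h₄.1 ?_
    change _ • _ = (0 : X.presheaf.stalk y) • _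
    rw [h₁₁, h₁₀, h₇, h₅, h₆, h₈, h₉, zero_smul]
    rw [← sub_eq_zero, ← neg_eq_zero] at h₁₂
    rw [← h₁₂]
    simp only [neg_smul, one_smul]
    module
  -- The scalars -m + i are nonzero for i < m, so t^m divides g and the pole of h disappears.
  have hdvd : t ^ m ∣ g := by
    refine Derivation.dvd_of_pow_dvd_euler δ ht.isCoordinate.deriv_self (-(m : k)) m ?_ g ⟨g₁, ?_⟩
    · intro i hi h0
      rw [neg_add_eq_zero, Nat.cast_inj] at h0
      omega
    · rw [neg_one_smul, ← sub_eq_add_neg, sub_eq_zero] at key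
      exact key
  obtain ⟨c, rfl⟩ := hdvd
  refine ⟨c, ?_⟩
  filter_upwards [hg, ht.isUnit_spread, spread_mul (k := k) (t ^ m) c, spread_pow (k := k) t m]
    with y h₁ h₂ h₃ h₄ hy
  have hyx : y ≠ x := fun h' => hxZ (h' ▸ hy.2)
  have h₅ := h₁ hy
  rw [h₃, h₄] at h₅
  exact ((h₂ hyx).pow m).mul_left_cancel h₅

/-- If ω = t^{-m-1} g dt, solve g = (tδ - m)h + t^m c. Then s = t^{-m} h satisfies ω - ds = t^{-1} c
dt, a simple pole. The value i = m, where -m + i vanishes, is the obstruction that leaves this pole.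
-/
theorem exists_decomposition_polarForms {x : X} {t : X.presheaf.stalk x}
    (ht : IsLocalCoordinate k x t) {Y Z : EffectiveDivisor X} {U : X.Opens}
    {ω : ∀ x : ↥(U ⊓ Z.compl), Ω[X.presheaf.stalk (x : X)⁄k]}
    (hω : ω ∈ (polarForms k Z).sections U) (hx : x ∈ U) (hxZ : x ∉ Z.compl) (hxY : x ∈ Y.compl) :
    ∃ (V : X.Opens) (hV : V ≤ U) (_ : x ∈ V) (s : ∀ x : ↥(V ⊓ Z.compl), X.presheaf.stalk (x : X)),
      s ∈ (invIdealAlong k Y Z).sections V ∧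
      (fun y : ↥(V ⊓ Z.red.compl) => ω ⟨y, hV y.2.1, mem_compl_red.1 y.2.2⟩ -
        D k _ (s ⟨y, y.2.1, mem_compl_red.1 y.2.2⟩)) ∈ (polarForms k Z.red).sections V := by
  obtain ⟨m, hm⟩ := Nat.exists_eq_succ_of_ne_zero hxZ
  obtain ⟨g, hg⟩ := exists_of_mem_polarForms ht hω hx
  rw [hm] at hg
  set δ := ht.isCoordinate.deriv
  obtain ⟨h, c, e⟩ := Derivation.exists_euler_add_pow_mul δ ht.isCoordinate.deriv_self
    (-(m : k)) m (fun i hi h0 => by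
      rw [neg_add_eq_zero, Nat.cast_inj] at h0
      omega) g
  obtain ⟨V₁, hxV₁, hV₁⟩ := exists_isFun_spread (k := k) h
  obtain ⟨V₂, hxV₂, hV₂⟩ := exists_isFun_spread (k := k) t
  have e₁ := spread_add (k := k) (t * δ h + -(m : k) • h) (t ^ m * c)
  rw [← e] at e₁
  obtain ⟨V₃, hxV₃, hV₃⟩ := exists_opens_of_eventually
    ((eventually_mem_compl Z x).and (ht.isUnit_spread.and (eventually_mem Y.compl hxY)))
  let V := V₁ ⊓ V₂ ⊓ V₃ ⊓ U
  have hxV : x ∈ V := ⟨⟨⟨hxV₁, hxV₂⟩, hxV₃⟩, hx⟩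
  have hV : ∀ y ∈ V, y ∉ Z.compl → y = x := fun y hy hyZ => by_contra fun hyx =>
    hyZ ((hV₃ y hy.1.2).1 hyx)
  have hunit : ∀ y ∈ V ⊓ Z.compl, IsUnit (spread k t y ^ m) := fun y hy =>
    ((hV₃ y hy.1.1.2).2.1 fun h' => hxZ (h' ▸ hy.2)).pow m
  -- Off |Z| the germ of t is a unit, so `Ring.inverse` is a genuine inverse where s is defined.
  let s : ∀ x : ↥(V ⊓ Z.compl), X.presheaf.stalk (x : X) :=
    fun y => Ring.inverse (spread k t y ^ m) * spread k h y
  have hs : ∀ y (hy : y ∈ V ⊓ Z.compl), spread k t y ^ m * s ⟨y, hy⟩ = spread k h y := fun y hy =>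
    Ring.mul_inverse_cancel_left _ _ (hunit y hy)
  have hsF : IsFun k (V ⊓ Z.compl) s := by
    refine IsFun.mul (IsFun.inverse (IsFun.pow ?_ m) fun y => hunit y y.2) ?_
    · exact hV₂.res (inf_le_left.trans (inf_le_left.trans (inf_le_left.trans inf_le_right)))
    · exact hV₁.res (inf_le_left.trans (inf_le_left.trans (inf_le_left.trans inf_le_left)))
  refine ⟨V, inf_le_right, hxV, s, ⟨mem_invIdeal hsF fun y hy hyZ => ?_, fun y => ?_⟩,
    mem_polarForms ?_ fun y hy hyZ => ?_⟩
  · obtain rfl := hV y hy hyZ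
    refine ⟨t, ht, h, .of_forall fun z hz => ?_⟩
    rw [subRed_mult, hm, Nat.succ_sub_one]
    exact hs z hz
  · exact (idealAt_eq_top Y (hV₃ y y.2.1.1.2).2.2).ge trivial
  · exact IsForm.sub
      (IsForm.res (V := U ⊓ Z.compl) (V' := V ⊓ Z.red.compl)
        (fun y hy => ⟨hy.1.2, mem_compl_red.1 hy.2⟩) hω.1)
      (IsForm.res (V := V ⊓ Z.compl) (V' := V ⊓ Z.red.compl)
        (fun y hy => ⟨hy.1, mem_compl_red.1 hy.2⟩) hsF.d)
  · obtain rfl := hV y hy fun h' => hyZ (mem_compl_red.2 h')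
    have hred : Z.red.mult y = 1 := by
      change min 1 (Z.mult y) = 1
      omega
    refine ⟨t, ht, c, ?_⟩
    rw [hred]
    filter_upwards [hg, ht.D_spread h, e₁, spread_mul (k := k) t (δ h),
      spread_smul (k := k) (-(m : k)) h, spread_add (k := k) (t * δ h) (-(m : k) • h),
      spread_mul (k := k) (t ^ m) c, spread_pow (k := k) t m] with z h₁ h₂ h₃ h₄ h₅ h₆ h₇ h₈ hz
    have hz' : z ∈ V ⊓ Z.compl := ⟨hz.1, mem_compl_red.1 hz.2⟩
    have h₉ := pow_succ_smul_D (k := k) (spread k t z) (s ⟨z, hz'⟩) m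
    rw [hs z hz', h₂] at h₉
    refine (hunit z hz').smul_left_cancel.1 ?_
    rw [smul_smul, pow_one, ← pow_succ, smul_sub, h₁ ⟨hz.1.2, hz'.2⟩, h₉, h₃, h₆, h₄, h₅, h₇, h₈]
    simp only [neg_smul]
    module

omit [CharZero k] in
include hX in
-- Points of |Z| are isolated in |Z|, so near each of them the function vanishes on a punctured
-- neighbourhood.
theorem eq_zero_of_forall_compl {Z : EffectiveDivisor X} {V : X.Opens}
    {s : ∀ x : V, X.presheaf.stalk (x : X)} (hs : IsFun k V s)
    (h : ∀ (x : X) (hx : x ∈ V), x ∈ Z.compl → s ⟨x, hx⟩ = 0) (x : V) : s x = 0 := by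
  obtain ⟨x, hx⟩ := x
  by_cases hxZ : x ∈ Z.compl
  · exact h x hx hxZ
  · obtain ⟨t, ht⟩ := hX x (Z.isClosed_singleton x hxZ)
    refine ht.eq_zero_of_eventually ?_
    filter_upwards [hs.eventually hx, eventually_mem_compl Z x, eventually_mem V hx]
      with y h₁ h₂ hyV hyx
    rw [← h₁ hyV]
    exact h y hyV (h₂ hyx)

/-- Cartesian: a function with bounded poles whose differential has at most simple poles is regular,
and membership in I_Y can be read off outside |Z| because |Y| does not meet |Z|. Locally surjective:
near |Z| a polar form is an exact one plus one with a simple pole. -/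
theorem bicartesian_polarForms {Y Z : EffectiveDivisor X}
    (h : ∀ x, Y.mult x = 0 ∨ Z.mult x = 0) :
    Bicartesian (toInvIdealAlong Y Z) (diff Y Z.red) (diffInv hX Y Z) (redFormsIncl Z) := by
  refine Bicartesian.of_sections rfl ?_ ?_ ?_
  · rintro U ⟨s, hs⟩ ha _
    have ha' : ∀ (x : X) (hx : x ∈ U ⊓ Z.compl), s ⟨x, hx.1, trivial⟩ = 0 := fun x hx =>
      congrFun (congrArg (fun b : (invIdealAlong k Y Z).sections U => b.1) ha) ⟨x, hx⟩
    exact Subtype.ext (funext (eq_zero_of_forall_compl hX hs.1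
      fun x hx hxZ => ha' x ⟨hx.1, hxZ⟩))
  · rintro U ⟨g, hg⟩ ⟨ω, hω⟩ e
    have e' : ∀ (x : X) (hx : x ∈ U ⊓ Z.compl),
        D k (X.presheaf.stalk x) (g ⟨x, hx⟩) = ω ⟨x, hx.1, mem_compl_red.2 hx.2⟩ := fun x hx =>
      congrFun (congrArg (fun b : (polarForms k Z).sections U => b.1) e) ⟨x, hx⟩
    obtain ⟨s, hs, hsg⟩ := exists_isFun_extension (k := k) (h := g) hg.1.1 fun x hx hxZ => by
      obtain ⟨t, ht⟩ := hX x (Z.isClosed_singleton x hxZ)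
      exact exists_eventually_eq_spread ht hg.1 hω e' hx hxZ
    refine ⟨⟨s, hs, fun x => ?_⟩, ?_, ?_⟩
    · by_cases hx : (x : X) ∈ Z.compl
      · exact Set.mem_of_eq_of_mem (hsg x ⟨x.2.1, hx⟩) (hg.2 ⟨x, x.2.1, hx⟩)
      · exact (idealAt_eq_top Y ((h x).resolve_right hx)).ge trivial
    · exact Subtype.ext (funext fun x => hsg x x.2)
    · refine Subtype.ext (funext fun x => ?_)
      have hx : (x : X) ∈ U ⊓ Z.compl := ⟨x.2.1, mem_compl_red.1 x.2.2⟩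
      exact (congrArg (D k _) (hsg x hx)).trans (e' x hx)
  · rintro U ⟨ω, hω⟩ x hx
    by_cases hxZ : x ∈ Z.compl
    · refine ⟨U ⊓ Z.compl, inf_le_left, ⟨hx, hxZ⟩, 0,
        ⟨fun y => ω ⟨y, y.2.1⟩, mem_polarForms (hω.1.res inf_le_left) fun y hy hyZ =>
          absurd (mem_compl_red.2 hy.2) hyZ⟩, ?_⟩
      rw [map_zero, zero_add]
      rfl
    · obtain ⟨t, ht⟩ := hX x (Z.isClosed_singleton x hxZ)
      obtain ⟨V, hV, hxV, s, hs, hω'⟩ := exists_decomposition_polarForms ht (Y := Y) hω hx hxZ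
        ((h x).resolve_right hxZ)
      refine ⟨V, hV, hxV, ⟨s, hs⟩, ⟨_, hω'⟩, ?_⟩
      exact Subtype.ext (funext fun y => (add_sub_cancel
        (G := Ω[X.presheaf.stalk (y : X)⁄k]) (D k _ (s y)) (ω ⟨y, hV y.2.1, y.2.2⟩)).symm)

end EffectiveDivisor

end CurveModulus

/-! ### The square for Y: forms generated by differentials of the ideal. -/

namespace CurveModulus

open KaehlerDifferential Topology Filter

namespace EffectiveDivisor

variable {k : Type u} [Field k] {X : Scheme.{u}} [X.Over (Spec (CommRingCat.of k))]

/-- A generator is d(t^{m+1} b) = t^m ((m + 1)b + tδb) dt. -/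
theorem exists_of_mem_diffIdealAt {x : X} {t : X.presheaf.stalk x} (ht : IsLocalCoordinate k x t)
    {Y : EffectiveDivisor X} {m : ℕ} (hm : Y.mult x = m + 1) {ω : Ω[X.presheaf.stalk x⁄k]}
    (hω : ω ∈ Y.diffIdealAt k x) : ∃ c, ω = (t ^ m * c) • D k _ t := by
  induction hω using Submodule.span_induction with
  | mem ω h =>
    obtain ⟨a, ha, rfl⟩ := h
    rw [SetLike.mem_coe, idealAt, hm, ht.mem_pow_iff] at ha
    obtain ⟨b, rfl⟩ := ha
    refine ⟨(m + 1 : ℕ) * b + t * ht.isCoordinate.deriv b, ?_⟩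
    rw [ht.isCoordinate.D_eq, Derivation.leibniz, Derivation.leibniz_pow,
      ht.isCoordinate.deriv_self, Nat.add_sub_cancel, smul_eq_mul, smul_eq_mul, nsmul_eq_mul,
      smul_eq_mul]
    congr 1
    ring
  | zero => exact ⟨0, by simp⟩
  | add ω ω' _ _ h h' =>
    obtain ⟨c, rfl⟩ := h
    obtain ⟨c', rfl⟩ := h'
    exact ⟨c + c', by rw [mul_add, add_smul]⟩
  | smul a ω _ h =>
    obtain ⟨c, rfl⟩ := h
    exact ⟨a * c, by rw [smul_smul, mul_left_comm]⟩

variable [CharZero k]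

/-- In characteristic zero, t^m dt is (m + 1)⁻¹ d(t^{m+1}). -/
theorem smul_D_mem_diffIdealAt {x : X} {t : X.presheaf.stalk x} (ht : IsLocalCoordinate k x t)
    {Y : EffectiveDivisor X} {m : ℕ} (hm : Y.mult x = m + 1) (c : X.presheaf.stalk x) :
    (t ^ m * c) • D k _ t ∈ Y.diffIdealAt k x := by
  have h₁ : D k _ (t ^ (m + 1)) ∈ Y.diffIdealAt k x := D_mem_diffIdealAt (by
    rw [idealAt, hm]
    exact Ideal.pow_mem_pow ht.mem_maximalIdeal _)
  have h₂ : ((m + 1 : ℕ) : k) ≠ 0 := Nat.cast_ne_zero.2 m.succ_ne_zero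
  have h₃ := Submodule.smul_mem _ (algebraMap k _ ((m + 1 : ℕ) : k)⁻¹ * c) h₁
  convert h₃ using 1
  rw [Derivation.leibniz_pow, Nat.add_sub_cancel, ← Nat.cast_smul_eq_nsmul (X.presheaf.stalk x),
    smul_smul, smul_smul]
  congr 1
  have h₄ : algebraMap k (X.presheaf.stalk x) ((m + 1 : ℕ) : k)⁻¹ * ((m + 1 : ℕ) : _) = 1 := by
    rw [← map_natCast (algebraMap k (X.presheaf.stalk x)), ← map_mul, inv_mul_cancel₀ h₂, map_one]
  linear_combination - (t ^ m * c) * h₄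

/-- Write a = tc. Then da = (tδ + 1)c dt is a multiple of t^m dt, and injectivity of tδ + 1 modulo
t^m gives that t^m divides c. -/
theorem mem_idealAt_of_D_mem {x : X} {t : X.presheaf.stalk x} (ht : IsLocalCoordinate k x t)
    {Y : EffectiveDivisor X} (hY : Y.mult x ≠ 0) {a : X.presheaf.stalk x}
    (ha : a ∈ Y.red.idealAt x) (h : D k _ a ∈ Y.diffIdealAt k x) : a ∈ Y.idealAt x := by
  obtain ⟨m, hm⟩ := Nat.exists_eq_succ_of_ne_zero hY
  have hred : Y.red.mult x = 1 := by
    change min 1 (Y.mult x) = 1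
    omega
  rw [idealAt, hred, ht.mem_pow_iff, pow_one] at ha
  obtain ⟨c, rfl⟩ := ha
  obtain ⟨b, hb⟩ := exists_of_mem_diffIdealAt ht hm h
  set δ := ht.isCoordinate.deriv
  have h₁ : δ (t * c) = t ^ m * b :=
    ht.isCoordinate.1 ((ht.isCoordinate.D_eq _).symm.trans hb)
  rw [Derivation.leibniz, ht.isCoordinate.deriv_self, smul_eq_mul, smul_eq_mul, mul_one] at h₁
  have h₂ : t ^ m ∣ c := by
    refine Derivation.dvd_of_pow_dvd_euler δ ht.isCoordinate.deriv_self (1 : k) m ?_ c ⟨b, ?_⟩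
    · intro i _ h0
      rw [← Nat.cast_one, ← Nat.cast_add, Nat.cast_eq_zero] at h0
      omega
    · rw [one_smul, h₁]
  rw [idealAt, hm, ht.mem_pow_iff, Nat.succ_eq_add_one, pow_succ']
  exact mul_dvd_mul_left t h₂

/-- Near a point of |Y| the form is regular, ω = g dt. Solving g = (tδ + 1)h + t^m c gives ω - d(th)
= t^m c dt, where th lies in I_{Y_red}. -/
theorem exists_decomposition_formsAlong {x : X} {t : X.presheaf.stalk x}
    (ht : IsLocalCoordinate k x t) {Y Z : EffectiveDivisor X} {U : X.Opens}
    {ω : ∀ x : ↥(U ⊓ Z.compl), Ω[X.presheaf.stalk (x : X)⁄k]}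
    (hω : ω ∈ (polarForms k Z).sections U) (hx : x ∈ U) (hxZ : x ∈ Z.compl) (hxY : x ∉ Y.compl) :
    ∃ (V : X.Opens) (hV : V ≤ U) (_ : x ∈ V)
      (s : ∀ x : ↥(V ⊓ ⊤), X.presheaf.stalk (x : X)), s ∈ (Y.red.ideal k).sections V ∧
      (fun y : ↥(V ⊓ Z.compl) => ω ⟨y, hV y.2.1, y.2.2⟩ -
        D k _ (s ⟨y, y.2.1, trivial⟩)) ∈ (formsAlong k Y Z).sections V := by
  obtain ⟨m, hm⟩ := Nat.exists_eq_succ_of_ne_zero hxY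
  have hred : Y.red.mult x = 1 := by
    change min 1 (Y.mult x) = 1
    omega
  obtain ⟨g, hg⟩ := hω.1.eventually ⟨hx, hxZ⟩ ht
  set δ := ht.isCoordinate.deriv
  obtain ⟨h, c, e⟩ := Derivation.exists_euler_add_pow_mul δ ht.isCoordinate.deriv_self
    (1 : k) m (fun i _ h0 => by
      rw [← Nat.cast_one, ← Nat.cast_add, Nat.cast_eq_zero] at h0
      omega) g
  obtain ⟨V₁, hxV₁, hV₁⟩ := exists_isFun_spread (k := k) (t * h)
  obtain ⟨V₂, hxV₂, hV₂⟩ := exists_opens_of_eventually (eventually_mem_compl Y x)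
  let V := V₁ ⊓ V₂ ⊓ (U ⊓ Z.compl)
  have hV : ∀ y ∈ V, y ∉ Y.compl → y = x := fun y hy hyY => by_contra fun hyx =>
    hyY (hV₂ y hy.1.2 hyx)
  have hVU : V ≤ U := inf_le_right.trans inf_le_left
  have hsF : IsFun k (V ⊓ ⊤) fun y => spread k (t * h) y :=
    hV₁.res (inf_le_left.trans (inf_le_left.trans inf_le_left))
  refine ⟨V, hVU, ⟨⟨hxV₁, hxV₂⟩, hx, hxZ⟩, fun y => spread k (t * h) y,
    ⟨hsF, fun y => ?_⟩, ⟨mem_polarForms ?_ fun y hy hyZ => absurd hy.2.2 hyZ, fun y => ?_⟩⟩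
  · by_cases hyY : (y : X) ∈ Y.compl
    · exact (idealAt_eq_top Y.red (mem_compl_red.2 hyY)).ge trivial
    · obtain ⟨y, hy⟩ := y
      obtain rfl := hV y hy.1 hyY
      change spread k (t * h) y ∈ Y.red.idealAt y
      rw [spread_self, idealAt, hred, pow_one]
      exact Ideal.mul_mem_right _ _ ht.mem_maximalIdeal
  · exact IsForm.sub (IsForm.res (V := U ⊓ Z.compl) (V' := V ⊓ Z.compl)
        (inf_le_inf_right _ hVU) hω.1)
      (IsForm.res (V := V ⊓ ⊤) (V' := V ⊓ Z.compl) (inf_le_inf_left _ le_top) hsF.d)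
  · by_cases hyY : (y : X) ∈ Y.compl
    · exact (diffIdealAt_eq_top Y hyY).ge trivial
    · obtain ⟨y, hy⟩ := y
      obtain rfl := hV y hy.1 hyY
      have h₁ : ω ⟨y, hx, hxZ⟩ - D k _ (spread k (t * h) y) = (t ^ m * c) • D k _ t := by
        rw [hg.self_of_nhds ⟨hx, hxZ⟩, spread_self, spread_self, spread_self,
          ht.isCoordinate.D_eq (t * h), Derivation.leibniz, ht.isCoordinate.deriv_self, e,
          ← sub_smul]
        congr 1
        simp only [smul_eq_mul, one_smul]
        ring
      exact Set.mem_of_eq_of_mem h₁ (smul_D_mem_diffIdealAt ht hm c)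

/-- Off |Y| both inclusions are isomorphisms. At a point of |Y| the cartesian property and local
surjectivity are the injectivity and surjectivity of tδ + 1 modulo t^m. -/
theorem bicartesian_formsAlong
    (hX : ∀ x : X, IsClosed ({x} : Set X) → ∃ t, IsLocalCoordinate k x t)
    {Y Z : EffectiveDivisor X} (h : ∀ x, Y.mult x = 0 ∨ Z.mult x = 0) :
    Bicartesian (idealIncl Y Y.red (CurveWithModulus.idealAt_red Y)) (diffAlong (k := k) Y Z)
      (diff Y.red Z) (formsAlongIncl Y Z) := by
  refine Bicartesian.of_sections rfl ?_ ?_ ?_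
  · intro U a ha _
    apply Subtype.ext
    exact congrArg (fun b : (Y.red.ideal k).sections U => b.1) ha
  · rintro U ⟨s, hs⟩ ⟨ω, hω⟩ e
    have e' : ∀ (x : X) (hx : x ∈ U ⊓ Z.compl),
        D k (X.presheaf.stalk x) (s ⟨x, hx.1, trivial⟩) = ω ⟨x, hx⟩ := fun x hx =>
      congrFun (congrArg (fun b : (polarForms k Z).sections U => b.1) e) ⟨x, hx⟩
    refine ⟨⟨s, hs.1, fun x => ?_⟩, rfl, Subtype.ext (funext fun x => e' x x.2)⟩
    by_cases hxY : (x : X) ∈ Y.compl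
    · exact (idealAt_eq_top Y hxY).ge trivial
    · obtain ⟨t, ht⟩ := hX x (Y.isClosed_singleton x hxY)
      have hx : (x : X) ∈ U ⊓ Z.compl := ⟨x.2.1, (h x).resolve_left hxY⟩
      exact mem_idealAt_of_D_mem ht hxY (hs.2 x) (Set.mem_of_eq_of_mem (e' x hx) (hω.2 ⟨x, hx⟩))
  · rintro U ⟨ω, hω⟩ x hx
    by_cases hxY : x ∈ Y.compl
    · refine ⟨U ⊓ Y.compl, inf_le_left, ⟨hx, hxY⟩, 0,
        ⟨fun y => ω ⟨y, y.2.1.1, y.2.2⟩, (polarForms k Z).res inf_le_left ω hω, fun y => ?_⟩, ?_⟩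
      · exact (diffIdealAt_eq_top Y y.2.1.2).ge trivial
      · rw [map_zero, zero_add]
        rfl
    · obtain ⟨t, ht⟩ := hX x (Y.isClosed_singleton x hxY)
      obtain ⟨V, hV, hxV, s, hs, hω'⟩ := exists_decomposition_formsAlong ht (Y := Y) hω hx
        ((h x).resolve_left hxY) hxY
      refine ⟨V, hV, hxV, ⟨s, hs⟩, ⟨_, hω'⟩, ?_⟩
      exact Subtype.ext (funext fun y => (add_sub_cancel
        (G := Ω[X.presheaf.stalk (y : X)⁄k]) (D k _ (s ⟨y, y.2.1, trivial⟩))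
        (ω ⟨y, hV y.2.1, y.2.2⟩)).symm)

end EffectiveDivisor

end CurveModulus

/-! ### Compatibility of pullback with maps of two-term complexes. -/

namespace CurveModulus

section TwoTermPull

variable {k : Type u} [Field k] {T T' : TopCat.{u}} {A B A₁ B₁ A₂ B₂ : Sh k T}
  {d : A ⟶ B} {d₁ : A₁ ⟶ B₁} {d₂ : A₂ ⟶ B₂} (f : T ⟶ T') {F G F₁ G₁ F₂ G₂ : Sh k T'} {e : F ⟶ G}
  {e₁ : F₁ ⟶ G₁} {e₂ : F₂ ⟶ G₂} (n : ℤ)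

theorem twoTermHom_congr {α α' : F ⟶ (pushf k f).obj A} {β β' : G ⟶ (pushf k f).obj B}
    (hα : α = α') (hβ : β = β') (comm : α ≫ (pushf k f).map d = e ≫ β) :
    twoTermHom f α β comm = twoTermHom f α' β' (by rw [← hα, comm, hβ]) := by
  subst hα hβ
  rfl

theorem Hyper.map_map {α : A ⟶ A₁} {β : B ⟶ B₁} (h : α ≫ d₁ = d ≫ β) {α' : A₁ ⟶ A₂} {β' : B₁ ⟶ B₂}
    (h' : α' ≫ d₂ = d₁ ≫ β') (c : Hyper n (twoTerm d)) :
    Hyper.map n (twoTermMap α' β' h') (Hyper.map n (twoTermMap α β h) c) =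
      Hyper.map n (twoTermMap (α ≫ α') (β ≫ β') (by rw [Category.assoc, h', reassoc_of% h])) c := by
  rw [← Hyper.map_comp, twoTermMap_comp]

/-- The composite square may be replaced by any square with equal sides, so identities between sheaf
maps can be supplied separately. -/
theorem Hyper.map_map_eq {α : A ⟶ A₁} {β : B ⟶ B₁} (h : α ≫ d₁ = d ≫ β) {α' : A₁ ⟶ A₂}
    {β' : B₁ ⟶ B₂} (h' : α' ≫ d₂ = d₁ ≫ β') {α'' : A ⟶ A₂} {β'' : B ⟶ B₂}
    (h'' : α'' ≫ d₂ = d ≫ β'') (hα : α ≫ α' = α'') (hβ : β ≫ β' = β'') (c : Hyper n (twoTerm d)) :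
    Hyper.map n (twoTermMap α' β' h') (Hyper.map n (twoTermMap α β h) c) =
      Hyper.map n (twoTermMap α'' β'' h'') c := by
  subst hα hβ
  exact Hyper.map_map n h h' c

/-- Pullback is compatible with the maps given by commutative squares. -/
theorem Hyper.pull_map_comm {a : F ⟶ F₁} {b : G ⟶ G₁} (w : a ≫ e₁ = e ≫ b) {a' : A ⟶ A₁}
    {b' : B ⟶ B₁} (w' : a' ≫ d₁ = d ≫ b') {α : F ⟶ (pushf k f).obj A} {β : G ⟶ (pushf k f).obj B}
    (h : α ≫ (pushf k f).map d = e ≫ β) {α₁ : F₁ ⟶ (pushf k f).obj A₁}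
    {β₁ : G₁ ⟶ (pushf k f).obj B₁} (h₁ : α₁ ≫ (pushf k f).map d₁ = e₁ ≫ β₁)
    (hα : a ≫ α₁ = α ≫ (pushf k f).map a') (hβ : b ≫ β₁ = β ≫ (pushf k f).map b')
    (c : Hyper n (twoTerm e)) :
    Hyper.pull f n (twoTermHom f α₁ β₁ h₁) (Hyper.map n (twoTermMap a b w) c) =
      Hyper.map n (twoTermMap a' b' w') (Hyper.pull f n (twoTermHom f α β h) c) := by
  rw [Hyper.pull_map, Hyper.map_pull, twoTermMap_comp_twoTermHom, twoTermHom_comp_map,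
    twoTermHom_congr f hα hβ]

theorem Hyper.pull_map_id_comm {e' : F ⟶ G₁} {d' : A ⟶ B₁} {b : G ⟶ G₁} (w : 𝟙 F ≫ e' = e ≫ b)
    {b' : B ⟶ B₁} (w' : 𝟙 A ≫ d' = d ≫ b') {α : F ⟶ (pushf k f).obj A}
    {β : G ⟶ (pushf k f).obj B} (h : α ≫ (pushf k f).map d = e ≫ β)
    {β₁ : G₁ ⟶ (pushf k f).obj B₁} (h₁ : α ≫ (pushf k f).map d' = e' ≫ β₁)
    (hβ : b ≫ β₁ = β ≫ (pushf k f).map b') (c : Hyper n (twoTerm e)) :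
    Hyper.pull f n (twoTermHom f α β₁ h₁) (Hyper.map n (twoTermMap (𝟙 F) b w) c) =
      Hyper.map n (twoTermMap (𝟙 A) b' w') (Hyper.pull f n (twoTermHom f α β h) c) :=
  Hyper.pull_map_comm f n w w' h h₁ (by rw [Category.id_comp, CategoryTheory.Functor.map_id,
    Category.comp_id])
    hβ c

theorem Hyper.pull_map_eq {a₁ : F ⟶ F₁} {b₁ : G ⟶ G₁} (w₁ : a₁ ≫ e₁ = e ≫ b₁) {a₂ : F ⟶ F₂}
    {b₂ : G ⟶ G₂} (w₂ : a₂ ≫ e₂ = e ≫ b₂)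
    {α₁ : F₁ ⟶ (pushf k f).obj A} {β₁ : G₁ ⟶ (pushf k f).obj B}
    (h₁ : α₁ ≫ (pushf k f).map d = e₁ ≫ β₁) {α₂ : F₂ ⟶ (pushf k f).obj A}
    {β₂ : G₂ ⟶ (pushf k f).obj B} (h₂ : α₂ ≫ (pushf k f).map d = e₂ ≫ β₂)
    (hα : a₁ ≫ α₁ = a₂ ≫ α₂) (hβ : b₁ ≫ β₁ = b₂ ≫ β₂) (c : Hyper n (twoTerm e)) :
    Hyper.pull f n (twoTermHom f α₁ β₁ h₁) (Hyper.map n (twoTermMap a₁ b₁ w₁) c) =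
      Hyper.pull f n (twoTermHom f α₂ β₂ h₂) (Hyper.map n (twoTermMap a₂ b₂ w₂) c) := by
  rw [Hyper.pull_map, Hyper.pull_map, twoTermMap_comp_twoTermHom, twoTermMap_comp_twoTermHom,
    twoTermHom_congr f hα hβ]

theorem Hyper.map_pull_eq {a₁ : A₁ ⟶ A} {b₁ : B₁ ⟶ B} (w₁ : a₁ ≫ d = d₁ ≫ b₁) {a₂ : A₂ ⟶ A}
    {b₂ : B₂ ⟶ B} (w₂ : a₂ ≫ d = d₂ ≫ b₂)
    {α₁ : F ⟶ (pushf k f).obj A₁} {β₁ : G ⟶ (pushf k f).obj B₁}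
    (h₁ : α₁ ≫ (pushf k f).map d₁ = e ≫ β₁) {α₂ : F ⟶ (pushf k f).obj A₂}
    {β₂ : G ⟶ (pushf k f).obj B₂} (h₂ : α₂ ≫ (pushf k f).map d₂ = e ≫ β₂)
    (hα : α₁ ≫ (pushf k f).map a₁ = α₂ ≫ (pushf k f).map a₂)
    (hβ : β₁ ≫ (pushf k f).map b₁ = β₂ ≫ (pushf k f).map b₂) (c : Hyper n (twoTerm e)) :
    Hyper.map n (twoTermMap a₁ b₁ w₁) (Hyper.pull f n (twoTermHom f α₁ β₁ h₁) c) =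
      Hyper.map n (twoTermMap a₂ b₂ w₂) (Hyper.pull f n (twoTermHom f α₂ β₂ h₂) c) := by
  rw [Hyper.map_pull, Hyper.map_pull, twoTermHom_comp_map, twoTermHom_comp_map,
    twoTermHom_congr f hα hβ]

end TwoTermPull

end CurveModulus

/-! ### Pullback on the auxiliary sheaves. -/

namespace CurveModulus

open KaehlerDifferential

namespace EffectiveDivisor

variable {k : Type u} [Field k] {X X' : Scheme.{u}} [X.Over (Spec (CommRingCat.of k))]
  [X'.Over (Spec (CommRingCat.of k))] (f : X ⟶ X') [f.IsOver (Spec (CommRingCat.of k))]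

/-- The submodule is defined through generators da with a in I_Y, so stability under pullback
follows directly from f^* I_{Y'} ⊆ I_Y. -/
theorem kaehlerMap_mem_diffIdealAt {Y' : EffectiveDivisor X'} {Y : EffectiveDivisor X}
    (h : ∀ x, pullIdealAt f Y' x ≤ Y.idealAt x) (x : X) {θ : Ω[X'.presheaf.stalk (f x)⁄k]}
    (hθ : θ ∈ Y'.diffIdealAt k (f x)) : kaehlerMap (stalkHom k f x) θ ∈ Y.diffIdealAt k x := by
  induction hθ using Submodule.span_induction with
  | mem θ hθ =>
    obtain ⟨a, ha, rfl⟩ := hθ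
    rw [kaehlerMap_D]
    exact D_mem_diffIdealAt (h x (Ideal.mem_map_of_mem (f.stalkMap x).hom ha))
  | zero => rw [map_zero]; exact zero_mem _
  | add θ θ' _ _ h h' => rw [map_add]; exact add_mem h h'
  | smul a θ _ h => rw [kaehlerMap_smul]; exact Submodule.smul_mem _ _ h

/-- The pullback of forms generated by differentials of functions in `I_Y`. -/
def formsAlongPull (Y' Z' : EffectiveDivisor X') (Y Z : EffectiveDivisor X)
    (hY : ∀ x, pullIdealAt f Y' x ≤ Y.idealAt x) (hZ : ∀ x ∈ Z.compl, f x ∈ Z'.compl)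
    (h : PullsBackForms (k := k) f Z' Z hZ) :
    (formsAlong k Y' Z').sheaf ⟶ (pushf k f.base).obj (formsAlong k Y Z).sheaf :=
  GermSheaf.pull f.base (formsAlong k Y' Z') (formsAlong k Y Z) hZ
    (fun x => kaehlerMap (stalkHom k f x)) fun U s hs => ⟨h U s hs.1,
      fun x => kaehlerMap_mem_diffIdealAt f hY x (hs.2 ⟨f x, x.2.1, hZ x x.2.2⟩)⟩

theorem diffAlong_pull (Y' Z' : EffectiveDivisor X') (Y Z : EffectiveDivisor X)
    (hY : ∀ x, pullIdealAt f Y' x ≤ Y.idealAt x) (hZ : ∀ x ∈ Z.compl, f x ∈ Z'.compl)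
    (h : PullsBackForms (k := k) f Z' Z hZ) :
    idealPull f Y' Y hY ≫ (pushf k f.base).map (diffAlong Y Z) =
      diffAlong (k := k) Y' Z' ≫ formsAlongPull f Y' Z' Y Z hY hZ h := by
  apply Sheaf.hom_ext
  ext U s
  apply Subtype.ext
  funext x
  exact (kaehlerMap_D (stalkHom k f x) _).symm

/-- The pullback of functions in `I_Y I_{Z_red} I_Z⁻¹`. -/
def invIdealAlongPull (Y' Z' : EffectiveDivisor X') (Y Z : EffectiveDivisor X)
    (hY : ∀ x, pullIdealAt f Y' x ≤ Y.idealAt x) (hZ : ∀ x ∈ Z.compl, f x ∈ Z'.compl)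
    (h : ∀ x, Z.subRed.idealAt x ≤ pullIdealAt f Z'.subRed x) :
    (invIdealAlong k Y' Z').sheaf ⟶ (pushf k f.base).obj (invIdealAlong k Y Z).sheaf :=
  GermSheaf.pull f.base (invIdealAlong k Y' Z') (invIdealAlong k Y Z) hZ
    (fun x => (stalkHom k f x).toLinearMap) fun U s hs =>
      ⟨invIdeal_pull f Z' Z'.subRed Z Z.subRed hZ h U s hs.1,
        fun x => hY x (Ideal.mem_map_of_mem (f.stalkMap x).hom (hs.2 ⟨f x, x.2.1, hZ x x.2.2⟩))⟩

theorem diffInv_pull (hX : ∀ x : X, IsClosed ({x} : Set X) → ∃ t, IsLocalCoordinate k x t)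
    (hX' : ∀ x : X', IsClosed ({x} : Set X') → ∃ t, IsLocalCoordinate k x t)
    (Y' Z' : EffectiveDivisor X') (Y Z : EffectiveDivisor X)
    (hY : ∀ x, pullIdealAt f Y' x ≤ Y.idealAt x) (hZ : ∀ x ∈ Z.compl, f x ∈ Z'.compl)
    (h : ∀ x, Z.subRed.idealAt x ≤ pullIdealAt f Z'.subRed x)
    (hΩ : PullsBackForms (k := k) f Z' Z hZ) :
    diffInv hX' Y' Z' ≫ formsPull f Z' Z hZ hΩ =
      invIdealAlongPull f Y' Z' Y Z hY hZ h ≫ (pushf k f.base).map (diffInv hX Y Z) := by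
  apply Sheaf.hom_ext
  ext U s
  apply Subtype.ext
  funext x
  exact kaehlerMap_D (stalkHom k f x) _

instance mono_idealIncl (D E : EffectiveDivisor X) (h : ∀ x, D.idealAt x ≤ E.idealAt x) :
    Mono (idealIncl (k := k) D E h) := by
  refine Preadditive.mono_of_cancel_zero _ fun {F} g hg => ?_
  apply Sheaf.hom_ext
  ext U s
  apply Subtype.ext
  exact congrArg (fun φ : F ⟶ (E.ideal k).sheaf => ((φ.hom.app U).hom s).1) hg

theorem mono_toInvIdeal (hX : ∀ x : X, IsClosed ({x} : Set X) → ∃ t, IsLocalCoordinate k x t)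
    (Z E : EffectiveDivisor X) : Mono (toInvIdeal (k := k) Z E) := by
  refine Preadditive.mono_of_cancel_zero _ fun {F} g hg => ?_
  apply Sheaf.hom_ext
  ext U s
  apply Subtype.ext
  funext x
  refine eq_zero_of_forall_compl hX (Z := Z) ((g.hom.app U).hom s).2.1 (fun x hx hxZ => ?_) x
  exact congrArg (fun φ : F ⟶ (invIdeal k Z E).sheaf =>
    ((φ.hom.app U).hom s).1 ⟨x, hx.1, hxZ⟩) hg

end EffectiveDivisor

end CurveModulus

/-! ### The decomposition of de Rham cohomology. -/

namespace CurveModulus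

namespace CurveWithModulus

open EffectiveDivisor

variable {k : Type u} [Field k] [CharZero k] (P : CurveWithModulus k)

theorem exists_coordinate (x : P.X) (hx : IsClosed ({x} : Set P.X)) :
    ∃ t, IsLocalCoordinate k x t :=
  have := P.smooth
  exists_isLocalCoordinate x hx

/-- The square which splits off `U(X, Y)`. -/
theorem bicartesian_Y : Bicartesian (idealIncl P.Y P.Y.red (idealAt_red P.Y))
    (diffAlong (k := k) P.Y P.Z.red) (diff P.Y.red P.Z.red) (formsAlongIncl P.Y P.Z.red) :=
  bicartesian_formsAlong P.exists_coordinate P.redZ.disjoint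

/-- The square which splits off `V(X, Z)`. -/
theorem bicartesian_Z : Bicartesian (toInvIdealAlong P.Y P.Z) (diff P.Y P.Z.red)
    (diffInv P.exists_coordinate P.Y P.Z) (redFormsIncl P.Z) :=
  bicartesian_polarForms P.exists_coordinate P.disjoint

omit [CharZero k] in
-- Identifies the quotient of I_Y I_{Z_red} I_Z⁻¹ by I_Y with that of I_{Z_red} I_Z⁻¹ by 𝒪_X, whose
-- sections are V(X, Z).
theorem bicartesian_V : Bicartesian
    (idealIncl (k := k) P.Y (EffectiveDivisor.zero P.X) (ideal_le_zero P.Y))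
      (toInvIdealAlong P.Y P.Z) (toInvIdeal P.Z P.Z.subRed) (invIdealAlongIncl P.Y P.Z) :=
  bicartesian_invIdeal P.disjoint

omit [CharZero k] in
theorem idealIncl_comp_diff : idealIncl P.Y P.Y.red (idealAt_red P.Y) ≫ diff P.Y.red P.Z.red =
    diff (k := k) P.Y P.Z.red := rfl

theorem toInvIdealAlong_comp_diffInv : toInvIdealAlong P.Y P.Z ≫
    diffInv P.exists_coordinate P.Y P.Z = diff (k := k) P.Y P.Z := rfl

/-- The cohomology of `[I_Y ⟶ I_{Z_red}⁻¹ Ω¹]`. -/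
abbrev HRedZ : Type (u + 1) := Hyper 1 (twoTerm (diff (k := k) P.Y P.Z.red))

/-- The cohomology of the subcomplex of `[I_Y ⟶ I_{Z_red}⁻¹ Ω¹]` which is quasi-isomorphic to
`[I_{Y_red} ⟶ I_{Z_red}⁻¹ Ω¹]`. -/
abbrev HAlong : Type (u + 1) := Hyper 1 (twoTerm (diffAlong (k := k) P.Y P.Z.red))

/-- The cohomology of `[I_Y ⟶ I_{Y_red}]`. -/
abbrev HU : Type (u + 1) := Hyper 1 (twoTerm (idealIncl (k := k) P.Y P.Y.red (idealAt_red P.Y)))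

/-- The cohomology of `[I_Y ⟶ I_Y I_{Z_red} I_Z⁻¹]`. -/
abbrev HV : Type (u + 1) := Hyper 1 (twoTerm (toInvIdealAlong (k := k) P.Y P.Z))

/-- The map to `[I_Y ⟶ I_{Z_red}⁻¹ Ω¹]` given by the inclusion of forms. -/
def alongToRedZ : P.HAlong →ₗ[k] P.HRedZ :=
  Hyper.map 1 (twoTermMap (𝟙 _) (formsAlongIncl P.Y P.Z.red) rfl)

/-- The map `[I_Y ⟶ I_{Y_red}] ⟶ [I_Y ⟶ I_{Z_red}⁻¹ Ω¹]` given by `d`. -/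
def uToRedZ : P.HU →ₗ[k] P.HRedZ :=
  Hyper.map 1 (twoTermMap (𝟙 _) (diff P.Y.red P.Z.red) rfl)

/-- The map to `[I_Y ⟶ I_Z⁻¹ Ω¹]` given by the inclusion of forms. -/
def redZTo : P.HRedZ →ₗ[k] P.H1dR :=
  Hyper.map 1 (twoTermMap (d' := diff P.Y P.Z) (𝟙 _) (redFormsIncl P.Z) rfl)

/-- The map `[I_Y ⟶ I_Y I_{Z_red} I_Z⁻¹] ⟶ [I_Y ⟶ I_Z⁻¹ Ω¹]` given by `d`. -/
def vTo : P.HV →ₗ[k] P.H1dR :=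
  Hyper.map 1 (twoTermMap (d' := diff P.Y P.Z) (𝟙 _) (diffInv P.exists_coordinate P.Y P.Z) rfl)

/-- The map which assembles `𝐇¹_dR(X, Y, Z)` from its summands. -/
def assemble : (P.HAlong × P.HU) × P.HV →ₗ[k] P.H1dR :=
  (P.redZTo.comp (P.alongToRedZ.coprod P.uToRedZ)).coprod P.vTo

theorem assemble_apply (c : P.HAlong) (u : P.HU) (v : P.HV) :
    P.assemble ((c, u), v) = P.redZTo (P.alongToRedZ c + P.uToRedZ u) + P.vTo v := rfl

/-- The two splittings are applied in succession: the square for Z separates V, and the square for Y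
separates U from what remains. -/
theorem assemble_bijective : Function.Bijective P.assemble := by
  have h₁ : Function.Bijective fun p : P.HAlong × P.HU => P.alongToRedZ p.1 + P.uToRedZ p.2 :=
    P.bicartesian_Y.decomposition P.idealIncl_comp_diff 1
  have h₂ : Function.Bijective fun p : P.HRedZ × P.HV => P.redZTo p.1 + P.vTo p.2 :=
    P.bicartesian_Z.decomposition P.toInvIdealAlong_comp_diffInv 1
  exact h₂.comp (h₁.prodMap Function.bijective_id)

/-- The first summand is `𝐇¹_dR(X, Y_red, Z_red)`. -/
def alongEquivRed : P.HAlong ≃ₗ[k] P.red.H1dR :=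
  LinearEquiv.ofBijective (Hyper.map 1 (twoTermMap (idealIncl P.Y P.Y.red (idealAt_red P.Y))
    (formsAlongIncl P.Y P.Z.red) P.bicartesian_Y.isPullback.w)) (P.bicartesian_Y.map_bijective 1)

/-- The second summand is `U(X, Y)`. -/
def uEquiv : P.HU ≃ₗ[k] P.U := hyperQuotient _

instance : Mono (toInvIdeal (k := k) P.Z P.Z.subRed) :=
  mono_toInvIdeal P.exists_coordinate _ _

/-- The quasi-isomorphism `[I_Y ⟶ I_Y I_{Z_red} I_Z⁻¹] ⟶ [𝒪_X ⟶ I_{Z_red} I_Z⁻¹]`. -/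
def vMap : P.HV →ₗ[k] Hyper 1 (twoTerm (toInvIdeal (k := k) P.Z P.Z.subRed)) :=
  Hyper.map 1 (twoTermMap (idealIncl P.Y (EffectiveDivisor.zero P.X) (ideal_le_zero P.Y))
    (invIdealAlongIncl P.Y P.Z) P.bicartesian_V.isPullback.w)

/-- The third summand is `V(X, Z)`. -/
def vEquiv : P.HV ≃ₗ[k] P.V :=
  (LinearEquiv.ofBijective P.vMap (P.bicartesian_V.map_bijective 1)).trans (hyperQuotient _)

/-- The decomposition of `𝐇¹_dR(X, Y, Z)`. -/
def decomposition : P.H1dR ≃ₗ[k] P.red.H1dR × P.U × P.V :=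
  (LinearEquiv.ofBijective P.assemble P.assemble_bijective).symm.trans
    (((P.alongEquivRed.prodCongr P.uEquiv).prodCongr P.vEquiv).trans (LinearEquiv.prodAssoc k _ _ _))

/-- As the decomposition is defined by inverting `assemble`, its properties are checked on assembled
elements. -/
theorem decomposition_assemble (c : P.HAlong) (u : P.HU) (v : P.HV) :
    P.decomposition (P.assemble ((c, u), v)) = (P.alongEquivRed c, P.uEquiv u, P.vEquiv v) := by
  have h : (LinearEquiv.ofBijective P.assemble P.assemble_bijective).symm
      (P.assemble ((c, u), v)) = ((c, u), v) :=
    (LinearEquiv.ofBijective P.assemble P.assemble_bijective).symm_apply_apply _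
  exact congrArg (((P.alongEquivRed.prodCongr P.uEquiv).prodCongr P.vEquiv).trans
    (LinearEquiv.prodAssoc k _ _ _)) h

theorem exists_eq_assemble (x : P.H1dR) :
    ∃ (c : P.HAlong) (u : P.HU) (v : P.HV), P.assemble ((c, u), v) = x := by
  obtain ⟨⟨⟨c, u⟩, v⟩, h⟩ := P.assemble_bijective.2 x
  exact ⟨c, u, v, h⟩

end CurveWithModulus

end CurveModulus

/-! ### Functoriality of the decomposition. -/

namespace CurveModulus

namespace CurveWithModulus

open EffectiveDivisor

variable {k : Type u} [Field k] [CharZero k] {P Q : CurveWithModulus k} (f : P ⟶ Q)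

/-- Pullback on the cohomology of `[I_Y ⟶ I_{Z_red}⁻¹ Ω¹]`. -/
def pullRedZ : Q.HRedZ →ₗ[k] P.HRedZ :=
  Hyper.pull f.toHom.base 1 (twoTermHom f.toHom.base (idealPull f.toHom Q.Y P.Y f.Y_le)
    (formsPull f.toHom Q.Z.red P.Z.red (redMap f).map_compl (redMap f).pullsBack)
    (diff_pull f.toHom Q.Y Q.Z.red P.Y P.Z.red f.Y_le _ _))

/-- Pullback on the first summand. -/
def pullAlong : Q.HAlong →ₗ[k] P.HAlong :=
  Hyper.pull f.toHom.base 1 (twoTermHom f.toHom.base (idealPull f.toHom Q.Y P.Y f.Y_le)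
    (formsAlongPull f.toHom Q.Y Q.Z.red P.Y P.Z.red f.Y_le (redMap f).map_compl
      (redMap f).pullsBack)
    (diffAlong_pull f.toHom Q.Y Q.Z.red P.Y P.Z.red f.Y_le _ _))

omit [CharZero k] in
theorem idealPull_red : idealPull f.toHom Q.Y P.Y f.Y_le ≫
      (pushf k f.toHom.base).map (idealIncl P.Y P.Y.red (idealAt_red P.Y)) =
    idealIncl (k := k) Q.Y Q.Y.red (idealAt_red Q.Y) ≫ idealPull f.toHom Q.Y.red P.Y.red
      (fun x => pullIdealAt_red_le f.toHom Q.Y P.Y x (f.Y_le x)) := rfl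

/-- Pullback on the second summand. -/
def pullU : Q.HU →ₗ[k] P.HU :=
  Hyper.pull f.toHom.base 1 (twoTermHom f.toHom.base (idealPull f.toHom Q.Y P.Y f.Y_le)
    (idealPull f.toHom Q.Y.red P.Y.red
      fun x => pullIdealAt_red_le f.toHom Q.Y P.Y x (f.Y_le x)) (idealPull_red f))

omit [CharZero k] in
theorem toInvIdealAlong_pull : idealPull f.toHom Q.Y P.Y f.Y_le ≫
      (pushf k f.toHom.base).map (toInvIdealAlong P.Y P.Z) =
    toInvIdealAlong (k := k) Q.Y Q.Z ≫ invIdealAlongPull f.toHom Q.Y Q.Z P.Y P.Z f.Y_le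
      f.map_compl f.Z_sub_red_ge := rfl

/-- Pullback on the third summand. -/
def pullV : Q.HV →ₗ[k] P.HV :=
  Hyper.pull f.toHom.base 1 (twoTermHom f.toHom.base (idealPull f.toHom Q.Y P.Y f.Y_le)
    (invIdealAlongPull f.toHom Q.Y Q.Z P.Y P.Z f.Y_le f.map_compl f.Z_sub_red_ge)
    (toInvIdealAlong_pull f))

theorem redFormsIncl_pull : redFormsIncl Q.Z ≫
      formsPull (k := k) f.toHom Q.Z P.Z f.map_compl f.pullsBack =
    formsPull (k := k) f.toHom Q.Z.red P.Z.red (redMap f).map_compl (redMap f).pullsBack ≫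
      (pushf k f.toHom.base).map (redFormsIncl P.Z) := rfl

theorem formsAlongIncl_pull : formsAlongIncl Q.Y Q.Z.red ≫
      formsPull (k := k) f.toHom Q.Z.red P.Z.red (redMap f).map_compl (redMap f).pullsBack =
    formsAlongPull (k := k) f.toHom Q.Y Q.Z.red P.Y P.Z.red f.Y_le (redMap f).map_compl
      (redMap f).pullsBack ≫ (pushf k f.toHom.base).map (formsAlongIncl P.Y P.Z.red) := rfl

theorem H1dRMap_redZTo (c : Q.HRedZ) :
    H1dRMap f f.pullsBack (Q.redZTo c) = P.redZTo (pullRedZ f c) := by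
  unfold redZTo pullRedZ H1dRMap
  exact Hyper.pull_map_id_comm f.toHom.base 1 _ _ _ _ (redFormsIncl_pull f) c

theorem pullRedZ_alongToRedZ (c : Q.HAlong) :
    pullRedZ f (Q.alongToRedZ c) = P.alongToRedZ (pullAlong f c) := by
  unfold alongToRedZ pullRedZ pullAlong
  exact Hyper.pull_map_id_comm f.toHom.base 1 _ _ _ _ (formsAlongIncl_pull f) c

theorem pullRedZ_uToRedZ (c : Q.HU) :
    pullRedZ f (Q.uToRedZ c) = P.uToRedZ (pullU f c) := by
  unfold uToRedZ pullRedZ pullU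
  exact Hyper.pull_map_id_comm f.toHom.base 1 _ _ _ _ (diff_pull f.toHom _ _ _ _ _ _ _).symm c

theorem H1dRMap_vTo (c : Q.HV) : H1dRMap f f.pullsBack (Q.vTo c) = P.vTo (pullV f c) := by
  unfold vTo pullV H1dRMap
  exact Hyper.pull_map_id_comm f.toHom.base 1 _ _ _ _ (diffInv_pull f.toHom _ _ _ _ _ _ _ _ _ _) c

/-- Each constituent of `assemble` is an inclusion of forms or the differential, and both commute
with pullback. -/
theorem H1dRMap_assemble (c : Q.HAlong) (u : Q.HU) (v : Q.HV) :
    H1dRMap f f.pullsBack (Q.assemble ((c, u), v)) =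
      P.assemble ((pullAlong f c, pullU f u), pullV f v) := by
  rw [assemble_apply, assemble_apply, map_add, H1dRMap_redZTo, H1dRMap_vTo, map_add,
    pullRedZ_alongToRedZ, pullRedZ_uToRedZ]

/-- The quasi-isomorphism to the reduced complex consists of inclusions, which commute with pullback
on germs. -/
theorem alongEquivRed_pull (c : Q.HAlong) : P.alongEquivRed (pullAlong f c) =
    H1dRMap (redMap f) (redMap f).pullsBack (Q.alongEquivRed c) :=
  (Hyper.pull_map_comm f.toHom.base 1 Q.bicartesian_Y.isPullback.w P.bicartesian_Y.isPullback.w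
    _ _ rfl rfl c).symm

omit [CharZero k] in
theorem uEquiv_pull (u : Q.HU) : P.uEquiv (pullU f u) = UMap f (Q.uEquiv u) :=
  hyperQuotient_pull f.toHom.base _ _ _ _ _ u

theorem vEquiv_pull (v : Q.HV) : P.vEquiv (pullV f v) = VMap f (Q.vEquiv v) :=
  (congrArg (hyperQuotient (toInvIdeal (k := k) P.Z P.Z.subRed))
    (Hyper.pull_map_comm f.toHom.base 1 Q.bicartesian_V.isPullback.w P.bicartesian_V.isPullback.w
      (toInvIdealAlong_pull f) (α₁ := idealPull f.toHom (EffectiveDivisor.zero Q.X)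
        (EffectiveDivisor.zero P.X) fun _ => by simp [idealAt, EffectiveDivisor.zero])
      (β₁ := invIdealPull f.toHom Q.Z Q.Z.subRed P.Z P.Z.subRed f.map_compl f.Z_sub_red_ge)
      rfl rfl rfl v).symm).trans
    (hyperQuotient_pull f.toHom.base _ _ _ _ _ (Q.vMap v))

/-- The decomposition is functorial. -/
theorem decomposition_pull (x : Q.H1dR) : P.decomposition (H1dRMap f f.pullsBack x) =
    (H1dRMap (redMap f) (redMap f).pullsBack (Q.decomposition x).1,
      UMap f (Q.decomposition x).2.1, VMap f (Q.decomposition x).2.2) := by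
  obtain ⟨c, u, v, rfl⟩ := Q.exists_eq_assemble x
  rw [H1dRMap_assemble, decomposition_assemble, decomposition_assemble, alongEquivRed_pull,
    uEquiv_pull, vEquiv_pull]

end CurveWithModulus

end CurveModulus

/-! ### The inclusion and the projection of the reduced summand. -/

namespace CurveModulus

namespace EffectiveDivisor

variable {k : Type u} [Field k] {X X' : Scheme.{u}} [X.Over (Spec (CommRingCat.of k))]
  [X'.Over (Spec (CommRingCat.of k))] (f : X ⟶ X') [f.IsOver (Spec (CommRingCat.of k))]

theorem idealIncl_comp_idealPull (Y' E' : EffectiveDivisor X') (Y : EffectiveDivisor X)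
    (hY : ∀ x, pullIdealAt f Y' x ≤ Y.idealAt x) (hE : ∀ x, pullIdealAt f E' x ≤ Y.idealAt x)
    (h : ∀ x, Y'.idealAt x ≤ E'.idealAt x) :
    idealIncl Y' E' h ≫ idealPull f E' Y hE = idealPull (k := k) f Y' Y hY := rfl

theorem redFormsIncl_comp_formsPull (Y' Z' : EffectiveDivisor X') (Z : EffectiveDivisor X)
    (hZ : ∀ x ∈ Z.compl, f x ∈ Z'.compl) (h : PullsBackForms (k := k) f Z' Z hZ)
    (hZr : ∀ x ∈ Z.compl, f x ∈ Z'.red.compl) (hr : PullsBackForms (k := k) f Z'.red Z hZr) :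
    (formsAlongIncl Y' Z'.red ≫ redFormsIncl Z') ≫ formsPull (k := k) f Z' Z hZ h =
      formsAlongIncl Y' Z'.red ≫ formsPull f Z'.red Z hZr hr := rfl

theorem idealPull_comp_toInvIdealAlong (Y' : EffectiveDivisor X') (Y E Z : EffectiveDivisor X)
    (hY : ∀ x, pullIdealAt f Y' x ≤ Y.idealAt x) (hE : ∀ x, pullIdealAt f Y' x ≤ E.idealAt x)
    (h : ∀ x, Y.idealAt x ≤ E.idealAt x) :
    idealPull (k := k) f Y' Y hY ≫ (pushf k f.base).map (idealIncl Y E h ≫ toInvIdealAlong E Z) =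
      idealPull (k := k) f Y' E hE ≫ (pushf k f.base).map (toInvIdealAlong E Z) := rfl

theorem formsPull_comp_redFormsIncl (Z' : EffectiveDivisor X') (Z : EffectiveDivisor X)
    (hZ : ∀ x ∈ Z.compl, f x ∈ Z'.compl) (h : PullsBackForms (k := k) f Z' Z hZ)
    (hZr : ∀ x ∈ Z.red.compl, f x ∈ Z'.compl) (hr : PullsBackForms (k := k) f Z' Z.red hZr) :
    formsPull (k := k) f Z' Z hZ h ≫ (pushf k f.base).map (𝟙 _) =
      formsPull f Z' Z.red hZr hr ≫ (pushf k f.base).map (redFormsIncl Z) := rfl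

end EffectiveDivisor

namespace CurveWithModulus

open EffectiveDivisor

variable {k : Type u} [Field k] [CharZero k] (P : CurveWithModulus k)

/-- The map from the first summand to `𝐇¹_dR(X, Y, Z)`. -/
def alongTo : P.HAlong →ₗ[k] P.H1dR :=
  Hyper.map 1 (twoTermMap (d' := diff P.Y P.Z) (𝟙 _)
    (formsAlongIncl P.Y P.Z.red ≫ redFormsIncl P.Z) rfl)

omit [CharZero k] in
theorem redZTo_alongToRedZ (c : P.HAlong) : P.redZTo (P.alongToRedZ c) = P.alongTo c := by
  unfold redZTo alongToRedZ alongTo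
  exact Hyper.map_map_eq 1 _ _ _ (Category.comp_id _) rfl c

/-- Both sides are induced by the inclusion of [I_Y ⟶ F] into the complex [I_{Y_red} ⟶ I_Z⁻¹ Ω¹],
where F ⊆ I_{Z_red}⁻¹ Ω¹ is the subsheaf `formsAlong`. -/
theorem H1dRMap_redYTo_alongTo (c : P.HAlong) :
    H1dRMap P.redYTo P.redYTo.pullsBack (P.alongTo c) =
      H1dRMap P.redYToRed P.redYToRed.pullsBack (P.alongEquivRed c) := by
  unfold H1dRMap alongTo
  have : Scheme.Hom.IsOver (𝟙 P.X) (Spec (CommRingCat.of k)) := P.redYTo.isOver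
  exact Hyper.pull_map_eq P.redYTo.toHom.base 1 _ P.bicartesian_Y.isPullback.w _ _
    ((Category.id_comp _).trans
      (idealIncl_comp_idealPull (k := k) (𝟙 P.X) _ _ _ _ _ (idealAt_red P.Y)).symm)
    (redFormsIncl_comp_formsPull (k := k) (𝟙 P.X) _ _ _ _ _ _ _) c

/-- The inclusion of the first summand is compatible with the maps
`𝐇¹_dR(X, Y, Z) → 𝐇¹_dR(X, Y_red, Z) ← 𝐇¹_dR(X, Y_red, Z_red)`. -/
theorem H1dRMap_redYTo_decomposition_symm (c : P.red.H1dR) :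
    H1dRMap P.redYTo P.redYTo.pullsBack (P.decomposition.symm (c, 0, 0)) =
      H1dRMap P.redYToRed P.redYToRed.pullsBack c := by
  obtain ⟨c, rfl⟩ := P.alongEquivRed.surjective c
  -- The inverse is evaluated by assembling c with zero in the other two summands.
  have h : P.decomposition.symm (P.alongEquivRed c, 0, 0) = P.redZTo (P.alongToRedZ c) := by
    rw [LinearEquiv.symm_apply_eq]
    have h' := P.decomposition_assemble c 0 0
    rw [assemble_apply, map_zero, map_zero, map_zero, map_zero, add_zero, add_zero] at h'
    exact h'.symm
  rw [h, redZTo_alongToRedZ, H1dRMap_redYTo_alongTo]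

/-- The cohomology of `[I_{Y_red} I_{Z_red} I_Z⁻¹ ⟶ I_Z⁻¹ Ω¹]`. -/
abbrev HInv : Type (u + 1) := Hyper 1 (twoTerm (diffInv P.exists_coordinate P.Y.red P.Z))

/-- The map `[I_Y ⟶ I_Z⁻¹ Ω¹] ⟶ [I_{Y_red} I_{Z_red} I_Z⁻¹ ⟶ I_Z⁻¹ Ω¹]`. -/
def toHInv : P.H1dR →ₗ[k] P.HInv :=
  Hyper.map 1 (twoTermMap (d := diff P.Y P.Z)
    (idealIncl P.Y P.Y.red (idealAt_red P.Y) ≫ toInvIdealAlong P.Y.red P.Z) (𝟙 _) rfl)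

/-- The quasi-isomorphism
`[I_{Y_red} ⟶ I_{Z_red}⁻¹ Ω¹] ⟶ [I_{Y_red} I_{Z_red} I_Z⁻¹ ⟶ I_Z⁻¹ Ω¹]`. -/
def redToHInv : P.red.H1dR →ₗ[k] P.HInv :=
  Hyper.map 1 (twoTermMap (d := diff P.Y.red P.Z.red) (toInvIdealAlong P.Y.red P.Z)
    (redFormsIncl P.Z) rfl)

/-- The square for Z, taken for (X, Y_red, Z), is a quasi-isomorphism between these two complexes.
-/
theorem redToHInv_injective : Function.Injective P.redToHInv :=
  ((bicartesian_polarForms P.exists_coordinate P.redY.disjoint).map_bijective 1).1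

theorem toHInv_alongTo (c : P.HAlong) : P.toHInv (P.alongTo c) = P.redToHInv (P.alongEquivRed c) := by
  unfold toHInv alongTo redToHInv
  have w : (idealIncl P.Y P.Y.red (idealAt_red P.Y) ≫ toInvIdealAlong P.Y.red P.Z) ≫
        diffInv P.exists_coordinate P.Y.red P.Z =
      diffAlong (k := k) P.Y P.Z.red ≫ formsAlongIncl P.Y P.Z.red ≫ redFormsIncl P.Z := rfl
  exact (Hyper.map_map_eq 1 _ _ w (Category.id_comp _) (Category.comp_id _) c).trans
    (Hyper.map_map_eq 1 P.bicartesian_Y.isPullback.w _ w rfl rfl c).symm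

/-- The map `[I_Y ⟶ I_{Y_red}] ⟶ [I_Y ⟶ I_Z⁻¹ Ω¹]` given by `d`. -/
def uTo : P.HU →ₗ[k] P.H1dR :=
  Hyper.map 1 (twoTermMap (d' := diff P.Y P.Z) (𝟙 _) (diff P.Y.red P.Z) rfl)

omit [CharZero k] in
theorem redZTo_uToRedZ (u : P.HU) : P.redZTo (P.uToRedZ u) = P.uTo u := by
  unfold redZTo uToRedZ uTo
  exact Hyper.map_map_eq 1 _ _ _ (Category.comp_id _) rfl u

/-- In the target complex the differential is already defined on I_{Y_red}, so the morphism extends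
over degree 1 and factors through an acyclic complex. -/
theorem toHInv_uTo (u : P.HU) : P.toHInv (P.uTo u) = 0 := by
  unfold toHInv uTo
  exact (Hyper.map_map_eq 1 _ _ _ (Category.id_comp _) (Category.comp_id _) u).trans
    (Hyper.map_eq_zero_of_lift 1 (d' := diffInv P.exists_coordinate P.Y.red P.Z)
      (idealIncl P.Y P.Y.red (idealAt_red P.Y) ≫ toInvIdealAlong P.Y.red P.Z)
      (toInvIdealAlong P.Y.red P.Z) rfl u)

/-- As for U, with the extension given by the inclusion of I_Y I_{Z_red} I_Z⁻¹ in I_{Y_red}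
I_{Z_red} I_Z⁻¹. -/
theorem toHInv_vTo (v : P.HV) : P.toHInv (P.vTo v) = 0 := by
  unfold toHInv vTo
  exact (Hyper.map_map_eq 1 _ _ _ (Category.id_comp _) (Category.comp_id _) v).trans
    (Hyper.map_eq_zero_of_lift 1 (d' := diffInv P.exists_coordinate P.Y.red P.Z)
      (idealIncl P.Y P.Y.red (idealAt_red P.Y) ≫ toInvIdealAlong P.Y.red P.Z)
      (invIdealAlongMono P.Y P.Y.red P.Z (idealAt_red P.Y)) rfl v)

/-- The U and V summands die, and on the remaining summand the two maps agree; since `redToHInv` is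
injective, this characterizes the projection b by maps of complexes alone. -/
theorem toHInv_eq (x : P.H1dR) : P.toHInv x = P.redToHInv (P.decomposition x).1 := by
  obtain ⟨c, u, v, rfl⟩ := P.exists_eq_assemble x
  rw [decomposition_assemble, assemble_apply, map_add, map_add, map_add, redZTo_alongToRedZ,
    redZTo_uToRedZ, toHInv_alongTo, toHInv_uTo, toHInv_vTo, add_zero, add_zero]

/-- Both composites are the inclusion of [I_Y ⟶ I_{Z_red}⁻¹ Ω¹] in [I_{Y_red} I_{Z_red} I_Z⁻¹ ⟶
I_Z⁻¹ Ω¹]. -/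
theorem toHInv_H1dRMap_toRedZ (c : P.redZ.H1dR) :
    P.toHInv (H1dRMap P.toRedZ P.toRedZ.pullsBack c) =
      P.redToHInv (H1dRMap P.redToRedZ P.redToRedZ.pullsBack c) := by
  unfold toHInv redToHInv H1dRMap
  have : Scheme.Hom.IsOver (𝟙 P.X) (Spec (CommRingCat.of k)) := P.toRedZ.isOver
  exact Hyper.map_pull_eq P.toRedZ.toHom.base 1 _ _ _ _
    (idealPull_comp_toInvIdealAlong (k := k) (𝟙 P.X) _ _ _ _ _ _ (idealAt_red P.Y))
    (formsPull_comp_redFormsIncl (k := k) (𝟙 P.X) _ _ _ _ _ _) c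

/-- The projection to the first summand is compatible with the maps
`𝐇¹_dR(X, Y, Z) ← 𝐇¹_dR(X, Y, Z_red) → 𝐇¹_dR(X, Y_red, Z_red)`. -/
theorem decomposition_H1dRMap_toRedZ (c : P.redZ.H1dR) :
    (P.decomposition (H1dRMap P.toRedZ P.toRedZ.pullsBack c)).1 =
      H1dRMap P.redToRedZ P.redToRedZ.pullsBack c :=
  P.redToHInv_injective ((P.toHInv_eq _).symm.trans (P.toHInv_H1dRMap_toRedZ c))

end CurveWithModulus

end CurveModulus

end

theorem mainTheorem6 (k : Type u) [Field k] [CharZero k] :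
    -- pullback of differential forms along a morphism of curves with modulus respects the bounds
    -- on the poles, so that it induces pullback maps on de Rham cohomology
    ∃ hΩ : ∀ {P Q : CurveModulus.CurveWithModulus k} (f : P ⟶ Q), f.PullsBack,
    -- the decomposition `𝐇¹_dR(X, Y, Z) ≅ 𝐇¹_dR(X, Y_red, Z_red) ⊕ U(X, Y) ⊕ V(X, Z)`
    ∃ dec : ∀ P : CurveModulus.CurveWithModulus k, P.H1dR ≃ₗ[k] P.red.H1dR × P.U × P.V,
      -- it is functorial
      (∀ {P Q : CurveModulus.CurveWithModulus k} (f : P ⟶ Q) (c : Q.H1dR),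
        dec P (CurveModulus.CurveWithModulus.H1dRMap f (hΩ f) c) =
          (CurveModulus.CurveWithModulus.H1dRMap (CurveModulus.CurveWithModulus.redMap f)
              (hΩ (CurveModulus.CurveWithModulus.redMap f)) (dec Q c).1,
            CurveModulus.CurveWithModulus.UMap f (dec Q c).2.1,
            CurveModulus.CurveWithModulus.VMap f (dec Q c).2.2)) ∧
      -- the inclusion of the first summand is compatible with the maps
      -- `𝐇¹_dR(X, Y, Z) → 𝐇¹_dR(X, Y_red, Z) ← 𝐇¹_dR(X, Y_red, Z_red)`
      (∀ (P : CurveModulus.CurveWithModulus k) (c : P.red.H1dR),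
        CurveModulus.CurveWithModulus.H1dRMap P.redYTo (hΩ P.redYTo) ((dec P).symm (c, 0, 0)) =
          CurveModulus.CurveWithModulus.H1dRMap P.redYToRed (hΩ P.redYToRed) c) ∧
      -- the projection to the first summand is compatible with the maps
      -- `𝐇¹_dR(X, Y, Z) ← 𝐇¹_dR(X, Y, Z_red) → 𝐇¹_dR(X, Y_red, Z_red)`
      (∀ (P : CurveModulus.CurveWithModulus k) (c : P.redZ.H1dR),
        (dec P (CurveModulus.CurveWithModulus.H1dRMap P.toRedZ (hΩ P.toRedZ) c)).1 =
          CurveModulus.CurveWithModulus.H1dRMap P.redToRedZ (hΩ P.redToRedZ) c) :=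
  ⟨fun f => f.pullsBack, fun P => P.decomposition,
    fun f => CurveModulus.CurveWithModulus.decomposition_pull f,
    fun P => P.H1dRMap_redYTo_decomposition_symm, fun P => P.decomposition_H1dRMap_toRedZ⟩
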